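/- **Setting.** Let $\hat\Omega\subset\mathbb R^2$ be a simply connected open set and $\Gamma_f:=\partial\hat\Omega$. Let $\Omega\subset\hat\Omega$ be a bounded connected open set with Lipschitz boundary such that $\Gamma_f\subset\partial\Omega$ and such that the free boundary $\Gamma_\Omega:=\partial\Omega\setminus\Gamma_f$ is nonempty and closed (so $\partial\Omega$ is the disjoint union of the closed sets $\Gamma_f$ and $\Gamma_\Omega$). Let $h>0$, $g_D\in H^{1/2}(\Gamma_f)$, $g_N\in H^{-1/2}(\Gamma_f)$, and let $\langle\cdot,\cdot\rangle_{\Gamma_f}$ denote the $L^2(\Gamma_f)$ product with respect to arc length, and also the duality pairing with $g_N$. Let $\boldsymbol\theta:\mathbb R^2\to\mathbb R^2$ be a $C^1$ vector field with $\boldsymbol\theta=0$ on $\Gamma_f$, and put $\Omega_t:=\{x+t\boldsymbol\theta(x):x\in\Omega\}$. Let $\delta>0$, let $U\subset\mathbb R^2$ be an open set with $\Omega_t\subset U$ for all $|t|<\delta$, and let $f\in H^1(U)$ be independent of $t$. For a domain $D$ write $\Gamma_D:=\partial D\setminus\Gamma_f$ and $V(D):=\{v\in H^1(D): v=0\text{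 on }\Gamma_D\}$ (in the sense of traces). For $w,v\in V(D)$ define the Lagrangian $$\mathcal L(D,w,v)=\tfrac12h^{-1}\|g_D-w\|_{L^2(\Gamma_f)}^2-\int_D\nabla w\cdot\nabla v\,dx+\int_D f\,v\,dx+\langle g_N,v\rangle_{\Gamma_f}.$$ For every $|t|<\delta$ let $u_t\in V(\Omega_t)$ and $p_t\in V(\Omega_t)$ be solutions of the state and adjoint problems $$\int_{\Omega_t}\nabla u_t\cdot\nabla v\,dx=\int_{\Omega_t}f\,v\,dx+\langle g_N,v\rangle_{\Gamma_f},\qquad \int_{\Omega_t}\nabla v\cdot\nabla p_t\,dx=h^{-1}\langle u_t-g_D,v\rangle_{\Gamma_f}\qquad\forall v\in V(\Omega_t),$$ and write $u=u_0$, $p=p_0$. **Lemma.** The shape derivative of the Lagrangian at the state/adjoint pair, $$D_{\Omega,\boldsymbol\theta}\mathcal L(\Omega,u,p):=\lim_{t\to0}\frac1t\bigl(\mathcal L(\Omega_t,u_t,p_t)-\mathcal L(\Omega,u,p)\bigr),$$ exists and has the representation $$D_{\Omega,\boldsymbol\theta}\mathcal L(\Omega,u,p)=\int_\Omega(\nabla\cdot\boldsymbol\theta)\,(f\,p-\nabla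 u\cdot\nabla p)\,dx+\int_\Omega\nabla u\cdot S(\boldsymbol\theta)\nabla p\,dx+\int_\Omega(\nabla f\cdot\boldsymbol\theta)\,p\,dx,$$ where $S(\boldsymbol\theta)=D\boldsymbol\theta+(D\boldsymbol\theta)^{t}$. -/

import Mathlib

open MeasureTheory Set Filter Topology

noncomputable section

namespace BernoulliShape

/-- The Euclidean plane. -/
abbrev Plane : Type := EuclideanSpace ℝ (Fin 2)

/-! ### Domains and boundaries -/

/-- Near each of its boundary points, `Ω` coincides, after a rotation or reflection of the plane,
with the set of points strictly below the graph of a Lipschitz function. -/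
def HasLipschitzBoundary (Ω : Set Plane) : Prop :=
  ∀ x ∈ frontier Ω, ∃ (R : Plane ≃ₗᵢ[ℝ] Plane) (γ : ℝ → ℝ) (K : NNReal) (r : ℝ),
    0 < r ∧ LipschitzWith K γ ∧ ∀ y ∈ Metric.ball x r, y ∈ Ω ↔ R y 1 < γ (R y 0)

/-- The free part `∂Ω ∖ Γf` of the boundary of `Ω`, where `Γf` is the fixed part. -/
def freeBoundary (Γf Ω : Set Plane) : Set Plane := frontier Ω \ Γf

/-- The family of admissible domains: bounded connected open subsets `Ω` of the hold-all domain
`Ωhat` with Lipschitz boundary `∂Ω = ∂Ωhat ∪ Γ`, where the free part `Γ` is nonempty and does not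
meet `∂Ωhat` (both parts are closed sets). -/
structure IsAdmissible (Ωhat Ω : Set Plane) : Prop where
  isOpen : IsOpen Ω
  isConnected : IsConnected Ω
  isBounded : Bornology.IsBounded Ω
  subset : Ω ⊆ Ωhat
  lipschitz : HasLipschitzBoundary Ω
  fixed_subset : frontier Ωhat ⊆ frontier Ω
  free_nonempty : (freeBoundary (frontier Ωhat) Ω).Nonempty
  free_closed : IsClosed (freeBoundary (frontier Ωhat) Ω)

/-! ### Sobolev functions and traces -/

/-- `G` is the weak gradient of `v` in the open set `Ω`. -/
def IsWeakGradient (Ω : Set Plane) (v : Plane → ℝ) (G : Plane → Plane) : Prop :=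
  ∀ φ : Plane → ℝ, ContDiff ℝ (⊤ : ℕ∞) φ → HasCompactSupport φ → tsupport φ ⊆ Ω →
    ∫ x in Ω, φ x • G x = -∫ x in Ω, v x • gradient φ x

/-- `v ∈ H¹(Ω)`. -/
def MemH1 (Ω : Set Plane) (v : Plane → ℝ) : Prop :=
  MemLp v 2 (volume.restrict Ω) ∧
    ∃ G : Plane → Plane, MemLp G 2 (volume.restrict Ω) ∧ IsWeakGradient Ω v G

open Classical in
/-- The weak gradient of `v ∈ H¹(Ω)`, a square integrable field on `Ω` that is unique up to
equality almost everywhere in `Ω` (and `0` by convention if there is none). -/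
def weakGrad (Ω : Set Plane) (v : Plane → ℝ) : Plane → Plane :=
  if h : ∃ G : Plane → Plane, MemLp G 2 (volume.restrict Ω) ∧ IsWeakGradient Ω v G
  then h.choose else 0

/-- Arc length on the curve `Γ`. -/
def arcLength (Γ : Set Plane) : Measure Plane := (μH[1] : Measure Plane).restrict Γ

/-- `g ∈ L²(Γ)` is the trace of `v ∈ H¹(Ω)` on the part `Γ` of the boundary of `Ω`: some sequence
of functions that are `C¹` on the plane converges to `v` in `H¹(Ω)`, and its restrictions to `Γ`
converge to `g` in `L²(Γ)`. -/
def HasTrace (Ω Γ : Set Plane) (v g : Plane → ℝ) : Prop :=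
  MemH1 Ω v ∧ MemLp g 2 (arcLength Γ) ∧
    ∃ φ : ℕ → Plane → ℝ, (∀ n, ContDiff ℝ 1 (φ n)) ∧
      Tendsto (fun n => eLpNorm (fun x => φ n x - v x) 2 (volume.restrict Ω)) atTop (𝓝 0) ∧
      Tendsto (fun n => eLpNorm (fun x => gradient (φ n) x - weakGrad Ω v x) 2
        (volume.restrict Ω)) atTop (𝓝 0) ∧
      Tendsto (fun n => eLpNorm (fun x => φ n x - g x) 2 (arcLength Γ)) atTop (𝓝 0)

open Classical in
/-- The trace of `v ∈ H¹(Ω)` on `Γ`, unique up to equality almost everywhere on `Γ` if `Ω` has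
Lipschitz boundary (and `0` by convention if there is none). -/
def trace (Ω Γ : Set Plane) (v : Plane → ℝ) : Plane → ℝ :=
  if h : ∃ g : Plane → ℝ, HasTrace Ω Γ v g then h.choose else 0

/-- `v` lies in the space of all `H¹(Ω)` functions that vanish, in the sense of traces, on the free
boundary of `Ω`. -/
def MemV (Γf Ω : Set Plane) (v : Plane → ℝ) : Prop :=
  MemH1 Ω v ∧ HasTrace Ω (freeBoundary Γf Ω) v 0

/-! ### The boundary data spaces -/

/-- The squared Sobolev–Slobodeckij norm of `H^{1/2}(Γ)`, with values in `[0, ∞]`. -/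
def hHalfNormSq (Γ : Set Plane) (g : Plane → ℝ) : ENNReal :=
  (∫⁻ x, ENNReal.ofReal (g x ^ 2) ∂arcLength Γ) +
    ∫⁻ x, ∫⁻ y, ENNReal.ofReal ((g x - g y) ^ 2 / dist x y ^ 2) ∂arcLength Γ ∂arcLength Γ

/-- `g ∈ H^{1/2}(Γ)`. -/
def MemHHalf (Γ : Set Plane) (g : Plane → ℝ) : Prop :=
  MemLp g 2 (arcLength Γ) ∧ hHalfNormSq Γ g ≠ ⊤

/-- An element of `H^{-1/2}(Γ)`: a bounded linear functional on (classes modulo equality almost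
everywhere of functions in) `H^{1/2}(Γ)`. Its values outside `H^{1/2}(Γ)` have no meaning. -/
structure HMinusHalf (Γ : Set Plane) where
  /-- the duality pairing with a function on `Γ` -/
  pairing : (Plane → ℝ) → ℝ
  congr_ae : ∀ g₁ g₂ : Plane → ℝ, g₁ =ᵐ[arcLength Γ] g₂ → pairing g₁ = pairing g₂
  map_add : ∀ g₁ g₂ : Plane → ℝ, MemHHalf Γ g₁ → MemHHalf Γ g₂ →
    pairing (g₁ + g₂) = pairing g₁ + pairing g₂
  map_smul : ∀ (c : ℝ) (g : Plane → ℝ), MemHHalf Γ g → pairing (c • g) = c * pairing g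
  bounded : ∃ C : ℝ, ∀ g : Plane → ℝ, MemHHalf Γ g →
    |pairing g| ≤ C * Real.sqrt (hHalfNormSq Γ g).toReal

/-! ### State, adjoint and Lagrangian -/

/-- The Dirichlet form `a(w, v) = ∫_Ω ∇w · ∇v`. -/
def dirichletForm (Ω : Set Plane) (w v : Plane → ℝ) : ℝ :=
  ∫ x in Ω, inner ℝ (weakGrad Ω w x) (weakGrad Ω v x)

/-- The load `l(v) = ∫_Ω f v + ⟨gN, v⟩` on `Γf`. -/
def load (Γf : Set Plane) (f : Plane → ℝ) (gN : HMinusHalf Γf) (Ω : Set Plane)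
    (v : Plane → ℝ) : ℝ :=
  (∫ x in Ω, f x * v x) + gN.pairing (trace Ω Γf v)

/-- `u` is the state in `Ω`: the weak solution of `-Δu = f` in `Ω` with `u = 0` on the free boundary
and normal derivative `gN` on `Γf`. -/
def IsState (Γf : Set Plane) (f : Plane → ℝ) (gN : HMinusHalf Γf) (Ω : Set Plane)
    (u : Plane → ℝ) : Prop :=
  MemV Γf Ω u ∧ ∀ v : Plane → ℝ, MemV Γf Ω v → dirichletForm Ω u v = load Γf f gN Ω v

/-- `p` is the adjoint state in `Ω` that belongs to `u`. -/
def IsAdjoint (Γf : Set Plane) (h : ℝ) (gD : Plane → ℝ) (Ω : Set Plane)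
    (u p : Plane → ℝ) : Prop :=
  MemV Γf Ω p ∧ ∀ v : Plane → ℝ, MemV Γf Ω v →
    dirichletForm Ω v p =
      h⁻¹ * ∫ x, (trace Ω Γf u x - gD x) * trace Ω Γf v x ∂arcLength Γf

/-- The Lagrangian `L(Ω, u, v) = (1/2) h⁻¹ ‖gD - u‖² - a(u, v) + l(v)`, the norm being that of
`L²(Γf)`. -/
def lagrangian (Γf : Set Plane) (h : ℝ) (f gD : Plane → ℝ) (gN : HMinusHalf Γf)
    (Ω : Set Plane) (u v : Plane → ℝ) : ℝ :=
  1 / 2 * h⁻¹ * (∫ x, (gD x - trace Ω Γf u x) ^ 2 ∂arcLength Γf)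
    - dirichletForm Ω u v + load Γf f gN Ω v

/-! ### Domain perturbations -/

/-- The perturbed domain `Ω_t(θ) = {x + t θ(x) : x ∈ Ω}`. -/
def perturbed (Ω : Set Plane) (θ : Plane → Plane) (t : ℝ) : Set Plane :=
  (fun x => x + t • θ x) '' Ω

/-- The divergence of `θ`, the trace of its derivative. -/
def divergence (θ : Plane → Plane) (x : Plane) : ℝ :=
  LinearMap.trace ℝ Plane (fderiv ℝ θ x : Plane →ₗ[ℝ] Plane)

/-- `S(θ) = Dθ + (Dθ)ᵗ`. -/
def symGrad (θ : Plane → Plane) (x : Plane) : Plane →L[ℝ] Plane :=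
  fderiv ℝ θ x + ContinuousLinearMap.adjoint (fderiv ℝ θ x)

end BernoulliShape

end

open BernoulliShape

/-! The first derivative can be found without differentiating the adjoint. Since `u t` solves the
state equation, the last two terms of the Lagrangian cancel, whatever the second argument in V is:
its value is h⁻¹/2 times the squared boundary misfit of `u t`. Put T = id + tθ, A = |det DT|
(DT)⁻¹(DT)⁻*, and e = u_t ∘ T - u. As T fixes Γf pointwise, u_t ∘ T has the same trace there as u_t,
and e lies in V(Ω). Expanding the square and testing the adjoint equation on Ω with e gives
(`lagrangian_image_sub`)

L(Ω_t, u_t, p_t) - L(Ω, u, p) = ∫ ∇e · ∇p + (1/(2h)) ‖e‖² on Γf.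

Transporting the state equation to Ω and subtracting the one on Ω removes the Neumann datum
(`IsState.pullback_sub`): for all w in V(Ω),

∫ (A(∇u + ∇e) - ∇u) · ∇w = ∫ (|det DT| f∘T - f) w.

With w = e, ellipticity and the Poincaré inequality yield ‖∇e‖ = O(t) (`energy_error_le`), so the
boundary square is O(t²) by the trace inequality. With w = p, the expansions A = 1 + t(div θ - S(θ))
+ O(t²) (`exists_expansion`) and |det DT| f∘T = f + t(f div θ + ∇f·θ) + o(t) in L²
(`exists_source_expansion`) determine ∫ ∇e · ∇p up to o(t) (`linear_term_error_le`). This is the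
asserted formula.

The analytic burden lies in three places. The expansion of f∘T must hold for f in H¹(U) on an
arbitrary open U, where no extension or global smooth approximation is at hand; it is proved by
mollifying along the segments from x to x + tθ(x) and passing to the limit with Fatou's lemma
(`exists_eLpNorm_difference_le`). The trace and Poincaré inequalities are derived from boundary
charts for C¹ functions and extended by approximation (`exists_trace_inequality`,
`exists_poincare_inequality`). Finally, θ is merely C¹, so it is first cut off outside a ball
containing Ω (`exists_cutoff_field`). Lipschitz regularity is used only for Ω; everything on Ω_t is
obtained by transport. -/

namespace BernoulliShape

/-! ### Square integrable functions -/

section SquareIntegrable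

variable {α : Type*} [MeasurableSpace α] {μ : Measure α}

lemma eLpNorm_two_sq {E : Type*} [NormedAddCommGroup E] (g : α → E) :
    eLpNorm g 2 μ ^ 2 = ∫⁻ x, ‖g x‖ₑ ^ 2 ∂μ := by
  have := eLpNorm_nnreal_pow_eq_lintegral (μ := μ) (f := g) (p := 2) (by norm_num)
  simpa using this

lemma sq_lintegral_le {f : α → ENNReal} (hf : AEMeasurable f μ) :
    (∫⁻ x, f x ∂μ) ^ 2 ≤ μ univ * ∫⁻ x, f x ^ 2 ∂μ := by
  have h := ENNReal.lintegral_mul_le_Lp_mul_Lq μ Real.HolderConjugate.two_two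
    (aemeasurable_const (b := (1 : ENNReal))) hf
  simp only [Pi.mul_apply, one_mul, ENNReal.rpow_ofNat, one_pow, lintegral_one] at h
  calc (∫⁻ x, f x ∂μ) ^ 2
      ≤ (μ univ ^ (1 / 2 : ℝ) * (∫⁻ x, f x ^ 2 ∂μ) ^ (1 / 2 : ℝ)) ^ 2 := by gcongr
    _ = _ := by
      rw [mul_pow, ← ENNReal.rpow_two, ← ENNReal.rpow_two (_ ^ (1 / 2 : ℝ)), ← ENNReal.rpow_mul,
        ← ENNReal.rpow_mul]
      norm_num

lemma enorm_integral_sq_le {E : Type*} [NormedAddCommGroup E] [NormedSpace ℝ E] {k : α → E}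
    (hk : AEStronglyMeasurable k μ) :
    ‖∫ x, k x ∂μ‖ₑ ^ 2 ≤ μ univ * ∫⁻ x, ‖k x‖ₑ ^ 2 ∂μ :=
  (pow_le_pow_left' (enorm_integral_le_lintegral_enorm k) 2).trans (sq_lintegral_le hk.enorm)

lemma eLpNorm_one_le_of_norm_le_mul {E F H : Type*} [NormedAddCommGroup E] [NormedAddCommGroup F]
    [NormedAddCommGroup H] {ξ : α → E} {η : α → F} {k : α → H} (hξ : MemLp ξ 2 μ)
    (hη : MemLp η 2 μ) {C : ℝ} (hk : ∀ᵐ x ∂μ, ‖k x‖ ≤ C * (‖ξ x‖ * ‖η x‖)) :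
    eLpNorm k 1 μ ≤ ENNReal.ofReal C * (eLpNorm ξ 2 μ * eLpNorm η 2 μ) := by
  have h1 := eLpNorm_smul_le_mul_eLpNorm (p := 2) (q := 2) (r := 1) hη.1.norm hξ.1.norm
  rw [eLpNorm_norm, eLpNorm_norm] at h1
  refine (eLpNorm_le_mul_eLpNorm_of_ae_le_mul (g := fun x => ‖ξ x‖ • ‖η x‖) (c := C) ?_ 1).trans ?_
  · filter_upwards [hk] with x hx
    rw [smul_eq_mul, Real.norm_of_nonneg (by positivity)]
    exact hx
  · gcongr
    exact h1

lemma integrable_of_norm_le_mul {E F H : Type*} [NormedAddCommGroup E] [NormedAddCommGroup F]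
    [NormedAddCommGroup H] {ξ : α → E} {η : α → F} {k : α → H} (hξ : MemLp ξ 2 μ)
    (hη : MemLp η 2 μ) (hkm : AEStronglyMeasurable k μ) {C : ℝ}
    (hk : ∀ᵐ x ∂μ, ‖k x‖ ≤ C * (‖ξ x‖ * ‖η x‖)) : Integrable k μ := by
  rw [← memLp_one_iff_integrable]
  exact ⟨hkm, (eLpNorm_one_le_of_norm_le_mul hξ hη hk).trans_lt
    (ENNReal.mul_lt_top ENNReal.ofReal_lt_top (ENNReal.mul_lt_top hξ.2 hη.2))⟩

/-- Cauchy–Schwarz for an integrand that is bounded by a product. -/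
lemma norm_integral_le_of_norm_le_mul {E F H : Type*} [NormedAddCommGroup E] [NormedAddCommGroup F]
    [NormedAddCommGroup H] [NormedSpace ℝ H] {ξ : α → E} {η : α → F} {k : α → H}
    (hξ : MemLp ξ 2 μ) (hη : MemLp η 2 μ) {C : ℝ} (hC : 0 ≤ C)
    (hk : ∀ᵐ x ∂μ, ‖k x‖ ≤ C * (‖ξ x‖ * ‖η x‖)) :
    ‖∫ x, k x ∂μ‖ ≤ C * ((eLpNorm ξ 2 μ).toReal * (eLpNorm η 2 μ).toReal) := by
  have h := (enorm_integral_le_lintegral_enorm k).trans_eq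
    (eLpNorm_one_eq_lintegral_enorm (f := k) (μ := μ)).symm
  have h2 := h.trans (eLpNorm_one_le_of_norm_le_mul hξ hη hk)
  have h3 := ENNReal.toReal_mono (ENNReal.mul_ne_top ENNReal.ofReal_ne_top
    (ENNReal.mul_ne_top hξ.2.ne hη.2.ne)) h2
  simpa [ENNReal.toReal_mul, ENNReal.toReal_ofReal hC] using h3

lemma tendsto_integral_of_tendsto_eLpNorm {E : Type*} [NormedAddCommGroup E] [NormedSpace ℝ E]
    {ψ : α → ℝ} (hψ : MemLp ψ 2 μ) {F : ℕ → α → E} {G : α → E} (hG : MemLp G 2 μ)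
    (hF : ∀ n, MemLp (F n) 2 μ)
    (hFG : Tendsto (fun n => eLpNorm (fun x => F n x - G x) 2 μ) atTop (𝓝 0)) :
    Tendsto (fun n => ∫ x, ψ x • F n x ∂μ) atTop (𝓝 (∫ x, ψ x • G x ∂μ)) := by
  have hi : ∀ {H : α → E}, MemLp H 2 μ → Integrable (fun x => ψ x • H x) μ := fun hH =>
    integrable_of_norm_le_mul hψ hH (hψ.1.smul hH.1) (C := 1)
      (Eventually.of_forall fun x => by simp [norm_smul])
  have h0 : Tendsto (fun n => (eLpNorm (fun x => F n x - G x) 2 μ).toReal) atTop (𝓝 0) := by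
    exact (ENNReal.tendsto_toReal ENNReal.zero_ne_top).comp hFG
  rw [tendsto_iff_norm_sub_tendsto_zero]
  refine squeeze_zero (fun _ => norm_nonneg _) (fun n => ?_)
    (by simpa using h0.const_mul (eLpNorm ψ 2 μ).toReal)
  rw [← integral_sub (hi (hF n)) (hi hG), ← one_mul (_ * _)]
  exact norm_integral_le_of_norm_le_mul hψ ((hF n).sub hG) zero_le_one
    (Eventually.of_forall fun x => by simp [← smul_sub, norm_smul])

end SquareIntegrable

/-! ### Differentiable functions on segments -/

lemma norm_gradient (φ : Plane → ℝ) (x : Plane) : ‖gradient φ x‖ = ‖fderiv ℝ φ x‖ := by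
  simp [gradient]

lemma inner_gradient (φ : Plane → ℝ) (x v : Plane) :
    inner ℝ (gradient φ x) v = fderiv ℝ φ x v := by
  simp [gradient]

lemma continuous_gradient {φ : Plane → ℝ} (hφ : ContDiff ℝ 1 φ) : Continuous (gradient φ) := by
  have := hφ.continuous_fderiv one_ne_zero
  unfold gradient
  fun_prop

lemma hasDerivAt_comp_segment {E : Type*} [NormedAddCommGroup E] [NormedSpace ℝ E]
    {φ : Plane → E} (hφ : Differentiable ℝ φ) (y v : Plane) (s : ℝ) :
    HasDerivAt (fun s : ℝ => φ (y + s • v)) (fderiv ℝ φ (y + s • v) v) s := by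
  have h : HasDerivAt (fun s : ℝ => y + s • v) v s := by
    simpa using ((hasDerivAt_id s).smul_const v).const_add y
  exact (hφ _).hasFDerivAt.comp_hasDerivAt s h

/-- The fundamental theorem of calculus on a segment, followed by Cauchy–Schwarz. The extended
nonnegative form can be integrated over `y` with no integrability check; the trace and the Poincaré
inequality both start from it. -/
lemma enorm_sub_sq_le_of_contDiff {φ : Plane → ℝ} (hφ : ContDiff ℝ 1 φ) (y v : Plane) {a b : ℝ}
    (hab : a ≤ b) :
    ‖φ (y + b • v) - φ (y + a • v)‖ₑ ^ 2 ≤ ENNReal.ofReal (b - a) *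
      (‖v‖ₑ ^ 2 * ∫⁻ s in Ioc a b, ‖gradient φ (y + s • v)‖ₑ ^ 2) := by
  have hc : Continuous fun s : ℝ => fderiv ℝ φ (y + s • v) v := by
    have := hφ.continuous_fderiv one_ne_zero
    fun_prop
  have h1 : φ (y + b • v) - φ (y + a • v) = ∫ s in Ioc a b, fderiv ℝ φ (y + s • v) v := by
    rw [← intervalIntegral.integral_of_le hab,
      intervalIntegral.integral_eq_sub_of_hasDerivAt
        (fun s _ => hasDerivAt_comp_segment (hφ.differentiable (by norm_num)) y v s)
        (hc.intervalIntegrable _ _)]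
  rw [h1]
  refine (enorm_integral_sq_le hc.aestronglyMeasurable).trans ?_
  simp only [MeasurableSet.univ, Measure.restrict_apply, univ_inter, Real.volume_Ioc]
  gcongr
  rw [← lintegral_const_mul']
  · refine lintegral_mono fun s => ?_
    rw [← mul_pow]
    gcongr
    rw [mul_comm]
    calc ‖fderiv ℝ φ (y + s • v) v‖ₑ ≤ ‖fderiv ℝ φ (y + s • v)‖ₑ * ‖v‖ₑ :=
          ContinuousLinearMap.le_opENorm _ _
      _ = _ := by rw [← ofReal_norm, ← norm_gradient, ofReal_norm]
  · finiteness

lemma enorm_add_sq_le {E : Type*} [SeminormedAddCommGroup E] (a b : E) :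
    ‖a + b‖ₑ ^ 2 ≤ 2 * ‖a‖ₑ ^ 2 + 2 * ‖b‖ₑ ^ 2 := by
  have h : ‖a + b‖ ^ 2 ≤ 2 * ‖a‖ ^ 2 + 2 * ‖b‖ ^ 2 := by
    nlinarith [norm_add_le a b, norm_nonneg (a + b), sq_nonneg (‖a‖ - ‖b‖), norm_nonneg a,
      norm_nonneg b]
  have h2 := ENNReal.ofReal_le_ofReal h
  rw [ENNReal.ofReal_add (by positivity) (by positivity), ENNReal.ofReal_mul (by norm_num),
    ENNReal.ofReal_mul (by norm_num)] at h2
  simpa [ENNReal.ofReal_pow] using h2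

lemma enorm_sq_le_add {E : Type*} [SeminormedAddCommGroup E] (a b : E) :
    ‖a‖ₑ ^ 2 ≤ 2 * ‖b‖ₑ ^ 2 + 2 * ‖a - b‖ₑ ^ 2 := by
  simpa using enorm_add_sq_le b (a - b)

/-! ### Images under Lipschitz maps -/

/-- The preimage under `T` of a set is contained in its image under `S`, and a `K`-Lipschitz map
enlarges `d`-dimensional measure at most by the factor `K ^ d`. The case d = 1 serves arc length, d
= 2 area. -/
lemma map_restrict_hausdorffMeasure_le {T S : Plane → Plane} (hT : Measurable T)
    (hST : ∀ x, S (T x) = x) {K : NNReal} (hS : LipschitzWith K S) {d : ℝ} (hd : 0 ≤ d)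
    (A : Set Plane) :
    ((μH[d] : Measure Plane).restrict A).map T ≤
      ((K : ENNReal) ^ d) • (μH[d] : Measure Plane).restrict (T '' A) := by
  refine Measure.le_iff.2 fun s hs => ?_
  rw [Measure.map_apply hT hs, Measure.restrict_apply (hT hs), Measure.smul_apply,
    Measure.restrict_apply hs, smul_eq_mul]
  refine (measure_mono ?_).trans (hS.hausdorffMeasure_image_le hd _)
  rintro x ⟨hx, hxA⟩
  exact ⟨T x, ⟨hx, mem_image_of_mem T hxA⟩, hST x⟩

/-- Both are Haar measures. The value of the constant is irrelevant, as it appears on both sides of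
the comparison in `map_restrict_volume_le`. -/
lemma exists_volume_eq_smul_hausdorffMeasure :
    ∃ c : NNReal, (volume : Measure Plane) = c • (μH[2] : Measure Plane) := by
  have : (μH[2] : Measure Plane).IsAddHaarMeasure := by
    have := isAddHaarMeasure_hausdorffMeasure (E := Plane)
    simpa using this
  exact ⟨_, Measure.isAddLeftInvariant_eq_smul _ _⟩

lemma map_restrict_volume_le {T S : Plane → Plane} (hT : Measurable T)
    (hST : ∀ x, S (T x) = x) {K : NNReal} (hS : LipschitzWith K S) (A : Set Plane) :
    ((volume : Measure Plane).restrict A).map T ≤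
      ((K : ENNReal) ^ (2 : ℝ)) • (volume : Measure Plane).restrict (T '' A) := by
  obtain ⟨c, hc⟩ := exists_volume_eq_smul_hausdorffMeasure
  have h := map_restrict_hausdorffMeasure_le hT hST hS zero_le_two A
  rw [hc, Measure.restrict_smul, Measure.restrict_smul, Measure.map_smul, smul_comm]
  gcongr

/-! ### Weak gradients -/

lemma integral_smul_gradient {φ ψ : Plane → ℝ} (hφ : ContDiff ℝ 1 φ) (hψ : ContDiff ℝ 1 ψ)
    (hψc : HasCompactSupport ψ) :
    ∫ x, ψ x • gradient φ x = -∫ x, φ x • gradient ψ x := by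
  have cψ := hψ.continuous_fderiv one_ne_zero
  have cφ := hφ.continuous_fderiv one_ne_zero
  have hg : HasCompactSupport (gradient ψ) :=
    (hψc.fderiv ℝ).comp_left (g := (InnerProductSpace.toDual ℝ Plane).symm) (map_zero _)
  have i1 : Integrable fun x => ψ x • gradient φ x :=
    (hψ.continuous.smul (continuous_gradient hφ)).integrable_of_hasCompactSupport hψc.smul_right
  have i2 : Integrable fun x => φ x • gradient ψ x :=
    (hφ.continuous.smul (continuous_gradient hψ)).integrable_of_hasCompactSupport
      (hg.smul_left (f := φ))
  refine ext_inner_left ℝ fun v => ?_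
  rw [inner_neg_right, ← integral_inner i1, ← integral_inner i2]
  simp only [real_inner_comm _ v, real_inner_smul_left, inner_gradient]
  rw [integral_mul_fderiv_eq_neg_fderiv_mul_of_integrable]
  · simp only [mul_comm]
  · exact Continuous.integrable_of_hasCompactSupport (by fun_prop)
      (((hψc.fderiv ℝ).comp_left (g := fun L : Plane →L[ℝ] ℝ => L v) (by simp)).mul_right)
  · exact Continuous.integrable_of_hasCompactSupport (by fun_prop) hψc.mul_right
  · exact Continuous.integrable_of_hasCompactSupport (by fun_prop) hψc.mul_right
  · exact fun x _ => hψ.differentiable (by norm_num) x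
  · exact fun x _ => hφ.differentiable (by norm_num) x

lemma setIntegral_smul_eq {E : Type*} [NormedAddCommGroup E] [NormedSpace ℝ E] {Ω : Set Plane}
    {ψ : Plane → ℝ} (hψ : tsupport ψ ⊆ Ω) (G : Plane → E) :
    ∫ x in Ω, ψ x • G x = ∫ x, ψ x • G x :=
  setIntegral_eq_integral_of_forall_compl_eq_zero fun x hx => by
    rw [image_eq_zero_of_notMem_tsupport fun h => hx (hψ h), zero_smul]

lemma gradient_eq_zero_of_notMem_tsupport {ψ : Plane → ℝ} {x : Plane} (hx : x ∉ tsupport ψ) :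
    gradient ψ x = 0 := by
  have : fderiv ℝ ψ x = 0 := by
    by_contra h
    exact hx (support_fderiv_subset ℝ h)
  simp [gradient, this]

lemma setIntegral_smul_gradient_eq {Ω : Set Plane}
    {ψ : Plane → ℝ} (hψ : tsupport ψ ⊆ Ω) (g : Plane → ℝ) :
    ∫ x in Ω, g x • gradient ψ x = ∫ x, g x • gradient ψ x :=
  setIntegral_eq_integral_of_forall_compl_eq_zero fun x hx => by
    rw [gradient_eq_zero_of_notMem_tsupport fun h => hx (hψ h), smul_zero]

lemma IsWeakGradient.mono {Ω Ω' : Set Plane} {v : Plane → ℝ} {G : Plane → Plane}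
    (h : IsWeakGradient Ω v G) (hsub : Ω' ⊆ Ω) : IsWeakGradient Ω' v G := by
  intro ψ hψ hψc hψs
  rw [setIntegral_smul_eq hψs, setIntegral_smul_gradient_eq hψs,
    ← setIntegral_smul_eq (hψs.trans hsub), ← setIntegral_smul_gradient_eq (hψs.trans hsub)]
  exact h ψ hψ hψc (hψs.trans hsub)

lemma memLp_restrict_of_hasCompactSupport {E : Type*} [NormedAddCommGroup E] {F : Plane → E}
    (hF : Continuous F) (hc : HasCompactSupport F) (Ω : Set Plane) :
    MemLp F 2 (volume.restrict Ω) :=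
  (hF.memLp_of_hasCompactSupport hc).restrict Ω

lemma IsWeakGradient.ae_eq {Ω : Set Plane} (hΩ : IsOpen Ω) {v : Plane → ℝ} {G H : Plane → Plane}
    (hG : MemLp G 2 (volume.restrict Ω)) (hH : MemLp H 2 (volume.restrict Ω))
    (hvG : IsWeakGradient Ω v G) (hvH : IsWeakGradient Ω v H) :
    G =ᵐ[volume.restrict Ω] H := by
  have key := hΩ.ae_eq_zero_of_integral_contDiff_smul_eq_zero (μ := volume.restrict Ω)
    (f := fun x => G x - H x)
    (((hG.sub hH).locallyIntegrable (by norm_num)).locallyIntegrableOn Ω) ?_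
  · filter_upwards [key, ae_restrict_mem hΩ.measurableSet] with x hx hxΩ
    exact sub_eq_zero.1 (hx hxΩ)
  · intro ψ hψ hψc hψs
    have hψL := memLp_restrict_of_hasCompactSupport hψ.continuous hψc Ω
    have hi : ∀ {F : Plane → Plane}, MemLp F 2 (volume.restrict Ω) →
        Integrable (fun x => ψ x • F x) (volume.restrict Ω) := fun hF =>
      integrable_of_norm_le_mul hψL hF (hψL.1.smul hF.1) (C := 1)
        (Eventually.of_forall fun x => by simp [norm_smul])
    simp only [smul_sub]
    rw [integral_sub (hi hG) (hi hH), hvG ψ hψ hψc hψs, hvH ψ hψ hψc hψs, sub_self]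

lemma MemH1.weakGrad_spec {Ω : Set Plane} {v : Plane → ℝ} (h : MemH1 Ω v) :
    MemLp (weakGrad Ω v) 2 (volume.restrict Ω) ∧ IsWeakGradient Ω v (weakGrad Ω v) := by
  rw [weakGrad, dif_pos h.2]
  exact h.2.choose_spec

lemma MemH1.memLp_weakGrad {Ω : Set Plane} {v : Plane → ℝ} (h : MemH1 Ω v) :
    MemLp (weakGrad Ω v) 2 (volume.restrict Ω) := h.weakGrad_spec.1

lemma IsWeakGradient.weakGrad_ae_eq {Ω : Set Plane} (hΩ : IsOpen Ω) {v : Plane → ℝ}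
    {G : Plane → Plane} (hvG : IsWeakGradient Ω v G) (hG : MemLp G 2 (volume.restrict Ω)) :
    weakGrad Ω v =ᵐ[volume.restrict Ω] G := by
  have h : ∃ G : Plane → Plane, MemLp G 2 (volume.restrict Ω) ∧ IsWeakGradient Ω v G :=
    ⟨G, hG, hvG⟩
  rw [weakGrad, dif_pos h]
  exact IsWeakGradient.ae_eq hΩ h.choose_spec.1 hG h.choose_spec.2 hvG

/-! ### Approximation by functions that are continuously differentiable on the plane -/

/-- The `C¹` functions `φ n` converge to `v`, and their gradients to `G`, in `L²(Ω)`. -/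
structure ApproxH1 (Ω : Set Plane) (v : Plane → ℝ) (G : Plane → Plane) (φ : ℕ → Plane → ℝ) :
    Prop where
  memLp : MemLp v 2 (volume.restrict Ω)
  memLp_grad : MemLp G 2 (volume.restrict Ω)
  contDiff : ∀ n, ContDiff ℝ 1 (φ n)
  tendsto : Tendsto (fun n => eLpNorm (fun x => φ n x - v x) 2 (volume.restrict Ω)) atTop (𝓝 0)
  tendsto_grad : Tendsto (fun n => eLpNorm (fun x => gradient (φ n) x - G x) 2
    (volume.restrict Ω)) atTop (𝓝 0)

lemma memLp_restrict_of_continuous {E : Type*} [NormedAddCommGroup E] {F : Plane → E}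
    (hF : Continuous F) {Ω : Set Plane} (hΩ : Bornology.IsBounded Ω) :
    MemLp F 2 (volume.restrict Ω) := by
  obtain ⟨C, hC⟩ := hΩ.isCompact_closure.exists_bound_of_continuousOn hF.continuousOn
  have : IsFiniteMeasure (volume.restrict (closure Ω)) :=
    isFiniteMeasure_restrict.2 hΩ.isCompact_closure.measure_ne_top
  have h : MemLp F 2 (volume.restrict (closure Ω)) :=
    MemLp.of_bound hF.aestronglyMeasurable C (by
      filter_upwards [ae_restrict_mem isClosed_closure.measurableSet] with x hx using hC x hx)
  exact h.mono_measure (Measure.restrict_mono subset_closure le_rfl)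

/-- Integration by parts holds for each `φ n`, and both sides pass to the L² limit. Hence a limit of
gradients is automatically the weak gradient, so that differences and compositions can be computed
on the C¹ approximants. -/
lemma ApproxH1.isWeakGradient {Ω : Set Plane} (hb : Bornology.IsBounded Ω)
    {v : Plane → ℝ} {G : Plane → Plane} {φ : ℕ → Plane → ℝ} (h : ApproxH1 Ω v G φ) :
    IsWeakGradient Ω v G := by
  intro ψ hψ hψc hψs
  have hψ1 : ContDiff ℝ 1 ψ := hψ.of_le (by exact_mod_cast le_top)
  have cg := continuous_gradient hψ1
  have hg : HasCompactSupport (gradient ψ) :=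
    (hψc.fderiv ℝ).comp_left (g := (InnerProductSpace.toDual ℝ Plane).symm) (map_zero _)
  have l1 := tendsto_integral_of_tendsto_eLpNorm
    (memLp_restrict_of_hasCompactSupport hψ.continuous hψc Ω) h.memLp_grad
    (fun n => memLp_restrict_of_continuous (continuous_gradient (h.contDiff n)) hb) h.tendsto_grad
  have l2 : Tendsto (fun n => ∫ x in Ω, φ n x • gradient ψ x) atTop
      (𝓝 (∫ x in Ω, v x • gradient ψ x)) := by
    rw [tendsto_iff_norm_sub_tendsto_zero]
    have hgL := memLp_restrict_of_hasCompactSupport cg hg Ω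
    have hi : ∀ {w : Plane → ℝ}, MemLp w 2 (volume.restrict Ω) →
        Integrable (fun x => w x • gradient ψ x) (volume.restrict Ω) := fun hw =>
      integrable_of_norm_le_mul hw hgL (hw.1.smul hgL.1) (C := 1)
        (Eventually.of_forall fun x => by simp [norm_smul])
    have h0 := (ENNReal.tendsto_toReal ENNReal.zero_ne_top).comp h.tendsto
    refine squeeze_zero (fun _ => norm_nonneg _) (fun n => ?_)
      (by simpa using h0.mul_const (eLpNorm (gradient ψ) 2 (volume.restrict Ω)).toReal)
    have hn := memLp_restrict_of_continuous (h.contDiff n).continuous hb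
    rw [← integral_sub (hi hn) (hi h.memLp), ← one_mul (_ * _)]
    exact norm_integral_le_of_norm_le_mul (hn.sub h.memLp) hgL zero_le_one
      (Eventually.of_forall fun x => by simp [← sub_smul, norm_smul])
  refine tendsto_nhds_unique l1 (l2.neg.congr fun n => ?_)
  rw [setIntegral_smul_eq hψs, setIntegral_smul_gradient_eq hψs,
    integral_smul_gradient (h.contDiff n) hψ1 hψc]

lemma ApproxH1.memH1 {Ω : Set Plane} (hb : Bornology.IsBounded Ω)
    {v : Plane → ℝ} {G : Plane → Plane} {φ : ℕ → Plane → ℝ} (h : ApproxH1 Ω v G φ) :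
    MemH1 Ω v :=
  ⟨h.memLp, G, h.memLp_grad, h.isWeakGradient hb⟩

lemma ApproxH1.weakGrad_ae_eq {Ω : Set Plane} (hΩ : IsOpen Ω) (hb : Bornology.IsBounded Ω)
    {v : Plane → ℝ} {G : Plane → Plane} {φ : ℕ → Plane → ℝ} (h : ApproxH1 Ω v G φ) :
    weakGrad Ω v =ᵐ[volume.restrict Ω] G :=
  (h.isWeakGradient hb).weakGrad_ae_eq hΩ h.memLp_grad

lemma tendsto_eLpNorm_sub_sub {α E : Type*} [MeasurableSpace α] [NormedAddCommGroup E]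
    {μ : Measure α} {a b : ℕ → α → E} {f g : α → E}
    (ha : ∀ n, AEStronglyMeasurable (a n) μ) (hb : ∀ n, AEStronglyMeasurable (b n) μ)
    (hf : AEStronglyMeasurable f μ) (hg : AEStronglyMeasurable g μ)
    (h1 : Tendsto (fun n => eLpNorm (fun x => a n x - f x) 2 μ) atTop (𝓝 0))
    (h2 : Tendsto (fun n => eLpNorm (fun x => b n x - g x) 2 μ) atTop (𝓝 0)) :
    Tendsto (fun n => eLpNorm (fun x => (a n x - b n x) - (f x - g x)) 2 μ) atTop (𝓝 0) := by
  refine tendsto_of_tendsto_of_tendsto_of_le_of_le tendsto_const_nhds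
    (by simpa using h1.add h2) (fun _ => zero_le) (fun n => ?_)
  refine le_trans (le_of_eq ?_)
    (eLpNorm_sub_le ((ha n).sub hf) ((hb n).sub hg) (by norm_num))
  congr 1
  ext x
  simp only [Pi.sub_apply]
  abel

lemma gradient_sub {φ ψ : Plane → ℝ} (hφ : Differentiable ℝ φ) (hψ : Differentiable ℝ ψ)
    (x : Plane) : gradient (fun x => φ x - ψ x) x = gradient φ x - gradient ψ x := by
  simp only [gradient]
  rw [fderiv_fun_sub (hφ x) (hψ x), map_sub]

lemma ApproxH1.sub {Ω : Set Plane} {v w : Plane → ℝ} {G H : Plane → Plane}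
    {φ ψ : ℕ → Plane → ℝ} (h1 : ApproxH1 Ω v G φ) (h2 : ApproxH1 Ω w H ψ) :
    ApproxH1 Ω (fun x => v x - w x) (fun x => G x - H x) (fun n x => φ n x - ψ n x) where
  memLp := h1.memLp.sub h2.memLp
  memLp_grad := h1.memLp_grad.sub h2.memLp_grad
  contDiff n := (h1.contDiff n).sub (h2.contDiff n)
  tendsto := tendsto_eLpNorm_sub_sub (fun n => (h1.contDiff n).continuous.aestronglyMeasurable)
    (fun n => (h2.contDiff n).continuous.aestronglyMeasurable) h1.memLp.1 h2.memLp.1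
    h1.tendsto h2.tendsto
  tendsto_grad := by
    simp only [fun n => gradient_sub ((h1.contDiff n).differentiable (by norm_num))
      ((h2.contDiff n).differentiable (by norm_num))]
    exact tendsto_eLpNorm_sub_sub
      (fun n => (continuous_gradient (h1.contDiff n)).aestronglyMeasurable)
      (fun n => (continuous_gradient (h2.contDiff n)).aestronglyMeasurable)
      h1.memLp_grad.1 h2.memLp_grad.1 h1.tendsto_grad h2.tendsto_grad

lemma HasTrace.exists_approx {Ω Γ : Set Plane} {v g : Plane → ℝ} (h : HasTrace Ω Γ v g) :
    ∃ φ, ApproxH1 Ω v (weakGrad Ω v) φ ∧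
      Tendsto (fun n => eLpNorm (fun x => φ n x - g x) 2 (arcLength Γ)) atTop (𝓝 0) := by
  obtain ⟨h1, h2, φ, c, t1, t2, t3⟩ := h
  exact ⟨φ, ⟨h1.1, h1.memLp_weakGrad, c, t1, t2⟩, t3⟩

lemma ApproxH1.hasTrace {Ω Γ : Set Plane} (hΩ : IsOpen Ω) (hb : Bornology.IsBounded Ω)
    {v g : Plane → ℝ} {G : Plane → Plane} {φ : ℕ → Plane → ℝ} (h : ApproxH1 Ω v G φ)
    (hg : MemLp g 2 (arcLength Γ))
    (ht : Tendsto (fun n => eLpNorm (fun x => φ n x - g x) 2 (arcLength Γ)) atTop (𝓝 0)) :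
    HasTrace Ω Γ v g := by
  refine ⟨h.memH1 hb, hg, φ, h.contDiff, h.tendsto, h.tendsto_grad.congr fun n => ?_, ht⟩
  refine eLpNorm_congr_ae ?_
  filter_upwards [h.weakGrad_ae_eq hΩ hb] with x hx
  rw [hx]

lemma HasTrace.sub {Ω Γ : Set Plane} (hΩ : IsOpen Ω) (hb : Bornology.IsBounded Ω)
    {v w g k : Plane → ℝ} (h1 : HasTrace Ω Γ v g) (h2 : HasTrace Ω Γ w k) :
    HasTrace Ω Γ (fun x => v x - w x) (fun x => g x - k x) := by
  obtain ⟨φ, a1, t1⟩ := h1.exists_approx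
  obtain ⟨ψ, a2, t2⟩ := h2.exists_approx
  exact (a1.sub a2).hasTrace hΩ hb (h1.2.1.sub h2.2.1)
    (tendsto_eLpNorm_sub_sub (fun n => (a1.contDiff n).continuous.aestronglyMeasurable)
    (fun n => (a2.contDiff n).continuous.aestronglyMeasurable) h1.2.1.1 h2.2.1.1 t1 t2)

lemma MemV.sub {Ω Γf : Set Plane} (hΩ : IsOpen Ω) (hb : Bornology.IsBounded Ω)
    {v w : Plane → ℝ} (h1 : MemV Γf Ω v) (h2 : MemV Γf Ω w) :
    MemV Γf Ω (fun x => v x - w x) := by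
  have h := h1.2.sub hΩ hb h2.2
  exact ⟨h.1, by simpa using! h⟩

lemma MemV.weakGrad_sub_ae_eq {Ω Γf : Set Plane} (hΩ : IsOpen Ω) (hb : Bornology.IsBounded Ω)
    {v w : Plane → ℝ} (h1 : MemV Γf Ω v) (h2 : MemV Γf Ω w) :
    weakGrad Ω (fun x => v x - w x) =ᵐ[volume.restrict Ω]
      fun x => weakGrad Ω v x - weakGrad Ω w x := by
  obtain ⟨φ, a1, -⟩ := h1.2.exists_approx
  obtain ⟨ψ, a2, -⟩ := h2.2.exists_approx
  exact (a1.sub a2).weakGrad_ae_eq hΩ hb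

/-! ### Boundary charts -/

/-- A parametrization of a one-sided neighbourhood of the boundary point `x₀` of `Ω`: the boundary
is the curve `P`, the segments from the boundary in the direction `-e` run in `Ω`, and the map
`(x, s) ↦ P x - s e` preserves the area. The part of the boundary on which it lives is in `V`. -/
structure BoundaryChart (Ω : Set Plane) (x₀ : Plane) (V : Set Plane) where
  P : ℝ → Plane
  e : Plane
  I : Set ℝ
  K : NNReal
  ℓ : ℝ
  ρ : ℝ
  lipschitz : LipschitzWith K P
  antilipschitz : AntilipschitzWith 1 P
  measurePreserving : MeasurePreserving (fun z : ℝ × ℝ => P z.1 - z.2 • e) volume volume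
  injective : Function.Injective fun z : ℝ × ℝ => P z.1 - z.2 • e
  norm_e : ‖e‖ = 1
  ℓ_pos : 0 < ℓ
  ρ_pos : 0 < ρ
  mem : ∀ x ∈ I, ∀ s ∈ Ioo 0 ℓ, P x - s • e ∈ Ω
  mem_frontier : ∀ x ∈ I, P x ∈ frontier Ω ∩ V
  exists_of_mem : ∀ y ∈ Metric.ball x₀ ρ ∩ Ω, ∃ x ∈ I, ∃ s ∈ Ioo 0 (ℓ / 2), y = P x - s • e
  exists_of_mem_frontier : ∀ y ∈ Metric.ball x₀ ρ ∩ frontier Ω, ∃ x ∈ I, y = P x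

lemma measurePreserving_toLp_prod :
    MeasurePreserving (fun z : ℝ × ℝ => (!₂[z.1, z.2] : Plane)) volume volume := by
  have h1 := (volume_preserving_finTwoArrow ℝ).symm
  have h2 := (EuclideanSpace.volume_preserving_symm_measurableEquiv_toLp (Fin 2)).symm
  have h3 : (fun z : ℝ × ℝ => (!₂[z.1, z.2] : Plane)) =
      (MeasurableEquiv.toLp 2 (Fin 2 → ℝ)).symm.symm ∘ MeasurableEquiv.finTwoArrow.symm := by
    funext z
    ext i
    fin_cases i <;> rfl
  rw [h3]
  exact h2.comp h1

/-- On each vertical line the map is a reflection, so Fubini suffices and `γ` need not be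
differentiable. -/
lemma measurePreserving_graph {γ : ℝ → ℝ} (hγ : Measurable γ) :
    MeasurePreserving (fun z : ℝ × ℝ => (z.1, γ z.1 - z.2)) volume volume := by
  refine MeasurePreserving.skew_product (MeasurePreserving.id (volume : Measure ℝ))
    (g := fun x s => γ x - s) (μc := volume) (μd := volume) ?_ ?_
  · exact (hγ.comp measurable_fst).sub measurable_snd
  · exact Eventually.of_forall fun x => (Measure.measurePreserving_sub_left volume (γ x)).map_eq

lemma abs_coord_zero_le (y : Plane) : |y 0| ≤ ‖y‖ := by
  simpa using PiLp.norm_apply_le y 0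

lemma abs_coord_one_le (y : Plane) : |y 1| ≤ ‖y‖ := by
  simpa using PiLp.norm_apply_le y 1

lemma norm_le_abs_add_abs (y : Plane) : ‖y‖ ≤ |y 0| + |y 1| := by
  rw [EuclideanSpace.norm_eq, Fin.sum_univ_two, Real.sqrt_le_left (by positivity)]
  simp only [Real.norm_eq_abs]
  nlinarith [abs_nonneg (y 0), abs_nonneg (y 1)]

/-- Near a boundary point, the boundary is the graph. -/
lemma mem_frontier_iff_of_graph {Ω : Set Plane} {x : Plane} {R : Plane ≃ₗᵢ[ℝ] Plane} {γ : ℝ → ℝ}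
    (hγ : Continuous γ) {r : ℝ}
    (h : ∀ y ∈ Metric.ball x r, y ∈ Ω ↔ R y 1 < γ (R y 0)) {y : Plane}
    (hy : y ∈ Metric.ball x r) : y ∈ frontier Ω ↔ R y 1 = γ (R y 0) := by
  have hR : Continuous R := R.continuous
  have c1 : Continuous fun y : Plane => R y 1 := by fun_prop
  have c2 : Continuous fun y : Plane => γ (R y 0) := by fun_prop
  have hnhds : ∀ᶠ z in 𝓝 y, z ∈ Metric.ball x r := Metric.isOpen_ball.mem_nhds hy
  constructor
  · intro hf
    rw [frontier_eq_closure_inter_closure] at hf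
    refine le_antisymm ?_ ?_
    · by_contra! hlt
      have : ∀ᶠ z in 𝓝 y, z ∉ Ω := by
        filter_upwards [hnhds, c2.continuousAt.eventually_lt c1.continuousAt hlt] with z hz hz2 hΩ
        exact absurd ((h z hz).1 hΩ) (not_lt.2 hz2.le)
      exact (mem_closure_iff_frequently.1 hf.1) this
    · by_contra! hlt
      have : ∀ᶠ z in 𝓝 y, z ∈ Ω := by
        filter_upwards [hnhds, c1.continuousAt.eventually_lt c2.continuousAt hlt] with z hz hz2
        exact (h z hz).2 hz2
      exact (mem_closure_iff_frequently.1 hf.2) (this.mono fun z hz h => h hz)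
  · intro heq
    -- A point of the graph is approached vertically, from below (σ = 1) through `Ω` and from above
    -- (σ = -1) through the complement.
    have hpath : ∀ σ : ℝ, Tendsto (fun s : ℝ => y - s • (σ • R.symm !₂[0, 1])) (𝓝[>] 0) (𝓝 y) := by
      intro σ
      have : Continuous fun s : ℝ => y - s • (σ • R.symm !₂[0, 1]) := by fun_prop
      simpa using (this.tendsto 0).mono_left nhdsWithin_le_nhds
    have hR0 : ∀ σ s : ℝ, R (y - s • (σ • R.symm !₂[0, 1])) 0 = R y 0 := by simp
    have hR1 : ∀ σ s : ℝ, R (y - s • (σ • R.symm !₂[0, 1])) 1 = R y 1 - s * σ := by simp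
    rw [frontier_eq_closure_inter_closure]
    constructor
    · refine mem_closure_of_tendsto (hpath 1) ?_
      filter_upwards [(hpath 1).eventually hnhds, self_mem_nhdsWithin] with s hs hs0
      rw [h _ hs, hR0, hR1, ← heq]
      have : 0 < s := hs0
      linarith
    · refine mem_closure_of_tendsto (hpath (-1)) ?_
      filter_upwards [(hpath (-1)).eventually hnhds, self_mem_nhdsWithin] with s hs hs0
      rw [mem_compl_iff, h _ hs, hR0, hR1, ← heq]
      have : 0 < s := hs0
      linarith

lemma HasLipschitzBoundary.exists_chart {Ω : Set Plane} (hΩ : HasLipschitzBoundary Ω)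
    {x₀ : Plane} (hx₀ : x₀ ∈ frontier Ω) {V : Set Plane} (hV : V ∈ 𝓝 x₀) :
    Nonempty (BoundaryChart Ω x₀ V) := by
  obtain ⟨R, γ, K, r', hr', hγ, h'⟩ := hΩ x₀ hx₀
  obtain ⟨r'', hr'', hV⟩ := Metric.mem_nhds_iff.1 hV
  obtain ⟨r, hr, hrr', hrr''⟩ : ∃ r, 0 < r ∧ r ≤ r' ∧ r ≤ r'' :=
    ⟨min r' r'', lt_min hr' hr'', min_le_left _ _, min_le_right _ _⟩
  have h : ∀ y ∈ Metric.ball x₀ r, y ∈ Ω ↔ R y 1 < γ (R y 0) := fun y hy =>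
    h' y (Metric.ball_subset_ball hrr' hy)
  have hfr : ∀ y ∈ Metric.ball x₀ r, y ∈ frontier Ω ↔ R y 1 = γ (R y 0) := fun y hy =>
    mem_frontier_iff_of_graph hγ.continuous h hy
  have h0 : R x₀ 1 = γ (R x₀ 0) := (hfr x₀ (Metric.mem_ball_self hr)).1 hx₀
  set P : ℝ → Plane := fun x => R.symm !₂[x, γ x] with hP
  set e : Plane := R.symm !₂[0, 1] with he
  -- In the ball of radius ρ the height below the graph is less than (1 + K)ρ = r/4, which is half
  -- of the fibre length ℓ = r/2. The other half leaves room to move further inwards in the Poincaré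
  -- inequality.
  set ρ : ℝ := r / (4 * (1 + K)) with hρ
  have hK : (0 : ℝ) ≤ K := K.2
  have hρ0 : 0 < ρ := by positivity
  have hρr : (1 + K) * ρ = r / 4 := by rw [hρ]; field_simp
  have hγ' : ∀ x y, |γ x - γ y| ≤ K * |x - y| := fun x y => by
    simpa [Real.dist_eq] using hγ.dist_le_mul x y
  have hRP0 : ∀ x s : ℝ, R (P x - s • e) 0 = x := by simp [hP, he]
  have hRP1 : ∀ x s : ℝ, R (P x - s • e) 1 = γ x - s := by simp [hP, he]
  have hdist : ∀ x ∈ Metric.ball (R x₀ 0) ρ, ∀ s : ℝ, |s| < r / 2 →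
      P x - s • e ∈ Metric.ball x₀ r := by
    intro x hx s hs
    rw [mem_ball_iff_norm, ← R.norm_map, map_sub]
    refine (norm_le_abs_add_abs _).trans_lt ?_
    rw [PiLp.sub_apply, PiLp.sub_apply, hRP0, hRP1, h0]
    have h1 := hγ' x (R x₀ 0)
    rw [Metric.mem_ball, Real.dist_eq] at hx
    have h2 : |γ x - s - γ (R x₀ 0)| ≤ |γ x - γ (R x₀ 0)| + |s| := by
      rw [show γ x - s - γ (R x₀ 0) = (γ x - γ (R x₀ 0)) - s by ring]
      exact abs_sub _ _
    nlinarith [mul_le_mul_of_nonneg_left hx.le hK]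
  have hP0 : ∀ x, P x = P x - (0 : ℝ) • e := by simp
  have hrep : ∀ y, y = P (R y 0) - (γ (R y 0) - R y 1) • e := by
    intro y
    apply R.injective
    ext i
    fin_cases i
    · exact (hRP0 _ _).symm
    · refine Eq.trans ?_ (hRP1 _ _).symm
      simp
  have hball : ∀ y ∈ Metric.ball x₀ ρ, R y 0 ∈ Metric.ball (R x₀ 0) ρ ∧
      y ∈ Metric.ball x₀ r ∧ |γ (R y 0) - R y 1| < r / 4 := by
    intro y hy
    have hy' : ‖R y - R x₀‖ < ρ := by
      rw [← map_sub, R.norm_map]; exact mem_ball_iff_norm.1 hy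
    have a0 := (abs_coord_zero_le (R y - R x₀)).trans_lt hy'
    have a1 := (abs_coord_one_le (R y - R x₀)).trans_lt hy'
    rw [PiLp.sub_apply] at a0 a1
    refine ⟨by rwa [Metric.mem_ball, Real.dist_eq],
      Metric.ball_subset_ball (by nlinarith) hy, ?_⟩
    have h1 := hγ' (R y 0) (R x₀ 0)
    rw [h0] at a1
    have h2 : |γ (R y 0) - R y 1| ≤ |γ (R y 0) - γ (R x₀ 0)| + |R y 1 - γ (R x₀ 0)| := by
      rw [show γ (R y 0) - R y 1 = (γ (R y 0) - γ (R x₀ 0)) - (R y 1 - γ (R x₀ 0)) by ring]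
      exact abs_sub _ _
    nlinarith [mul_le_mul_of_nonneg_left a0.le hK]
  refine ⟨{ P := P, e := e, I := Metric.ball (R x₀ 0) ρ, K := 1 + K, ℓ := r / 2, ρ := ρ,
            lipschitz := ?_, antilipschitz := ?_, measurePreserving := ?_, injective := ?_,
            norm_e := ?_,
            ℓ_pos := ?_, ρ_pos := ?_, mem := ?_, mem_frontier := ?_,
            exists_of_mem := ?_, exists_of_mem_frontier := ?_ }⟩
  · refine LipschitzWith.of_dist_le_mul fun x y => ?_
    rw [hP, dist_eq_norm, ← map_sub, R.symm.norm_map]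
    refine (norm_le_abs_add_abs _).trans ?_
    have := hγ' x y
    simp only [PiLp.sub_apply, Real.dist_eq, NNReal.coe_add, NNReal.coe_one]
    simp
    linarith
  · refine AntilipschitzWith.of_le_mul_dist fun x y => ?_
    rw [hP, dist_eq_norm (R.symm _), ← map_sub, R.symm.norm_map, Real.dist_eq]
    simpa using abs_coord_zero_le (!₂[x, γ x] - !₂[y, γ y])
  · have := R.symm.measurePreserving.comp
      (measurePreserving_toLp_prod.comp (measurePreserving_graph hγ.continuous.measurable))
    refine Eq.mp (congrArg (fun F => MeasurePreserving F volume volume) ?_) this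
    funext z
    apply R.injective
    ext i
    fin_cases i
    · exact ((hRP0 z.1 z.2).trans (by simp)).symm
    · exact ((hRP1 z.1 z.2).trans (by simp)).symm
  · intro z w hzw
    have hzw' : P z.1 - z.2 • e = P w.1 - w.2 • e := hzw
    have a0 : z.1 = w.1 := by rw [← hRP0 z.1 z.2, hzw', hRP0]
    have a1 : γ z.1 - z.2 = γ w.1 - w.2 := by rw [← hRP1 z.1 z.2, hzw', hRP1]
    rw [a0] at a1
    exact Prod.ext a0 (by linarith)
  · rw [he, R.symm.norm_map]
    simp [EuclideanSpace.norm_eq]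
  · positivity
  · exact hρ0
  · intro x hx s hs
    rw [h _ (hdist x hx s (by rw [abs_of_pos hs.1]; exact hs.2)), hRP0, hRP1]
    linarith [hs.1]
  · intro x hx
    have hb := hdist x hx 0 (by simpa using by positivity)
    rw [← hP0] at hb
    refine ⟨(hfr _ hb).2 ?_, hV (Metric.ball_subset_ball hrr'' hb)⟩
    rw [hP0, hRP0, hRP1, sub_zero]
  · rintro y ⟨hy, hyΩ⟩
    obtain ⟨b1, b2, b3⟩ := hball y hy
    have := (h y b2).1 hyΩ
    exact ⟨_, b1, _, ⟨by linarith, by linarith [le_abs_self (γ (R y 0) - R y 1)]⟩, hrep y⟩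
  · rintro y ⟨hy, hyΩ⟩
    obtain ⟨b1, b2, b3⟩ := hball y hy
    have := (hfr y b2).1 hyΩ
    refine ⟨_, b1, (hrep y).trans ?_⟩
    rw [this, sub_self, zero_smul, sub_zero]

/-! ### Trace and Poincaré inequalities for continuously differentiable functions -/

lemma measurable_enorm_sq {E : Type*} [NormedAddCommGroup E] {F : Plane → E} (hF : Continuous F) :
    Measurable fun y => ‖F y‖ₑ ^ 2 :=
  ((ENNReal.continuous_pow 2).comp hF.enorm).measurable

namespace BoundaryChart

variable {Ω : Set Plane} {x₀ : Plane} {V : Set Plane} (c : BoundaryChart Ω x₀ V)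

lemma measurable_param : Measurable fun z : ℝ × ℝ => c.P z.1 - z.2 • c.e :=
  c.measurePreserving.measurable

/-- Area preservation turns the iterated integral into one over the image of the parameter
rectangle, which lies in `Ω`. Conversely, in `lintegral_le_param` this image covers the part of `Ω`
in a ball. -/
lemma lintegral_param_le {F : Plane → ENNReal} (hF : Measurable F) (hΩ : MeasurableSet Ω) :
    ∫⁻ x in c.I, ∫⁻ s in Ioo 0 c.ℓ, F (c.P x - s • c.e) ≤ ∫⁻ y in Ω, F y := by
  have hm : Measurable fun z : ℝ × ℝ => F (c.P z.1 - z.2 • c.e) := hF.comp c.measurable_param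
  rw [← c.measurePreserving.setLIntegral_comp_preimage hΩ hF,
    ← lintegral_prod (f := fun z : ℝ × ℝ => F (c.P z.1 - z.2 • c.e)) hm.aemeasurable,
    Measure.prod_restrict]
  exact lintegral_mono_set fun z hz => c.mem _ hz.1 _ hz.2

lemma lintegral_le_param {F : Plane → ENNReal} (hF : Measurable F) (hΩ : MeasurableSet Ω) :
    ∫⁻ y in Metric.ball x₀ c.ρ ∩ Ω, F y ≤
      ∫⁻ x in c.I, ∫⁻ s in Ioo 0 c.ℓ, F (c.P x - s • c.e) := by
  have hm : Measurable fun z : ℝ × ℝ => F (c.P z.1 - z.2 • c.e) := hF.comp c.measurable_param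
  rw [← c.measurePreserving.setLIntegral_comp_preimage (Metric.isOpen_ball.measurableSet.inter hΩ)
      hF, ← lintegral_prod (f := fun z : ℝ × ℝ => F (c.P z.1 - z.2 • c.e)) hm.aemeasurable,
    Measure.prod_restrict]
  refine lintegral_mono_set fun z hz => ?_
  obtain ⟨x, hx, s, hs, h⟩ := c.exists_of_mem _ hz
  obtain rfl : z = (x, s) := c.injective h
  exact ⟨hx, hs.1, hs.2.trans (half_lt_self c.ℓ_pos)⟩

/-- Arc length is compared with the parameter measure in both directions: `P` stretches lengths at
most by `K`, and in `le_arcLength` it does not shorten them, since the first coordinate is recovered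
by a projection. -/
lemma arcLength_le :
    (μH[1] : Measure Plane).restrict (Metric.ball x₀ c.ρ ∩ frontier Ω) ≤
      (c.K : ENNReal) • ((volume : Measure ℝ).restrict c.I).map c.P := by
  have hP : Measurable c.P := c.lipschitz.continuous.measurable
  refine Measure.le_iff.2 fun s hs => ?_
  rw [Measure.restrict_apply hs, Measure.smul_apply, Measure.map_apply hP hs,
    Measure.restrict_apply (hP hs), smul_eq_mul]
  have h := c.lipschitz.hausdorffMeasure_image_le zero_le_one (c.P ⁻¹' s ∩ c.I)
  rw [ENNReal.rpow_one, hausdorffMeasure_real] at h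
  refine (measure_mono ?_).trans h
  rintro y ⟨hy, hy2⟩
  obtain ⟨x, hx, rfl⟩ := c.exists_of_mem_frontier y hy2
  exact ⟨x, ⟨hy, hx⟩, rfl⟩

lemma le_arcLength :
    ((volume : Measure ℝ).restrict c.I).map c.P ≤
      (μH[1] : Measure Plane).restrict (frontier Ω ∩ V) := by
  have hP : Measurable c.P := c.lipschitz.continuous.measurable
  refine Measure.le_iff.2 fun s hs => ?_
  rw [Measure.restrict_apply hs, Measure.map_apply hP hs, Measure.restrict_apply (hP hs)]
  have h := c.antilipschitz.le_hausdorffMeasure_image zero_le_one (c.P ⁻¹' s ∩ c.I)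
  rw [ENNReal.rpow_one, hausdorffMeasure_real, ENNReal.coe_one, one_mul] at h
  refine h.trans (measure_mono ?_)
  rintro _ ⟨x, ⟨hx, hxI⟩, rfl⟩
  exact ⟨hx, c.mem_frontier x hxI⟩

lemma enorm_sub_sq_le {φ : Plane → ℝ} (hφ : ContDiff ℝ 1 φ) (x : ℝ) {s : ℝ}
    (hs : s ∈ Ioo 0 c.ℓ) :
    ‖φ (c.P x - s • c.e) - φ (c.P x)‖ₑ ^ 2 ≤
      ENNReal.ofReal c.ℓ * ∫⁻ s in Ioo 0 c.ℓ, ‖gradient φ (c.P x - s • c.e)‖ₑ ^ 2 := by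
  have h := enorm_sub_sq_le_of_contDiff hφ (c.P x) (-c.e) hs.1.le
  have he : ‖-c.e‖ₑ = 1 := by rw [enorm_neg, ← ofReal_norm, c.norm_e, ENNReal.ofReal_one]
  simp only [smul_neg, ← sub_eq_add_neg, zero_smul, sub_zero, he, one_pow, one_mul] at h
  refine h.trans ?_
  gcongr
  · exact hs.2.le
  · exact hs.2

lemma measurable_lintegral_param {F : Plane → ENNReal} (hF : Measurable F) :
    Measurable fun x => ∫⁻ s in Ioo 0 c.ℓ, F (c.P x - s • c.e) :=
  (hF.comp c.measurable_param).lintegral_prod_right'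

/-- Local trace inequality: the boundary value at the top of a fibre is bounded by the value at
depth `s` plus the increment along the fibre. Averaging over `s` in (0, ℓ) yields the factor ℓ⁻¹;
integration over the fibres and passage to arc length complete the bound. -/
lemma lintegral_boundary_le (hΩ : MeasurableSet Ω) : ∃ C : NNReal, ∀ φ : Plane → ℝ,
    ContDiff ℝ 1 φ → ∫⁻ y in Metric.ball x₀ c.ρ ∩ frontier Ω, ‖φ y‖ₑ ^ 2 ∂(μH[1]) ≤
      C * ((∫⁻ y in Ω, ‖φ y‖ₑ ^ 2) + ∫⁻ y in Ω, ‖gradient φ y‖ₑ ^ 2) := by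
  set ℓ' : NNReal := ⟨c.ℓ, c.ℓ_pos.le⟩ with hℓ'
  have hℓ : ENNReal.ofReal c.ℓ = ℓ' := ENNReal.ofReal_eq_coe_nnreal c.ℓ_pos.le
  have hℓ0 : ℓ' ≠ 0 := fun h => c.ℓ_pos.ne' (congrArg NNReal.toReal h)
  refine ⟨c.K * (ℓ'⁻¹ * (2 + 2 * (ℓ' * ℓ'))), fun φ hφ => ?_⟩
  have hφm : Measurable fun y => ‖φ y‖ₑ ^ 2 := measurable_enorm_sq hφ.continuous
  have hgm : Measurable fun y => ‖gradient φ y‖ₑ ^ 2 :=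
    measurable_enorm_sq (continuous_gradient hφ)
  set D : ℝ → ENNReal := fun x => ∫⁻ s in Ioo 0 c.ℓ, ‖gradient φ (c.P x - s • c.e)‖ₑ ^ 2 with hD
  set B : ℝ → ENNReal := fun x => ∫⁻ s in Ioo 0 c.ℓ, ‖φ (c.P x - s • c.e)‖ₑ ^ 2 with hB
  have hDm : Measurable D := c.measurable_lintegral_param hgm
  have hBm : Measurable B := c.measurable_lintegral_param hφm
  have h1 : ∀ x, ℓ' * ‖φ (c.P x)‖ₑ ^ 2 ≤ 2 * B x + 2 * (ℓ' * ℓ') * D x := by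
    intro x
    calc ℓ' * ‖φ (c.P x)‖ₑ ^ 2 = ∫⁻ s in Ioo 0 c.ℓ, ‖φ (c.P x)‖ₑ ^ 2 := by
          rw [lintegral_const, Measure.restrict_apply_univ, Real.volume_Ioo, sub_zero, hℓ, mul_comm]
      _ ≤ ∫⁻ s in Ioo 0 c.ℓ, (2 * ‖φ (c.P x - s • c.e)‖ₑ ^ 2 + 2 * (ℓ' * D x)) := by
          refine setLIntegral_mono' measurableSet_Ioo fun s hs => ?_
          refine (enorm_sq_le_add (φ (c.P x)) (φ (c.P x - s • c.e))).trans ?_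
          rw [← enorm_neg (φ (c.P x) - _), neg_sub]
          gcongr
          exact (c.enorm_sub_sq_le hφ x hs).trans_eq (by rw [hℓ])
      _ = _ := by
          rw [lintegral_add_right _ measurable_const, lintegral_const_mul' _ _ (by finiteness),
            lintegral_const, Measure.restrict_apply_univ, Real.volume_Ioo, sub_zero, hℓ]
          ring
  have h2 : ℓ' * ∫⁻ x in c.I, ‖φ (c.P x)‖ₑ ^ 2 ≤
      2 * (∫⁻ y in Ω, ‖φ y‖ₑ ^ 2) + 2 * (ℓ' * ℓ') * ∫⁻ y in Ω, ‖gradient φ y‖ₑ ^ 2 := by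
    rw [← lintegral_const_mul' _ _ (by finiteness)]
    refine (lintegral_mono h1).trans ?_
    rw [lintegral_add_left (hBm.const_mul _), lintegral_const_mul' _ _ (by finiteness),
      lintegral_const_mul' _ _ (by finiteness)]
    gcongr
    · exact c.lintegral_param_le hφm hΩ
    · exact c.lintegral_param_le hgm hΩ
  have h3 : ∫⁻ y in Metric.ball x₀ c.ρ ∩ frontier Ω, ‖φ y‖ₑ ^ 2 ∂(μH[1]) ≤
      c.K * ∫⁻ x in c.I, ‖φ (c.P x)‖ₑ ^ 2 := by
    refine (lintegral_mono' c.arcLength_le le_rfl).trans_eq ?_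
    rw [lintegral_smul_measure, lintegral_map hφm c.lipschitz.continuous.measurable, smul_eq_mul]
  refine h3.trans ?_
  have h4 : ∫⁻ x in c.I, ‖φ (c.P x)‖ₑ ^ 2 =
      (ℓ'⁻¹ : NNReal) * (ℓ' * ∫⁻ x in c.I, ‖φ (c.P x)‖ₑ ^ 2) := by
    rw [← mul_assoc, ← ENNReal.coe_mul, inv_mul_cancel₀ hℓ0, ENNReal.coe_one, one_mul]
  rw [h4]
  push_cast
  rw [mul_assoc (c.K : ENNReal), mul_assoc ((ℓ'⁻¹ : NNReal) : ENNReal)]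
  refine mul_le_mul_right (mul_le_mul_right (h2.trans ?_) _) _
  rw [mul_add, add_mul, add_mul]
  gcongr
  · exact le_self_add
  · exact le_add_self

/-- The same comparison read in the opposite direction: interior values are controlled by the value
at the end of their fibre. Only boundary points in `V` enter, so `V` can be chosen to avoid the
fixed boundary. -/
lemma lintegral_interior_le (hΩ : MeasurableSet Ω) : ∃ C : NNReal, ∀ φ : Plane → ℝ,
    ContDiff ℝ 1 φ → ∫⁻ y in Metric.ball x₀ c.ρ ∩ Ω, ‖φ y‖ₑ ^ 2 ≤
      C * ((∫⁻ y in Ω, ‖gradient φ y‖ₑ ^ 2) +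
        ∫⁻ y in frontier Ω ∩ V, ‖φ y‖ₑ ^ 2 ∂(μH[1])) := by
  set ℓ' : NNReal := ⟨c.ℓ, c.ℓ_pos.le⟩ with hℓ'
  have hℓ : ENNReal.ofReal c.ℓ = ℓ' := ENNReal.ofReal_eq_coe_nnreal c.ℓ_pos.le
  refine ⟨2 * (ℓ' * ℓ') + 2 * ℓ', fun φ hφ => ?_⟩
  have hφm : Measurable fun y => ‖φ y‖ₑ ^ 2 := measurable_enorm_sq hφ.continuous
  have hgm : Measurable fun y => ‖gradient φ y‖ₑ ^ 2 :=
    measurable_enorm_sq (continuous_gradient hφ)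
  set D : ℝ → ENNReal := fun x => ∫⁻ s in Ioo 0 c.ℓ, ‖gradient φ (c.P x - s • c.e)‖ₑ ^ 2 with hD
  have hDm : Measurable D := c.measurable_lintegral_param hgm
  have h1 : ∀ x, ∫⁻ s in Ioo 0 c.ℓ, ‖φ (c.P x - s • c.e)‖ₑ ^ 2 ≤
      2 * ℓ' * ‖φ (c.P x)‖ₑ ^ 2 + 2 * (ℓ' * ℓ') * D x := by
    intro x
    calc _ ≤ ∫⁻ s in Ioo 0 c.ℓ, (2 * ‖φ (c.P x)‖ₑ ^ 2 + 2 * (ℓ' * D x)) := by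
          refine setLIntegral_mono' measurableSet_Ioo fun s hs => ?_
          refine (enorm_sq_le_add (φ (c.P x - s • c.e)) (φ (c.P x))).trans ?_
          gcongr
          exact (c.enorm_sub_sq_le hφ x hs).trans_eq (by rw [hℓ])
      _ = _ := by
          rw [lintegral_const, Measure.restrict_apply_univ, Real.volume_Ioo, sub_zero, hℓ]
          ring
  refine (c.lintegral_le_param hφm hΩ).trans ((lintegral_mono h1).trans ?_)
  rw [lintegral_add_right _ (hDm.const_mul _), lintegral_const_mul' _ _ (by finiteness),
    lintegral_const_mul' _ _ (by finiteness)]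
  have h3 : ∫⁻ x in c.I, ‖φ (c.P x)‖ₑ ^ 2 ≤ ∫⁻ y in frontier Ω ∩ V, ‖φ y‖ₑ ^ 2 ∂(μH[1]) := by
    rw [← lintegral_map hφm c.lipschitz.continuous.measurable]
    exact lintegral_mono' c.le_arcLength le_rfl
  have h4 := c.lintegral_param_le hgm hΩ
  push_cast
  rw [mul_add, add_comm]
  gcongr
  · exact le_self_add
  · exact le_add_self

end BoundaryChart

/-- Comparison of the mean squares over a set and over a translate of it. -/
lemma lintegral_sq_le_translate {Ω A B : Set Plane} (v : Plane)
    (hAB : ∀ y ∈ A, y + v ∈ B)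
    (hAΩ : ∀ y ∈ A, ∀ s ∈ Ioc (0 : ℝ) 1, y + s • v ∈ Ω) {φ : Plane → ℝ} (hφ : ContDiff ℝ 1 φ) :
    ∫⁻ y in A, ‖φ y‖ₑ ^ 2 ≤ 2 * (∫⁻ y in B, ‖φ y‖ₑ ^ 2) +
      2 * ‖v‖ₑ ^ 2 * ∫⁻ y in Ω, ‖gradient φ y‖ₑ ^ 2 := by
  have hgc : Continuous fun y => ‖gradient φ y‖ₑ ^ 2 :=
    (ENNReal.continuous_pow 2).comp (continuous_gradient hφ).enorm
  have hφm : Measurable fun y => ‖φ y‖ₑ ^ 2 := measurable_enorm_sq hφ.continuous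
  have hshift : ∀ {F : Plane → ENNReal} (w : Plane) {E : Set Plane},
      (∀ y ∈ A, y + w ∈ E) → ∫⁻ y in A, F (y + w) ≤ ∫⁻ y in E, F y := by
    intro F w E hE
    rw [(measurePreserving_add_right volume w).setLIntegral_comp_emb
      (measurableEmbedding_addRight w) F A]
    exact lintegral_mono_set (image_subset_iff.2 hE)
  have h1 : ∀ y, ‖φ y‖ₑ ^ 2 ≤ 2 * ‖φ (y + v)‖ₑ ^ 2 +
      2 * ‖v‖ₑ ^ 2 * ∫⁻ s in Ioc (0 : ℝ) 1, ‖gradient φ (y + s • v)‖ₑ ^ 2 := by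
    intro y
    refine (enorm_sq_le_add (φ y) (φ (y + v))).trans ?_
    rw [mul_assoc]
    gcongr
    have h := enorm_sub_sq_le_of_contDiff hφ y v zero_le_one
    simp only [one_smul, zero_smul, add_zero, sub_zero, ENNReal.ofReal_one, one_mul] at h
    rwa [← enorm_neg (φ y - _), neg_sub]
  have hm : Measurable fun z : Plane × ℝ => ‖gradient φ (z.1 + z.2 • v)‖ₑ ^ 2 :=
    (hgc.comp (by fun_prop : Continuous fun z : Plane × ℝ => z.1 + z.2 • v)).measurable
  refine (lintegral_mono h1).trans ?_
  rw [lintegral_add_left (f := fun y => 2 * ‖φ (y + v)‖ₑ ^ 2)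
      ((hφm.comp (measurable_add_const v)).const_mul 2),
    lintegral_const_mul' _ _ (by finiteness), lintegral_const_mul' _ _ (by finiteness),
    lintegral_lintegral_swap hm.aemeasurable]
  refine add_le_add (mul_le_mul_right (hshift (F := fun y => ‖φ y‖ₑ ^ 2) v hAB) _)
    (mul_le_mul_right ?_ _)
  calc _ ≤ ∫⁻ s in Ioc (0 : ℝ) 1, ∫⁻ y in Ω, ‖gradient φ y‖ₑ ^ 2 :=
        setLIntegral_mono' measurableSet_Ioc fun s hs =>
          hshift (F := fun y => ‖gradient φ y‖ₑ ^ 2) (s • v) fun y hy => hAΩ y hy s hs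
    _ = _ := by simp

/-- The trace inequality on a compact part of the boundary. -/
lemma exists_trace_inequality {Ω : Set Plane} (hΩ : IsOpen Ω) (hL : HasLipschitzBoundary Ω)
    {Γ : Set Plane} (hΓ : IsCompact Γ) (hsub : Γ ⊆ frontier Ω) :
    ∃ C : NNReal, ∀ φ : Plane → ℝ, ContDiff ℝ 1 φ → ∫⁻ y, ‖φ y‖ₑ ^ 2 ∂arcLength Γ ≤
      C * ((∫⁻ y in Ω, ‖φ y‖ₑ ^ 2) + ∫⁻ y in Ω, ‖gradient φ y‖ₑ ^ 2) := by
  refine hΓ.induction_on (p := fun s => ∃ C : NNReal, ∀ φ : Plane → ℝ, ContDiff ℝ 1 φ →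
    ∫⁻ y in s, ‖φ y‖ₑ ^ 2 ∂(μH[1]) ≤
      C * ((∫⁻ y in Ω, ‖φ y‖ₑ ^ 2) + ∫⁻ y in Ω, ‖gradient φ y‖ₑ ^ 2)) ?_ ?_ ?_ ?_
  · exact ⟨0, by simp⟩
  · rintro s t hst ⟨C, hC⟩
    exact ⟨C, fun φ hφ => (lintegral_mono_set hst).trans (hC φ hφ)⟩
  · rintro s t ⟨C, hC⟩ ⟨D, hD⟩
    refine ⟨C + D, fun φ hφ => (lintegral_union_le _ s t).trans ?_⟩
    push_cast
    rw [add_mul]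
    exact add_le_add (hC φ hφ) (hD φ hφ)
  · intro x hx
    obtain ⟨c⟩ := hL.exists_chart (hsub hx) univ_mem
    obtain ⟨C, hC⟩ := c.lintegral_boundary_le hΩ.measurableSet
    refine ⟨Metric.ball x c.ρ ∩ frontier Ω, ?_, C, hC⟩
    exact inter_mem (mem_nhdsWithin_of_mem_nhds (Metric.ball_mem_nhds x c.ρ_pos))
      (mem_of_superset self_mem_nhdsWithin hsub)

/-- The Poincaré inequality for functions that are controlled on the part `Γ` of the boundary
of `Ω` that is complementary to a closed set. -/
lemma exists_poincare_inequality {Ω : Set Plane} (hΩ : IsOpen Ω) (hconn : IsPreconnected Ω)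
    (hb : Bornology.IsBounded Ω) (hL : HasLipschitzBoundary Ω) {Γf : Set Plane}
    (hΓf : IsClosed Γf) (hne : (freeBoundary Γf Ω).Nonempty) :
    ∃ C : NNReal, ∀ φ : Plane → ℝ, ContDiff ℝ 1 φ → ∫⁻ y in Ω, ‖φ y‖ₑ ^ 2 ≤
      C * ((∫⁻ y in Ω, ‖gradient φ y‖ₑ ^ 2) +
        ∫⁻ y, ‖φ y‖ₑ ^ 2 ∂arcLength (freeBoundary Γf Ω)) := by
  set R : (Plane → ℝ) → ENNReal := fun φ => (∫⁻ y in Ω, ‖gradient φ y‖ₑ ^ 2) +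
        ∫⁻ y, ‖φ y‖ₑ ^ 2 ∂arcLength (freeBoundary Γf Ω) with hR
  set p : Set Plane → Prop := fun s => ∃ C : NNReal, ∀ φ : Plane → ℝ, ContDiff ℝ 1 φ →
    ∫⁻ y in s ∩ Ω, ‖φ y‖ₑ ^ 2 ≤ C * R φ with hp
  have pmono : ∀ s t : Set Plane, s ⊆ t → p t → p s := by
    rintro s t hst ⟨C, hC⟩
    exact ⟨C, fun φ hφ => (lintegral_mono_set (inter_subset_inter_left Ω hst)).trans (hC φ hφ)⟩
  have punion : ∀ s t : Set Plane, p s → p t → p (s ∪ t) := by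
    rintro s t ⟨C, hC⟩ ⟨D, hD⟩
    refine ⟨C + D, fun φ hφ => ?_⟩
    rw [union_inter_distrib_right]
    refine (lintegral_union_le _ _ _).trans ?_
    push_cast
    rw [add_mul]
    exact add_le_add (hC φ hφ) (hD φ hφ)
  -- The estimate moves from `B` to `A` whenever the translation by `v` carries `A ∩ Ω` into `B`
  -- along segments that stay in `Ω`.
  have ptrans : ∀ (A B : Set Plane) (v : Plane), (∀ y ∈ A ∩ Ω, y + v ∈ B) →
      (∀ y ∈ A ∩ Ω, ∀ s ∈ Ioc (0 : ℝ) 1, y + s • v ∈ Ω) → p B → p A := by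
    rintro A B v hAB hAΩ ⟨C, hC⟩
    refine ⟨2 * C + 2 * ‖v‖₊ ^ 2, fun φ hφ => ?_⟩
    have hAB' : ∀ y ∈ A ∩ Ω, y + v ∈ B ∩ Ω := fun y hy =>
      ⟨hAB y hy, by simpa using hAΩ y hy 1 ⟨one_pos, le_rfl⟩⟩
    refine (lintegral_sq_le_translate v hAB' hAΩ hφ).trans ?_
    push_cast
    rw [add_mul, mul_assoc 2 (C : ENNReal)]
    refine add_le_add (mul_le_mul_right (hC φ hφ) _) (mul_le_mul_right le_self_add _)
  -- Continuation argument: the points near which the estimate holds form an open set. It meets `Ω`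
  -- near the free boundary, is relatively closed in `Ω`, hence contains `Ω` by connectedness, and
  -- then also its boundary points. Compactness of the closure leaves a finite union.
  set G : Set Plane := {x | ∃ s ∈ 𝓝 x, p s} with hG
  have hGo : IsOpen G := by
    refine isOpen_iff_mem_nhds.2 fun x hx => ?_
    obtain ⟨s, hs, hps⟩ := hx
    filter_upwards [eventually_mem_nhds_iff.2 hs] with y hy using ⟨s, hy, hps⟩
  have hball : ∀ x ∈ G, ∃ r > 0, p (Metric.ball x r) := by
    rintro x ⟨s, hs, hps⟩
    obtain ⟨r, hr, hrs⟩ := Metric.mem_nhds_iff.1 hs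
    exact ⟨r, hr, pmono _ _ hrs hps⟩
  have hGΩ : (Ω ∩ G).Nonempty := by
    obtain ⟨x, hx, hxf⟩ := hne
    obtain ⟨c⟩ := hL.exists_chart hx (hΓf.isOpen_compl.mem_nhds hxf)
    obtain ⟨C, hC⟩ := c.lintegral_interior_le hΩ.measurableSet
    have hxG : x ∈ G := ⟨_, Metric.ball_mem_nhds x c.ρ_pos, C, hC⟩
    obtain ⟨y, hyG, hyΩ⟩ := mem_closure_iff.1 (frontier_subset_closure hx) G hGo hxG
    exact ⟨y, hyΩ, hyG⟩
  have hsub : Ω ⊆ G := by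
    refine hconn.subset_of_closure_inter_subset hGo hGΩ ?_
    rintro x ⟨hxG, hxΩ⟩
    obtain ⟨r, hr, hrΩ⟩ := Metric.isOpen_iff.1 hΩ x hxΩ
    obtain ⟨g, hgG, hgx⟩ := Metric.mem_closure_iff.1 hxG r hr
    obtain ⟨η, hη, hpη⟩ := hball g hgG
    -- The first bound makes the translated ball fit into the good ball around `g`; the second keeps
    -- the segments inside the ball of radius `r` around `x`, which lies in `Ω`.
    have hδ : 0 < min η (r - dist x g) := lt_min hη (sub_pos.2 hgx)
    refine ⟨_, Metric.ball_mem_nhds x hδ, ptrans _ _ (g - x) ?_ ?_ hpη⟩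
    · rintro y ⟨hy, -⟩
      rw [mem_ball_iff_norm] at hy ⊢
      rw [show y + (g - x) - g = y - x by abel]
      exact hy.trans_le (min_le_left _ _)
    · rintro y ⟨hy, -⟩ s hs
      apply hrΩ
      rw [mem_ball_iff_norm] at hy ⊢
      have h1 : ‖y - x‖ < r - dist x g := hy.trans_le (min_le_right _ _)
      have h2 : ‖s • (g - x)‖ ≤ dist x g := by
        rw [norm_smul, Real.norm_of_nonneg hs.1.le, dist_comm, dist_eq_norm]
        exact mul_le_of_le_one_left (norm_nonneg _) hs.2
      calc ‖y + s • (g - x) - x‖ = ‖(y - x) + s • (g - x)‖ := by congr 1; abel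
        _ ≤ ‖y - x‖ + ‖s • (g - x)‖ := norm_add_le _ _
        _ < r := by linarith
  have hcl : closure Ω ⊆ G := by
    rw [closure_eq_self_union_frontier]
    refine union_subset hsub fun x hx => ?_
    obtain ⟨c⟩ := hL.exists_chart hx univ_mem
    have hℓ := c.ℓ_pos
    obtain ⟨x', hx'I, hx'⟩ :=
      c.exists_of_mem_frontier x ⟨Metric.mem_ball_self c.ρ_pos, hx⟩
    have hz : x - (c.ℓ / 2) • c.e ∈ Ω :=
      (congrArg (fun z => z - (c.ℓ / 2) • c.e ∈ Ω) hx').mpr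
        (c.mem x' hx'I _ ⟨half_pos hℓ, half_lt_self hℓ⟩)
    obtain ⟨η, hη, hpη⟩ := hball _ (hsub hz)
    -- A shift inwards by ℓ/2 carries a neighbourhood of the boundary point to an interior point
    -- already treated. Depths below ℓ/2 stay below ℓ, so the segments remain in the chart.
    refine ⟨_, Metric.ball_mem_nhds x (lt_min hη c.ρ_pos),
      ptrans _ _ (-((c.ℓ / 2) • c.e)) ?_ ?_ hpη⟩
    · rintro y ⟨hy, -⟩
      rw [mem_ball_iff_norm] at hy ⊢
      rw [show y + -((c.ℓ / 2) • c.e) - (x - (c.ℓ / 2) • c.e) = y - x by abel]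
      exact hy.trans_le (min_le_left _ _)
    · rintro y ⟨hy, hyΩ⟩ s hs
      obtain ⟨a, ha, b, hb, rfl⟩ :=
        c.exists_of_mem y ⟨Metric.ball_subset_ball (min_le_right _ _) hy, hyΩ⟩
      have : c.P a - b • c.e + s • -((c.ℓ / 2) • c.e) = c.P a - (b + s * (c.ℓ / 2)) • c.e := by
        module
      rw [this]
      refine c.mem a ha _ ⟨?_, ?_⟩
      · have := hb.1; have := hs.1; positivity
      · have := hb.2; nlinarith [hs.2]
  obtain ⟨C, hC⟩ : p (closure Ω) := by
    refine hb.isCompact_closure.induction_on (p := p) ⟨0, by simp⟩ pmono punion fun x hx => ?_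
    obtain ⟨s, hs, hps⟩ := hcl hx
    exact ⟨s, mem_nhdsWithin_of_mem_nhds hs, hps⟩
  refine ⟨C, fun φ hφ => ?_⟩
  have := hC φ hφ
  rwa [inter_eq_right.2 subset_closure] at this

/-! ### Traces and the Poincaré inequality in `V(Ω)` -/

lemma le_mul_of_sq_le {a b c : ENNReal} {C : NNReal} (h : a ^ 2 ≤ C * (b ^ 2 + c ^ 2)) :
    a ≤ (NNReal.sqrt C) * (b + c) := by
  have h2 : a ^ 2 ≤ ((NNReal.sqrt C) * (b + c)) ^ 2 := by
    rw [mul_pow, ← ENNReal.coe_pow, NNReal.sq_sqrt]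
    refine h.trans (mul_le_mul_right ?_ _)
    rw [add_sq]
    gcongr
    exact le_self_add
  exact (ENNReal.pow_le_pow_left_iff two_ne_zero).1 h2

lemma exists_trace_inequality_eLpNorm {Ω : Set Plane} (hΩ : IsOpen Ω)
    (hL : HasLipschitzBoundary Ω) {Γ : Set Plane} (hΓ : IsCompact Γ) (hsub : Γ ⊆ frontier Ω) :
    ∃ C : NNReal, ∀ φ : Plane → ℝ, ContDiff ℝ 1 φ → eLpNorm φ 2 (arcLength Γ) ≤
      C * (eLpNorm φ 2 (volume.restrict Ω) + eLpNorm (gradient φ) 2 (volume.restrict Ω)) := by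
  obtain ⟨C, hC⟩ := exists_trace_inequality hΩ hL hΓ hsub
  refine ⟨_, fun φ hφ => le_mul_of_sq_le (C := C) ?_⟩
  simpa only [eLpNorm_two_sq] using hC φ hφ

lemma exists_poincare_inequality_eLpNorm {Ω : Set Plane} (hΩ : IsOpen Ω)
    (hconn : IsPreconnected Ω) (hb : Bornology.IsBounded Ω) (hL : HasLipschitzBoundary Ω)
    {Γf : Set Plane} (hΓf : IsClosed Γf) (hne : (freeBoundary Γf Ω).Nonempty) :
    ∃ C : NNReal, ∀ φ : Plane → ℝ, ContDiff ℝ 1 φ → eLpNorm φ 2 (volume.restrict Ω) ≤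
      C * (eLpNorm (gradient φ) 2 (volume.restrict Ω) +
        eLpNorm φ 2 (arcLength (freeBoundary Γf Ω))) := by
  obtain ⟨C, hC⟩ := exists_poincare_inequality hΩ hconn hb hL hΓf hne
  refine ⟨_, fun φ hφ => le_mul_of_sq_le (C := C) ?_⟩
  simpa only [eLpNorm_two_sq] using hC φ hφ

section Limits

variable {α E : Type*} [MeasurableSpace α] [NormedAddCommGroup E] {μ : Measure α}

lemma eLpNorm_le_add_sub {f g : α → E} (hf : AEStronglyMeasurable f μ)
    (hg : AEStronglyMeasurable g μ) :
    eLpNorm f 2 μ ≤ eLpNorm g 2 μ + eLpNorm (fun x => f x - g x) 2 μ := by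
  have := eLpNorm_add_le (p := 2) hg (hf.sub hg) (by norm_num)
  rwa [add_sub_cancel] at this

lemma eLpNorm_sub_swap (f g : α → E) :
    eLpNorm (fun x => f x - g x) 2 μ = eLpNorm (fun x => g x - f x) 2 μ :=
  eLpNorm_congr_norm_ae (Eventually.of_forall fun _ => norm_sub_rev _ _)

lemma tendsto_eLpNorm_of_tendsto_sub {a : ℕ → α → E} {f : α → E}
    (ha : ∀ n, AEStronglyMeasurable (a n) μ) (hf : AEStronglyMeasurable f μ)
    (h : Tendsto (fun n => eLpNorm (fun x => a n x - f x) 2 μ) atTop (𝓝 0)) :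
    Tendsto (fun n => eLpNorm (a n) 2 μ) atTop (𝓝 (eLpNorm f 2 μ)) := by
  refine tendsto_of_tendsto_of_tendsto_of_le_of_le
    (g := fun n => eLpNorm f 2 μ - eLpNorm (fun x => a n x - f x) 2 μ)
    (h := fun n => eLpNorm f 2 μ + eLpNorm (fun x => a n x - f x) 2 μ) ?_ ?_ (fun n => ?_)
    (fun n => eLpNorm_le_add_sub (ha n) hf)
  · simpa using ENNReal.Tendsto.sub tendsto_const_nhds h (Or.inr ENNReal.zero_ne_top)
  · simpa using tendsto_const_nhds.add h
  · rw [tsub_le_iff_right, eLpNorm_sub_swap]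
    exact eLpNorm_le_add_sub hf (ha n)

end Limits

lemma HasTrace.eLpNorm_le {Ω Γ : Set Plane} {C : NNReal}
    (hC : ∀ φ : Plane → ℝ, ContDiff ℝ 1 φ → eLpNorm φ 2 (arcLength Γ) ≤
      C * (eLpNorm φ 2 (volume.restrict Ω) + eLpNorm (gradient φ) 2 (volume.restrict Ω)))
    {v g : Plane → ℝ} (h : HasTrace Ω Γ v g) :
    eLpNorm g 2 (arcLength Γ) ≤
      C * (eLpNorm v 2 (volume.restrict Ω) + eLpNorm (weakGrad Ω v) 2 (volume.restrict Ω)) := by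
  obtain ⟨φ, a, t⟩ := h.exists_approx
  have c := fun n => (a.contDiff n).continuous
  refine le_of_tendsto_of_tendsto'
    (tendsto_eLpNorm_of_tendsto_sub (fun n => (c n).aestronglyMeasurable) h.2.1.1 t)
    (ENNReal.Tendsto.const_mul
      ((tendsto_eLpNorm_of_tendsto_sub (fun n => (c n).aestronglyMeasurable) a.memLp.1
        a.tendsto).add
      (tendsto_eLpNorm_of_tendsto_sub
        (fun n => (continuous_gradient (a.contDiff n)).aestronglyMeasurable) a.memLp_grad.1
        a.tendsto_grad)) (Or.inr ENNReal.coe_ne_top)) (fun n => hC _ (a.contDiff n))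

/-- The approximants need not vanish on the free boundary, but their norm there tends to zero. This
is why the inequality for C¹ functions carries a boundary term. -/
lemma exists_poincare_memV {Ω : Set Plane} (hΩ : IsOpen Ω)
    (hconn : IsPreconnected Ω) (hb : Bornology.IsBounded Ω) (hL : HasLipschitzBoundary Ω)
    {Γf : Set Plane} (hΓf : IsClosed Γf) (hne : (freeBoundary Γf Ω).Nonempty) :
    ∃ C : NNReal, ∀ v : Plane → ℝ, MemV Γf Ω v → eLpNorm v 2 (volume.restrict Ω) ≤
      C * eLpNorm (weakGrad Ω v) 2 (volume.restrict Ω) := by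
  obtain ⟨C, hC⟩ := exists_poincare_inequality_eLpNorm hΩ hconn hb hL hΓf hne
  refine ⟨C, fun v hv => ?_⟩
  obtain ⟨φ, a, t⟩ := hv.2.exists_approx
  have c := fun n => (a.contDiff n).continuous
  have t' := tendsto_eLpNorm_of_tendsto_sub (fun n => (c n).aestronglyMeasurable) hv.2.2.1.1 t
  rw [eLpNorm_zero] at t'
  have := le_of_tendsto_of_tendsto'
    (tendsto_eLpNorm_of_tendsto_sub (fun n => (c n).aestronglyMeasurable) a.memLp.1 a.tendsto)
    (ENNReal.Tendsto.const_mul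
      ((tendsto_eLpNorm_of_tendsto_sub
        (fun n => (continuous_gradient (a.contDiff n)).aestronglyMeasurable) a.memLp_grad.1
        a.tendsto_grad).add t') (Or.inr ENNReal.coe_ne_top)) (fun n => hC _ (a.contDiff n))
  simpa using this

/-- The difference of two traces of `v` is a trace of v - v, whose H¹ norm is zero. -/
lemma HasTrace.ae_eq {Ω Γ : Set Plane} (hΩ : IsOpen Ω) (hb : Bornology.IsBounded Ω)
    {C : NNReal}
    (hC : ∀ φ : Plane → ℝ, ContDiff ℝ 1 φ → eLpNorm φ 2 (arcLength Γ) ≤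
      C * (eLpNorm φ 2 (volume.restrict Ω) + eLpNorm (gradient φ) 2 (volume.restrict Ω)))
    {v g k : Plane → ℝ} (h1 : HasTrace Ω Γ v g) (h2 : HasTrace Ω Γ v k) :
    g =ᵐ[arcLength Γ] k := by
  obtain ⟨φ, a, -⟩ := h1.exists_approx
  have h := (h1.sub hΩ hb h2).eLpNorm_le hC
  have hw : eLpNorm (weakGrad Ω fun x => v x - v x) 2 (volume.restrict Ω) = 0 := by
    rw [eLpNorm_congr_ae ((a.sub a).weakGrad_ae_eq hΩ hb)]
    simp
  rw [hw] at h
  simp only [sub_self, eLpNorm_zero', add_zero, mul_zero, nonpos_iff_eq_zero] at h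
  rw [eLpNorm_eq_zero_iff (f := fun x => g x - k x) (h1.2.1.1.sub h2.2.1.1) (by norm_num)] at h
  filter_upwards [h] with x hx using sub_eq_zero.1 hx

/-- By the trace inequality the boundary values of an H¹-Cauchy sequence are Cauchy in L²(Γ), and
this space is complete. -/
lemma ApproxH1.exists_hasTrace {Ω Γ : Set Plane} (hΩ : IsOpen Ω) (hb : Bornology.IsBounded Ω)
    {C : NNReal}
    (hC : ∀ φ : Plane → ℝ, ContDiff ℝ 1 φ → eLpNorm φ 2 (arcLength Γ) ≤
      C * (eLpNorm φ 2 (volume.restrict Ω) + eLpNorm (gradient φ) 2 (volume.restrict Ω)))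
    {v : Plane → ℝ} {G : Plane → Plane} {φ : ℕ → Plane → ℝ} (a : ApproxH1 Ω v G φ) :
    ∃ g, HasTrace Ω Γ v g := by
  have hm : ∀ n, MemLp (φ n) 2 (arcLength Γ) := fun n =>
    ⟨(a.contDiff n).continuous.aestronglyMeasurable, (hC _ (a.contDiff n)).trans_lt
      (ENNReal.mul_lt_top ENNReal.coe_lt_top (ENNReal.add_lt_top.2
        ⟨(memLp_restrict_of_continuous (a.contDiff n).continuous hb).2,
        (memLp_restrict_of_continuous (continuous_gradient (a.contDiff n)) hb).2⟩))⟩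
  set Δ : ℕ → ENNReal := fun n => eLpNorm (fun x => φ n x - v x) 2 (volume.restrict Ω) +
    eLpNorm (fun x => gradient (φ n) x - G x) 2 (volume.restrict Ω) with hΔ
  have hΔ0 : Tendsto Δ atTop (𝓝 0) := by simpa using a.tendsto.add a.tendsto_grad
  have hsub : ∀ {F : Type} [NormedAddCommGroup F] {b c d : Plane → F},
      AEStronglyMeasurable b (volume.restrict Ω) → AEStronglyMeasurable c (volume.restrict Ω) →
      AEStronglyMeasurable d (volume.restrict Ω) →
      eLpNorm (fun x => b x - c x) 2 (volume.restrict Ω) ≤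
      eLpNorm (fun x => b x - d x) 2 (volume.restrict Ω) +
        eLpNorm (fun x => c x - d x) 2 (volume.restrict Ω) := by
    intro F _ b c d hb' hc' hd'
    refine le_trans (le_of_eq ?_) (eLpNorm_sub_le (hb'.sub hd') (hc'.sub hd') (by norm_num))
    congr 1
    ext x
    simp
  have hdist : ∀ n m, edist ((hm n).toLp (φ n)) ((hm m).toLp (φ m)) ≤ C * (Δ n + Δ m) := by
    intro n m
    rw [Lp.edist_toLp_toLp]
    refine (hC _ ((a.contDiff n).sub (a.contDiff m))).trans (mul_le_mul_right ?_ _)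
    have hg : (gradient fun x => φ n x - φ m x) =
        fun x => gradient (φ n) x - gradient (φ m) x :=
      funext (gradient_sub ((a.contDiff n).differentiable (by norm_num))
        ((a.contDiff m).differentiable (by norm_num)))
    rw [hg]
    refine (add_le_add (hsub (a.contDiff n).continuous.aestronglyMeasurable
      (a.contDiff m).continuous.aestronglyMeasurable a.memLp.1)
      (hsub (continuous_gradient (a.contDiff n)).aestronglyMeasurable
      (continuous_gradient (a.contDiff m)).aestronglyMeasurable a.memLp_grad.1)).trans_eq ?_
    simp only [hΔ]
    ring
  have hcau : CauchySeq fun n => (hm n).toLp (φ n) := by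
    refine EMetric.cauchySeq_iff.2 fun ε hε => ?_
    have hlim : Tendsto (fun z : ℕ × ℕ => (C : ENNReal) * (Δ z.1 + Δ z.2)) atTop (𝓝 0) := by
      have := ENNReal.Tendsto.const_mul (a := (C : ENNReal))
        ((hΔ0.comp tendsto_fst).add (hΔ0.comp tendsto_snd)) (Or.inr ENNReal.coe_ne_top)
      rw [prod_atTop_atTop_eq] at this
      simpa using this
    obtain ⟨⟨N, M⟩, hN⟩ := eventually_atTop.1 (hlim.eventually_lt_const hε)
    exact ⟨max N M, fun m hm' n hn' => (hdist m n).trans_lt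
      (hN (m, n) ⟨(le_max_left _ _).trans hm', (le_max_right _ _).trans hn'⟩)⟩
  obtain ⟨g, hg⟩ := cauchySeq_tendsto_of_complete hcau
  refine ⟨g, a.hasTrace hΩ hb (Lp.memLp g) ?_⟩
  rw [Lp.tendsto_Lp_iff_tendsto_eLpNorm'] at hg
  refine hg.congr fun n => eLpNorm_congr_ae ?_
  filter_upwards [(hm n).coeFn_toLp] with x hx
  simp [hx]

lemma HasTrace.hasTrace_trace {Ω Γ : Set Plane} {v g : Plane → ℝ} (h : HasTrace Ω Γ v g) :
    HasTrace Ω Γ v (trace Ω Γ v) := by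
  have h' : ∃ g, HasTrace Ω Γ v g := ⟨g, h⟩
  rw [trace, dif_pos h']
  exact h'.choose_spec

/-! ### Change of variables -/

section MapLe

variable {α : Type*} [MeasurableSpace α] {μ ν : Measure α} {T : α → α} {c : ENNReal}

lemma aestronglyMeasurable_comp_of_map_le {E : Type*} [NormedAddCommGroup E] {g : α → E}
    (hT : Measurable T) (h : μ.map T ≤ c • ν) (hg : AEStronglyMeasurable g ν) :
    AEStronglyMeasurable (fun x => g (T x)) μ :=
  ((hg.smul_measure c).mono_measure h).comp_measurable hT

/-- The one-sided bound on the image measure is all that composition in L² requires. It applies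
alike to area and to arc length, without a Jacobian formula. -/
lemma eLpNorm_comp_le_of_map_le {E : Type*} [NormedAddCommGroup E] {g : α → E}
    (hT : Measurable T) (h : μ.map T ≤ c • ν) (hg : AEStronglyMeasurable g ν) :
    eLpNorm (fun x => g (T x)) 2 μ ≤ c ^ (1 / 2 : ℝ) * eLpNorm g 2 ν := by
  have h1 := eLpNorm_map_measure (p := 2) ((hg.smul_measure c).mono_measure h) hT.aemeasurable
  calc _ = eLpNorm g 2 (μ.map T) := h1.symm
    _ ≤ eLpNorm g 2 (c • ν) := eLpNorm_mono_measure g h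
    _ = _ := by
      rw [eLpNorm_smul_measure_of_ne_top (by norm_num)]
      simp

lemma memLp_comp_of_map_le {E : Type*} [NormedAddCommGroup E] {g : α → E}
    (hT : Measurable T) (h : μ.map T ≤ c • ν) (hc : c ≠ ⊤) (hg : MemLp g 2 ν) :
    MemLp (fun x => g (T x)) 2 μ :=
  ⟨aestronglyMeasurable_comp_of_map_le hT h hg.1,
    (eLpNorm_comp_le_of_map_le hT h hg.1).trans_lt (ENNReal.mul_lt_top
      (ENNReal.rpow_lt_top_of_nonneg (by norm_num) hc) hg.2)⟩

lemma tendsto_eLpNorm_comp_of_map_le {E : Type*} [NormedAddCommGroup E] {a : ℕ → α → E}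
    {g : α → E} (hT : Measurable T) (h : μ.map T ≤ c • ν) (hc : c ≠ ⊤)
    (ha : ∀ n, AEStronglyMeasurable (a n) ν) (hg : AEStronglyMeasurable g ν)
    (hag : Tendsto (fun n => eLpNorm (fun x => a n x - g x) 2 ν) atTop (𝓝 0)) :
    Tendsto (fun n => eLpNorm (fun x => a n (T x) - g (T x)) 2 μ) atTop (𝓝 0) := by
  have h0 := ENNReal.Tendsto.const_mul (a := c ^ (1 / 2 : ℝ)) hag
    (Or.inr (ENNReal.rpow_lt_top_of_nonneg (by norm_num) hc).ne)
  rw [mul_zero] at h0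
  exact tendsto_of_tendsto_of_tendsto_of_le_of_le tendsto_const_nhds h0 (fun _ => zero_le)
    (fun n => eLpNorm_comp_le_of_map_le (g := fun x => a n x - g x) hT h ((ha n).sub hg))

lemma ae_comp_of_map_le {p : α → Prop} (hT : Measurable T) (h : μ.map T ≤ c • ν)
    (hp : ∀ᵐ x ∂ν, p x) : ∀ᵐ x ∂μ, p (T x) :=
  ae_of_ae_map hT.aemeasurable
    (Measure.absolutelyContinuous_of_le_smul h |>.ae_le hp)

end MapLe

/-- `T` is a `C¹` diffeomorphism of the plane with inverse `S`; both are Lipschitz maps. -/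
structure IsLipDiffeo (T S : Plane → Plane) (K : NNReal) : Prop where
  contDiff : ContDiff ℝ 1 T
  contDiff_inv : ContDiff ℝ 1 S
  left_inv : ∀ x, S (T x) = x
  right_inv : ∀ x, T (S x) = x
  lipschitz : LipschitzWith K T
  lipschitz_inv : LipschitzWith K S

namespace IsLipDiffeo

variable {T S : Plane → Plane} {K : NNReal}

lemma symm (h : IsLipDiffeo T S K) : IsLipDiffeo S T K :=
  ⟨h.contDiff_inv, h.contDiff, h.right_inv, h.left_inv, h.lipschitz_inv, h.lipschitz⟩

lemma measurable (h : IsLipDiffeo T S K) : Measurable T := h.contDiff.continuous.measurable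

lemma injective (h : IsLipDiffeo T S K) : Function.Injective T :=
  Function.LeftInverse.injective h.left_inv

lemma image_image_symm (h : IsLipDiffeo T S K) (A : Set Plane) : S '' (T '' A) = A := by
  simp [image_image, h.left_inv]

/-- The homeomorphism underlying a diffeomorphism. -/
def toHomeomorph (h : IsLipDiffeo T S K) : Plane ≃ₜ Plane where
  toFun := T
  invFun := S
  left_inv := h.left_inv
  right_inv := h.right_inv
  continuous_toFun := h.contDiff.continuous
  continuous_invFun := h.contDiff_inv.continuous

lemma isOpen_image (h : IsLipDiffeo T S K) {Ω : Set Plane} (hΩ : IsOpen Ω) : IsOpen (T '' Ω) :=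
  h.toHomeomorph.isOpen_image.2 hΩ

lemma isBounded_image (h : IsLipDiffeo T S K) {Ω : Set Plane} (hΩ : Bornology.IsBounded Ω) :
    Bornology.IsBounded (T '' Ω) := h.lipschitz.isBounded_image hΩ

lemma frontier_image (h : IsLipDiffeo T S K) (Ω : Set Plane) :
    frontier (T '' Ω) = T '' frontier Ω := (h.toHomeomorph.image_frontier Ω).symm

lemma map_volume_le (h : IsLipDiffeo T S K) (Ω : Set Plane) :
    ((volume : Measure Plane).restrict Ω).map T ≤
      ((K : ENNReal) ^ (2 : ℝ)) • (volume : Measure Plane).restrict (T '' Ω) :=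
  map_restrict_volume_le h.measurable h.left_inv h.lipschitz_inv Ω

lemma map_arcLength_le (h : IsLipDiffeo T S K) (Γ : Set Plane) :
    (arcLength Γ).map T ≤ (K : ENNReal) • arcLength (T '' Γ) := by
  have := map_restrict_hausdorffMeasure_le h.measurable h.left_inv h.lipschitz_inv zero_le_one Γ
  rwa [ENNReal.rpow_one] at this

lemma fderiv_comp_fderiv_inv (h : IsLipDiffeo T S K) (x : Plane) :
    (fderiv ℝ S (T x)).comp (fderiv ℝ T x) = ContinuousLinearMap.id ℝ Plane := by
  rw [← fderiv_comp x (h.contDiff_inv.differentiable (by norm_num) _)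
    (h.contDiff.differentiable (by norm_num) _), show S ∘ T = id from funext h.left_inv, fderiv_id]

lemma fderiv_inv_comp_fderiv (h : IsLipDiffeo T S K) (x : Plane) :
    (fderiv ℝ T x).comp (fderiv ℝ S (T x)) = ContinuousLinearMap.id ℝ Plane := by
  simpa only [h.left_inv] using h.symm.fderiv_comp_fderiv_inv (T x)

end IsLipDiffeo

lemma gradient_comp {φ : Plane → ℝ} {T : Plane → Plane} (hφ : Differentiable ℝ φ)
    (hT : Differentiable ℝ T) (x : Plane) :
    gradient (fun x => φ (T x)) x =
      ContinuousLinearMap.adjoint (fderiv ℝ T x) (gradient φ (T x)) := by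
  refine ext_inner_right ℝ fun v => ?_
  rw [inner_gradient, ContinuousLinearMap.adjoint_inner_left, inner_gradient,
    show (fun x => φ (T x)) = φ ∘ T from rfl, fderiv_comp x (hφ _) (hT _)]
  rfl

lemma aestronglyMeasurable_clm_apply {μ : Measure Plane} {A : Plane → Plane →L[ℝ] Plane}
    (hA : Continuous A) {ξ : Plane → Plane} (hξ : AEStronglyMeasurable ξ μ) :
    AEStronglyMeasurable (fun x => A x (ξ x)) μ :=
  (ContinuousLinearMap.id ℝ (Plane →L[ℝ] Plane)).aestronglyMeasurable_comp₂
    hA.aestronglyMeasurable hξ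

lemma continuous_adjoint_fderiv {T : Plane → Plane} (hT : ContDiff ℝ 1 T) :
    Continuous fun x => ContinuousLinearMap.adjoint (fderiv ℝ T x) :=
  ContinuousLinearMap.adjoint.continuous.comp (hT.continuous_fderiv one_ne_zero)

/-- By the chain rule gradients are multiplied by the adjoint of DT, whose norm is at most `K`.
Convergence in H¹ therefore survives the composition, and the approximants remain C¹ on the plane.
-/
lemma ApproxH1.comp {T S : Plane → Plane} {K : NNReal} (h : IsLipDiffeo T S K) {Ω : Set Plane}
    {v : Plane → ℝ} {G : Plane → Plane} {φ : ℕ → Plane → ℝ} (a : ApproxH1 (T '' Ω) v G φ) :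
    ApproxH1 Ω (fun x => v (T x))
      (fun x => ContinuousLinearMap.adjoint (fderiv ℝ T x) (G (T x))) (fun n x => φ n (T x)) := by
  have hc : ((K : ENNReal) ^ (2 : ℝ)) ≠ ⊤ := by finiteness
  have hmap := h.map_volume_le Ω
  have hA := continuous_adjoint_fderiv h.contDiff
  have hbound : ∀ x ξ, ‖ContinuousLinearMap.adjoint (fderiv ℝ T x) ξ‖ ≤ K * ‖ξ‖ := by
    intro x ξ
    refine (ContinuousLinearMap.le_opNorm _ _).trans ?_
    rw [LinearIsometryEquiv.norm_map]
    gcongr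
    exact norm_fderiv_le_of_lipschitz ℝ h.lipschitz
  have hG := memLp_comp_of_map_le h.measurable hmap hc a.memLp_grad
  refine ⟨memLp_comp_of_map_le h.measurable hmap hc a.memLp, ?_,
    fun n => (a.contDiff n).comp h.contDiff, ?_, ?_⟩
  · exact MemLp.of_le_mul hG (aestronglyMeasurable_clm_apply hA hG.1)
      (Eventually.of_forall fun x => hbound x _)
  · exact tendsto_eLpNorm_comp_of_map_le h.measurable hmap hc
      (fun n => (a.contDiff n).continuous.aestronglyMeasurable) a.memLp.1 a.tendsto
  · have h1 := tendsto_eLpNorm_comp_of_map_le h.measurable hmap hc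
      (fun n => (continuous_gradient (a.contDiff n)).aestronglyMeasurable) a.memLp_grad.1
      a.tendsto_grad
    have h0 := ENNReal.Tendsto.const_mul (a := ENNReal.ofReal K) h1
      (Or.inr ENNReal.ofReal_ne_top)
    rw [mul_zero] at h0
    refine tendsto_of_tendsto_of_tendsto_of_le_of_le tendsto_const_nhds h0
      (fun _ => zero_le) fun n => ?_
    refine eLpNorm_le_mul_eLpNorm_of_ae_le_mul (Eventually.of_forall fun x => ?_) 2
    rw [gradient_comp ((a.contDiff n).differentiable (by norm_num))
      (h.contDiff.differentiable (by norm_num)), ← map_sub]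
    exact hbound x _

lemma HasTrace.comp {T S : Plane → Plane} {K : NNReal} (h : IsLipDiffeo T S K) {Ω Γ : Set Plane}
    (hΩ : IsOpen Ω) (hb : Bornology.IsBounded Ω) {v g : Plane → ℝ}
    (hv : HasTrace (T '' Ω) (T '' Γ) v g) :
    HasTrace Ω Γ (fun x => v (T x)) (fun x => g (T x)) := by
  obtain ⟨φ, a, t⟩ := hv.exists_approx
  exact (a.comp h).hasTrace hΩ hb
    (memLp_comp_of_map_le h.measurable (h.map_arcLength_le Γ) ENNReal.coe_ne_top hv.2.1)
    (tendsto_eLpNorm_comp_of_map_le h.measurable (h.map_arcLength_le Γ) ENNReal.coe_ne_top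
      (fun n => (a.contDiff n).continuous.aestronglyMeasurable) hv.2.1.1 t)

lemma HasTrace.congr_ae {Ω Γ : Set Plane} {v g k : Plane → ℝ} (h : HasTrace Ω Γ v g)
    (hgk : g =ᵐ[arcLength Γ] k) : HasTrace Ω Γ v k := by
  obtain ⟨h1, h2, φ, c, t1, t2, t3⟩ := h
  refine ⟨h1, h2.ae_eq hgk, φ, c, t1, t2, t3.congr fun n => eLpNorm_congr_ae ?_⟩
  filter_upwards [hgk] with x hx
  rw [hx]

section Fixed

variable {T S : Plane → Plane} {K : NNReal} {Γf : Set Plane}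

lemma image_eq_of_fixed (hT : ∀ x ∈ Γf, T x = x) : T '' Γf = Γf := by
  rw [image_congr hT, image_id']

lemma freeBoundary_image (h : IsLipDiffeo T S K) (hT : ∀ x ∈ Γf, T x = x) (Ω : Set Plane) :
    freeBoundary Γf (T '' Ω) = T '' freeBoundary Γf Ω := by
  rw [freeBoundary, freeBoundary, h.frontier_image, image_sdiff h.injective, image_eq_of_fixed hT]

lemma inv_fixed (h : IsLipDiffeo T S K) (hT : ∀ x ∈ Γf, T x = x) : ∀ x ∈ Γf, S x = x := by
  intro x hx
  conv_lhs => rw [← hT x hx]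
  exact h.left_inv x

lemma MemV.comp (h : IsLipDiffeo T S K) (hT : ∀ x ∈ Γf, T x = x) {Ω : Set Plane}
    (hΩ : IsOpen Ω) (hb : Bornology.IsBounded Ω) {v : Plane → ℝ} (hv : MemV Γf (T '' Ω) v) :
    MemV Γf Ω (fun x => v (T x)) := by
  have := hv.2
  rw [freeBoundary_image h hT] at this
  have h2 := this.comp h hΩ hb
  exact ⟨h2.1, h2⟩

lemma MemV.comp_inv (h : IsLipDiffeo T S K) (hT : ∀ x ∈ Γf, T x = x) {Ω : Set Plane}
    (hΩ : IsOpen Ω) (hb : Bornology.IsBounded Ω) {v : Plane → ℝ} (hv : MemV Γf Ω v) :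
    MemV Γf (T '' Ω) (fun x => v (S x)) := by
  rw [← h.image_image_symm Ω] at hv
  exact hv.comp h.symm (inv_fixed h hT) (h.isOpen_image hΩ) (h.isBounded_image hb)

/-- As `T` is the identity on `Γf`, composition with it leaves the boundary function unchanged. -/
lemma HasTrace.comp_fixed (h : IsLipDiffeo T S K) (hT : ∀ x ∈ Γf, T x = x)
    (hΓf : IsClosed Γf) {Ω : Set Plane} (hΩ : IsOpen Ω) (hb : Bornology.IsBounded Ω)
    {v g : Plane → ℝ} (hv : HasTrace (T '' Ω) Γf v g) :
    HasTrace Ω Γf (fun x => v (T x)) g := by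
  rw [← image_eq_of_fixed hT] at hv
  refine (hv.comp h hΩ hb).congr_ae ?_
  filter_upwards [ae_restrict_mem hΓf.measurableSet] with x hx
  rw [hT x hx]

/-- The field by which the Dirichlet form is transformed. -/
noncomputable def pullbackField (T S : Plane → Plane) (x : Plane) : Plane →L[ℝ] Plane :=
  |(fderiv ℝ T x).det| •
    (fderiv ℝ S (T x)).comp (ContinuousLinearMap.adjoint (fderiv ℝ S (T x)))

/-- The chain rule solved for the gradient on the image: DT·DS = 1, hence (DS)*(DT)* = 1. -/
lemma MemV.weakGrad_comp (h : IsLipDiffeo T S K) {Ω : Set Plane}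
    (hΩ : IsOpen Ω) (hb : Bornology.IsBounded Ω) {v : Plane → ℝ} (hv : MemV Γf (T '' Ω) v) :
    ∀ᵐ x ∂volume.restrict Ω, weakGrad (T '' Ω) v (T x) =
      ContinuousLinearMap.adjoint (fderiv ℝ S (T x)) (weakGrad Ω (fun x => v (T x)) x) := by
  obtain ⟨φ, a, -⟩ := hv.2.exists_approx
  filter_upwards [(a.comp h).weakGrad_ae_eq hΩ hb] with x hx
  rw [hx, ← ContinuousLinearMap.comp_apply, ← ContinuousLinearMap.adjoint_comp,
    h.fderiv_inv_comp_fderiv, ContinuousLinearMap.adjoint_id]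
  rfl

lemma dirichletForm_image (h : IsLipDiffeo T S K) {Ω : Set Plane}
    (hΩ : IsOpen Ω) (hb : Bornology.IsBounded Ω) {v w : Plane → ℝ} (hv : MemV Γf (T '' Ω) v)
    (hw : MemV Γf (T '' Ω) w) :
    dirichletForm (T '' Ω) v w = ∫ x in Ω, inner ℝ
      (pullbackField T S x (weakGrad Ω (fun x => v (T x)) x))
      (weakGrad Ω (fun x => w (T x)) x) := by
  rw [dirichletForm, integral_image_eq_integral_abs_det_fderiv_smul volume hΩ.measurableSet
    (fun x _ => (h.contDiff.differentiable (by norm_num) x).hasFDerivAt.hasFDerivWithinAt)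
    h.injective.injOn]
  refine integral_congr_ae ?_
  filter_upwards [hv.weakGrad_comp h hΩ hb, hw.weakGrad_comp h hΩ hb] with x h1 h2
  rw [h1, h2, pullbackField, smul_apply, real_inner_smul_left,
    ContinuousLinearMap.comp_apply, ContinuousLinearMap.adjoint_inner_right, smul_eq_mul]

lemma setIntegral_image (h : IsLipDiffeo T S K) {Ω : Set Plane} (hΩ : IsOpen Ω)
    (g : Plane → ℝ) :
    ∫ x in T '' Ω, g x = ∫ x in Ω, |(fderiv ℝ T x).det| * g (T x) :=
  integral_image_eq_integral_abs_det_fderiv_smul volume hΩ.measurableSet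
    (fun x _ => (h.contDiff.differentiable (by norm_num) x).hasFDerivAt.hasFDerivWithinAt)
    h.injective.injOn g

end Fixed

/-! ### Perturbations of the identity -/

/-- The perturbation tθ is a 1/2-contraction. So `T` is a homeomorphism whose inverse has Lipschitz
constant 1/(1 - 1/2) = 2, and a Neumann series inverts its derivative, which makes the inverse C¹.
The constant 2 also exceeds the bound 3/2 for `T`. -/
lemma exists_isLipDiffeo {θ : Plane → Plane} (hθ : ContDiff ℝ 1 θ) {M : NNReal}
    (hM : LipschitzWith M θ) {t : ℝ} (ht : |t| * M ≤ 1 / 2) :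
    ∃ S, IsLipDiffeo (fun x => x + t • θ x) S 2 := by
  set T : Plane → Plane := fun x => x + t • θ x with hT
  have hT1 : ContDiff ℝ 1 T := contDiff_id.add (hθ.const_smul t)
  have hlip : ∀ x y, ‖t • θ x - t • θ y‖ ≤ 1 / 2 * ‖x - y‖ := by
    intro x y
    rw [← smul_sub, norm_smul, Real.norm_eq_abs]
    have h := hM.dist_le_mul x y
    rw [dist_eq_norm, dist_eq_norm] at h
    calc |t| * ‖θ x - θ y‖ ≤ |t| * (M * ‖x - y‖) := by gcongr
      _ = (|t| * M) * ‖x - y‖ := by ring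
      _ ≤ _ := by gcongr
  have happrox : ApproximatesLinearOn T
      ((ContinuousLinearEquiv.refl ℝ Plane : Plane ≃L[ℝ] Plane) : Plane →L[ℝ] Plane)
      univ (1 / 2 : NNReal) := by
    rw [ApproximatesLinearOn.approximatesLinearOn_iff_lipschitzOnWith, lipschitzOnWith_univ]
    refine LipschitzWith.of_dist_le_mul fun x y => ?_
    rw [dist_eq_norm, dist_eq_norm]
    simpa [hT] using hlip x y
  have hc : Subsingleton Plane ∨ (1 / 2 : NNReal) <
      ‖((ContinuousLinearEquiv.refl ℝ Plane).symm : Plane →L[ℝ] Plane)‖₊⁻¹ := by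
    right
    have h1 : ‖((ContinuousLinearEquiv.refl ℝ Plane).symm : Plane →L[ℝ] Plane)‖₊ = 1 :=
      ContinuousLinearMap.nnnorm_id
    rw [h1]
    norm_num
  set e : Plane ≃ₜ Plane := happrox.toHomeomorph T hc with he
  have heT : ⇑e = T := rfl
  have hfd : ∀ x, ∃ L : Plane ≃L[ℝ] Plane, HasFDerivAt T (L : Plane →L[ℝ] Plane) x := by
    intro x
    have hn : ‖-(t • fderiv ℝ θ x)‖ < 1 := by
      rw [norm_neg, norm_smul, Real.norm_eq_abs]
      have := norm_fderiv_le_of_lipschitz ℝ hM (x₀ := x)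
      have := mul_le_mul_of_nonneg_left this (abs_nonneg t)
      linarith
    refine ⟨ContinuousLinearEquiv.ofUnit (Units.oneSub _ hn), ?_⟩
    have h : HasFDerivAt T (ContinuousLinearMap.id ℝ Plane + t • fderiv ℝ θ x) x :=
      (hasFDerivAt_id x).add ((hθ.differentiable (by norm_num) x).hasFDerivAt.const_smul t)
    have h2 : ((ContinuousLinearEquiv.ofUnit (Units.oneSub (-(t • fderiv ℝ θ x)) hn) :
        Plane ≃L[ℝ] Plane) : Plane →L[ℝ] Plane) =
        ContinuousLinearMap.id ℝ Plane + t • fderiv ℝ θ x := by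
      refine ContinuousLinearMap.ext fun v => ?_
      change ((Units.oneSub (-(t • fderiv ℝ θ x)) hn : (Plane →L[ℝ] Plane)ˣ) :
        Plane →L[ℝ] Plane) v = _
      rw [Units.val_oneSub, sub_neg_eq_add]
      rfl
    rw [h2]
    exact h
  choose L hL using hfd
  refine ⟨e.symm, hT1, e.contDiff_symm (f₀' := L) hL hT1, fun x => e.symm_apply_apply x,
    fun x => e.apply_symm_apply x, ?_, ?_⟩
  · refine LipschitzWith.of_dist_le_mul fun x y => ?_
    rw [dist_eq_norm, dist_eq_norm,
      show T x - T y = (x - y) + (t • θ x - t • θ y) by simp only [hT]; abel]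
    refine (norm_add_le _ _).trans ?_
    have := hlip x y
    push_cast
    linarith [norm_nonneg (x - y)]
  · refine LipschitzWith.of_dist_le_mul fun x y => ?_
    have h1 := hlip (e.symm x) (e.symm y)
    have h2 : e.symm x - e.symm y =
        (x - y) - (t • θ (e.symm x) - t • θ (e.symm y)) := by
      have a : e.symm x + t • θ (e.symm x) = x := e.apply_symm_apply x
      have b : e.symm y + t • θ (e.symm y) = y := e.apply_symm_apply y
      rw [show x - y = (e.symm x + t • θ (e.symm x)) - (e.symm y + t • θ (e.symm y)) by rw [a, b]]
      abel
    have h3 : ‖e.symm x - e.symm y‖ ≤ ‖x - y‖ + ‖t • θ (e.symm x) - t • θ (e.symm y)‖ := by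
      conv_lhs => rw [h2]
      exact norm_sub_le _ _
    rw [dist_eq_norm, dist_eq_norm]
    push_cast
    linarith

/-! ### Continuity in the mean under perturbations of the identity -/

/-- For a continuous compactly supported `g` in place of `G` this is uniform continuity; the error G
- g survives composition at the cost of a factor 2, the square root of the measure bound 4. The
estimate is uniform in `Φ`, so that it covers flow and mollification at once. -/
lemma exists_eLpNorm_comp_sub_le {G : Plane → Plane} (hG : MemLp G 2 volume) {ε : ENNReal}
    (hε : ε ≠ 0) : ∃ η > 0, ∀ Φ : Plane → Plane, Measurable Φ → (∀ x, ‖Φ x - x‖ ≤ η) →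
      (volume : Measure Plane).map Φ ≤ (2 ^ (2 : ℝ) : ENNReal) • volume →
      eLpNorm (fun x => G (Φ x) - G x) 2 volume ≤ ε := by
  have hε4 : ε / 4 ≠ 0 := (ENNReal.div_pos hε (by norm_num)).ne'
  obtain ⟨g, hgc, hGg, hgcont, hgL⟩ :=
    hG.exists_hasCompactSupport_eLpNorm_sub_le (by norm_num) hε4
  -- Since `Φ` moves points by at most 1, the difference g∘Φ - g vanishes outside this compact set.
  set A : Set Plane := Metric.cthickening 1 (tsupport g) with hA
  have hAc : IsCompact A := hgc.isCompact.cthickening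
  have hAm : volume A ≠ ⊤ := hAc.measure_ne_top
  obtain ⟨κ, hκ, hκε⟩ : ∃ κ : ℝ, 0 < κ ∧ ENNReal.ofReal κ * volume A ^ (1 / 2 : ℝ) ≤ ε / 4 := by
    have ht : Tendsto (fun κ : ℝ => ENNReal.ofReal κ * volume A ^ (1 / 2 : ℝ)) (𝓝[>] 0) (𝓝 0) := by
      have h1 : Tendsto (fun κ : ℝ => ENNReal.ofReal κ) (𝓝[>] 0) (𝓝 0) := by
        simpa using (ENNReal.continuous_ofReal.tendsto 0).mono_left nhdsWithin_le_nhds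
      simpa using ENNReal.Tendsto.mul_const h1
        (Or.inr (ENNReal.rpow_lt_top_of_nonneg (by norm_num) hAm).ne)
    obtain ⟨κ, h1, h2⟩ :=
      ((ht.eventually_le_const hε4.bot_lt).and self_mem_nhdsWithin).exists
    exact ⟨κ, h2, h1⟩
  obtain ⟨η, hη, hgη⟩ := Metric.uniformContinuous_iff.1
    (hgcont.uniformContinuous_of_tendsto_cocompact hgc.is_zero_at_infty) κ hκ
  refine ⟨min (η / 2) 1, by positivity, fun Φ hΦ hΦη hmap => ?_⟩
  have hd : ∀ x, dist (Φ x) x < η ∧ dist (Φ x) x ≤ 1 := fun x => by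
    rw [dist_eq_norm]
    have := hΦη x
    exact ⟨by linarith [this.trans (min_le_left _ _)], this.trans (min_le_right _ _)⟩
  have h1 : eLpNorm (fun x => (G - g) (Φ x)) 2 volume ≤ 2 * (ε / 4) := by
    refine (eLpNorm_comp_le_of_map_le hΦ hmap (hG.1.sub hgL.1)).trans ?_
    rw [← ENNReal.rpow_mul]
    norm_num
    gcongr
  have h2 : eLpNorm (fun x => g (Φ x) - g x) 2 volume ≤ ε / 4 := by
    refine (eLpNorm_mono_real (g := A.indicator fun _ => κ) fun x => ?_).trans ?_
    · by_cases hx : x ∈ A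
      · rw [indicator_of_mem hx, ← dist_eq_norm]
        exact (hgη (hd x).1).le
      · have hx1 : x ∉ tsupport g := fun h => hx (Metric.self_subset_cthickening _ h)
        have hx2 : Φ x ∉ tsupport g := fun h => hx
          (Metric.mem_cthickening_of_dist_le x (Φ x) 1 _ h (by rw [dist_comm]; exact (hd x).2))
        rw [image_eq_zero_of_notMem_tsupport hx1, image_eq_zero_of_notMem_tsupport hx2,
          indicator_of_notMem hx]
        simp
    · rw [eLpNorm_indicator_const hAc.isClosed.measurableSet (by norm_num) (by norm_num)]
      rw [Real.enorm_of_nonneg hκ.le]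
      simpa using hκε
  have h3 : (fun x => G (Φ x) - G x) =
      (fun x => (G - g) (Φ x)) + ((fun x => g (Φ x) - g x) - (G - g)) := by
    ext1 x
    simp only [Pi.add_apply, Pi.sub_apply]
    abel
  have m1 : AEStronglyMeasurable (fun x => (G - g) (Φ x)) volume :=
    aestronglyMeasurable_comp_of_map_le hΦ hmap (hG.1.sub hgL.1)
  have m2 : AEStronglyMeasurable (fun x => g (Φ x) - g x) volume :=
    (hgcont.measurable.comp hΦ).aestronglyMeasurable.sub hgcont.aestronglyMeasurable
  rw [h3]
  calc _ ≤ 2 * (ε / 4) + (ε / 4 + ε / 4) :=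
        (eLpNorm_add_le m1 (m2.sub (hG.1.sub hgL.1)) (by norm_num)).trans
          (add_le_add h1 ((eLpNorm_sub_le m2 (hG.1.sub hgL.1) (by norm_num)).trans
            (add_le_add h2 hGg)))
    _ = 4 * (ε / 4) := by ring
    _ = ε := ENNReal.mul_div_cancel (by norm_num) (by norm_num)

/-! ### Differences of a Sobolev function along a flow -/

/-- The mean of `G` around `y` with the weight `ρ`. -/
noncomputable def weightedMean {E : Type*} [NormedAddCommGroup E] [NormedSpace ℝ E]
    (ρ : ContDiffBump (0 : Plane)) (G : Plane → E) (y : Plane) : E :=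
  convolution (ρ.normed volume) G (ContinuousLinearMap.lsmul ℝ ℝ) volume y

section WeightedMean

variable {E : Type*} [NormedAddCommGroup E] [NormedSpace ℝ E] (ρ : ContDiffBump (0 : Plane))

lemma weightedMean_eq (G : Plane → E) (y : Plane) :
    weightedMean ρ G y = ∫ z, ρ.normed volume z • G (y - z) := convolution_lsmul

lemma continuous_weightedMean {G : Plane → E} (hG : LocallyIntegrable G) :
    Continuous (weightedMean ρ G) :=
  ρ.hasCompactSupport_normed.continuous_convolution_left _ ρ.continuous_normed hG

/-- The probability measure with density `ρ`. -/
noncomputable def bumpMeasure : Measure Plane :=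
  volume.withDensity fun z => ENNReal.ofReal (ρ.normed volume z)

lemma measurable_bumpDensity : Measurable fun z => ENNReal.ofReal (ρ.normed volume z) :=
  ρ.continuous_normed.measurable.ennreal_ofReal

lemma bumpMeasure_univ : bumpMeasure ρ univ = 1 := by
  rw [bumpMeasure, withDensity_apply _ MeasurableSet.univ, Measure.restrict_univ,
    ← ofReal_integral_eq_lintegral_ofReal ρ.integrable_normed
      (Eventually.of_forall ρ.nonneg_normed), ρ.integral_normed, ENNReal.ofReal_one]

lemma isProbabilityMeasure_bumpMeasure : IsProbabilityMeasure (bumpMeasure ρ) :=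
  ⟨bumpMeasure_univ ρ⟩

lemma integral_bumpMeasure (g : Plane → E) :
    ∫ z, g z ∂bumpMeasure ρ = ∫ z, ρ.normed volume z • g z := by
  rw [bumpMeasure, integral_withDensity_eq_integral_toReal_smul (measurable_bumpDensity ρ)
    (Eventually.of_forall fun _ => ENNReal.ofReal_lt_top)]
  simp only [ENNReal.toReal_ofReal (ρ.nonneg_normed _)]

lemma ae_bumpMeasure : ∀ᵐ z ∂bumpMeasure ρ, ‖z‖ < ρ.rOut := by
  rw [bumpMeasure, ae_withDensity_iff (measurable_bumpDensity ρ)]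
  refine Eventually.of_forall fun z hz => ?_
  by_contra h
  have : z ∉ Function.support (ρ.normed volume) := by
    rw [ρ.support_normed_eq, mem_ball_zero_iff]
    exact h
  exact hz (by rw [Function.notMem_support.1 this, ENNReal.ofReal_zero])

/-- Jensen's inequality for the square, obtained from Cauchy–Schwarz for a probability measure. -/
lemma enorm_weightedMean_sub_sq_le {G : Plane → Plane} (hG : Measurable G)
    (hGl : LocallyIntegrable G) (y a : Plane) :
    ‖weightedMean ρ G y - a‖ₑ ^ 2 ≤ ∫⁻ z, ‖G (y - z) - a‖ₑ ^ 2 ∂bumpMeasure ρ := by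
  have hi : Integrable (fun z => ρ.normed volume z • G (y - z)) volume :=
    ρ.hasCompactSupport_normed.convolutionExists_left (ContinuousLinearMap.lsmul ℝ ℝ)
      ρ.continuous_normed hGl y
  have h1 : weightedMean ρ G y - a = ∫ z, (G (y - z) - a) ∂bumpMeasure ρ := by
    rw [integral_bumpMeasure]
    simp only [smul_sub]
    rw [integral_sub hi (ρ.integrable_normed.smul_const a), integral_smul_const,
      ρ.integral_normed, one_smul, weightedMean_eq]
  rw [h1]
  have hm : Measurable fun z => G (y - z) - a :=
    (hG.comp (measurable_const.sub measurable_id)).sub_const a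
  refine (enorm_integral_sq_le hm.aestronglyMeasurable).trans_eq ?_
  rw [bumpMeasure_univ, one_mul]

/-- The reflected and translated weight z ↦ ρ(y - z) is a test function supported in `U`, so
differentiating the mollification means applying the definition of the weak gradient. The zero
extension of `f` only makes the convolution globally defined. -/
lemma hasFDerivAt_weightedMean {U : Set Plane} (hU : IsOpen U) {f : Plane → ℝ}
    {G : Plane → Plane} (hf : MemLp f 2 (volume.restrict U)) (hfG : IsWeakGradient U f G)
    {y : Plane} (hy : Metric.closedBall y ρ.rOut ⊆ U) :
    HasFDerivAt (weightedMean ρ (U.indicator f)) (innerSL ℝ (weightedMean ρ G y)) y := by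
  have hfl : LocallyIntegrable (U.indicator f) :=
    ((memLp_indicator_iff_restrict hU.measurableSet).2 hf).locallyIntegrable (by norm_num)
  set R : Plane → ℝ := ρ.normed volume with hR
  have hR1 : ContDiff ℝ (⊤ : ℕ∞) R := ρ.contDiff_normed
  have hRc : HasCompactSupport R := ρ.hasCompactSupport_normed
  have h1 : HasFDerivAt (weightedMean ρ (U.indicator f)) (convolution (fderiv ℝ R)
      (U.indicator f) (ContinuousLinearMap.precompL Plane
        (ContinuousLinearMap.lsmul ℝ ℝ : ℝ →L[ℝ] ℝ →L[ℝ] ℝ)) volume y) y :=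
    hRc.hasFDerivAt_convolution_left _ (hR1.of_le (by exact_mod_cast le_top)) hfl y
  refine h1.congr_fderiv (ContinuousLinearMap.ext fun w => ?_)
  symm
  have hex : Integrable (fun z => (ContinuousLinearMap.precompL Plane
      (ContinuousLinearMap.lsmul ℝ ℝ : ℝ →L[ℝ] ℝ →L[ℝ] ℝ)) (fderiv ℝ R z)
      (U.indicator f (y - z))) volume :=
    (hRc.fderiv ℝ).convolutionExists_left _ (hR1.continuous_fderiv (by simp)) hfl y
  rw [convolution_def, ContinuousLinearMap.integral_apply hex]
  simp only [ContinuousLinearMap.precompL_apply, ContinuousLinearMap.lsmul_apply]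
  set ψ : Plane → ℝ := fun z => R (y - z) with hψ
  have hψ1 : ContDiff ℝ (⊤ : ℕ∞) ψ := hR1.comp (contDiff_const.sub contDiff_id)
  have hψc : HasCompactSupport ψ := hRc.comp_homeomorph (Homeomorph.subLeft y)
  have hψs : tsupport ψ ⊆ U := by
    have h2 : tsupport ψ ⊆ Metric.closedBall y ρ.rOut := by
      refine closure_minimal (fun z hz => ?_) Metric.isClosed_closedBall
      have : y - z ∈ Function.support R := hz
      rw [hR, ρ.support_normed_eq, mem_ball_zero_iff] at this
      rw [Metric.mem_closedBall, dist_comm, dist_eq_norm]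
      exact this.le
    exact h2.trans hy
  have hgψ : ∀ z, inner ℝ (gradient ψ z) w = -fderiv ℝ R (y - z) w := by
    intro z
    have hd : HasFDerivAt ψ ((fderiv ℝ R (y - z)).comp (-ContinuousLinearMap.id ℝ Plane)) z :=
      ((hR1.differentiable (by simp)) (y - z)).hasFDerivAt.comp z ((hasFDerivAt_id z).const_sub y)
    rw [inner_gradient, hd.fderiv]
    simp
  have hgc : HasCompactSupport (gradient ψ) :=
    (hψc.fderiv ℝ).comp_left (g := (InnerProductSpace.toDual ℝ Plane).symm) (map_zero _)
  have hgL : MemLp (gradient ψ) 2 (volume.restrict U) := memLp_restrict_of_hasCompactSupport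
    (continuous_gradient (hψ1.of_le (by exact_mod_cast le_top))) hgc U
  have hi : Integrable (fun z => f z • gradient ψ z) (volume.restrict U) :=
    integrable_of_norm_le_mul hf hgL (hf.1.smul hgL.1) (C := 1)
      (Eventually.of_forall fun x => by simp [norm_smul])
  have h2 : weightedMean ρ G y = ∫ z in U, ψ z • G z := by
    rw [setIntegral_smul_eq hψs, weightedMean_eq,
      ← integral_sub_left_eq_self (fun z => ψ z • G z) volume y]
    simp [hψ, hR]
  rw [innerSL_apply_apply, h2, hfG ψ hψ1 hψc hψs, inner_neg_left, real_inner_comm,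
    ← integral_inner hi, ← integral_neg,
    ← integral_sub_left_eq_self (fun z => (fderiv ℝ R z w) • U.indicator f (y - z)) volume y,
    ← integral_indicator hU.measurableSet]
  refine integral_congr_ae (Eventually.of_forall fun z => ?_)
  by_cases hz : z ∈ U
  · simp only [indicator_of_mem hz, sub_sub_cancel, smul_eq_mul]
    rw [real_inner_comm, real_inner_smul_left, hgψ]
    ring
  · simp [indicator_of_notMem hz]

/-- The mollified function is differentiated along the segment and its gradient compared with `G x`;
Cauchy–Schwarz in `s` and Jensen in `z` give the bound by the oscillation of `G`. -/
lemma enorm_weightedMean_difference_sq_le {U : Set Plane} (hU : IsOpen U) {f : Plane → ℝ}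
    {G : Plane → Plane} (hf : MemLp f 2 (volume.restrict U)) (hfG : IsWeakGradient U f G)
    (hG : Measurable G) (hGl : LocallyIntegrable G) {x v : Plane}
    (hx : ∀ s ∈ Icc (0 : ℝ) 1, Metric.closedBall (x + s • v) ρ.rOut ⊆ U) :
    ‖weightedMean ρ (U.indicator f) (x + v) - weightedMean ρ (U.indicator f) x
      - inner ℝ (G x) v‖ₑ ^ 2 ≤ ‖v‖ₑ ^ 2 *
        ∫⁻ s in Ioc (0 : ℝ) 1, ∫⁻ z, ‖G (x + s • v - z) - G x‖ₑ ^ 2 ∂bumpMeasure ρ := by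
  have hg := continuous_weightedMean ρ hGl
  have hc : Continuous fun s : ℝ => inner ℝ (weightedMean ρ G (x + s • v)) v := by fun_prop
  have hd : ∀ s ∈ uIcc (0 : ℝ) 1, HasDerivAt
      (fun s : ℝ => weightedMean ρ (U.indicator f) (x + s • v))
      (inner ℝ (weightedMean ρ G (x + s • v)) v) s := by
    intro s hs
    rw [uIcc_of_le zero_le_one] at hs
    have h : HasDerivAt (fun s : ℝ => x + s • v) v s := by
      simpa using ((hasDerivAt_id s).smul_const v).const_add x
    exact (hasFDerivAt_weightedMean ρ hU hf hfG (hx s hs)).comp_hasDerivAt s h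
  have h1 := intervalIntegral.integral_eq_sub_of_hasDerivAt hd (hc.intervalIntegrable _ _)
  rw [intervalIntegral.integral_of_le zero_le_one] at h1
  simp only [one_smul, zero_smul, add_zero] at h1
  have h2 : weightedMean ρ (U.indicator f) (x + v) - weightedMean ρ (U.indicator f) x
      - inner ℝ (G x) v =
      ∫ s in Ioc (0 : ℝ) 1, inner ℝ (weightedMean ρ G (x + s • v) - G x) v := by
    simp only [inner_sub_left]
    rw [integral_sub (hc.integrableOn_Ioc) (integrable_const _), h1]
    simp
  rw [h2]
  have hc2 : Continuous fun s : ℝ => inner ℝ (weightedMean ρ G (x + s • v) - G x) v := by fun_prop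
  refine (enorm_integral_sq_le hc2.aestronglyMeasurable).trans ?_
  simp only [MeasurableSet.univ, Measure.restrict_apply, univ_inter, Real.volume_Ioc, sub_zero,
    ENNReal.ofReal_one, one_mul]
  rw [← lintegral_const_mul' _ _ (by finiteness)]
  refine lintegral_mono fun s => ?_
  calc ‖inner ℝ (weightedMean ρ G (x + s • v) - G x) v‖ₑ ^ 2
      ≤ (‖v‖ₑ * ‖weightedMean ρ G (x + s • v) - G x‖ₑ) ^ 2 := by
        gcongr
        rw [← ofReal_norm, ← ofReal_norm, ← ofReal_norm, ← ENNReal.ofReal_mul (norm_nonneg _)]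
        refine ENNReal.ofReal_le_ofReal ?_
        rw [mul_comm]
        exact norm_inner_le_norm _ _
    _ ≤ _ := by
        rw [mul_pow]
        gcongr
        exact enorm_weightedMean_sub_sq_le ρ hG hGl _ _

end WeightedMean

lemma map_sub_const_le {T S : Plane → Plane} (h : IsLipDiffeo T S 2) (z : Plane) :
    (volume : Measure Plane).map (fun x => T x - z) ≤ (2 ^ (2 : ℝ) : ENNReal) • volume := by
  have hS : LipschitzWith 2 fun y => S (y + z) := by
    have := h.lipschitz_inv.comp (LipschitzWith.of_dist_le_mul (K := 1)
      (f := fun y : Plane => y + z) fun x y => by simp)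
    rwa [mul_one] at this
  have h2 := map_restrict_volume_le (T := fun x => T x - z) (h.measurable.sub_const z)
    (fun x => by simp [h.left_inv]) hS univ
  rw [Measure.restrict_univ] at h2
  refine h2.trans ?_
  gcongr
  · exact le_rfl
  · exact Measure.restrict_le_self

/-- Bump functions with shrinking supports. -/
lemma exists_contDiffBump_seq {r : ℝ} (hr : 0 < r) : ∃ ρ : ℕ → ContDiffBump (0 : Plane),
    (∀ n, (ρ n).rOut ≤ r) ∧ (∀ n, (ρ n).rOut ≤ 2 * (ρ n).rIn) ∧
      Tendsto (fun n => (ρ n).rOut) atTop (𝓝 0) := by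
  refine ⟨fun n => { rIn := r / (n + 1) / 2
                     rOut := r / (n + 1)
                     rIn_pos := by positivity
                     rIn_lt_rOut := half_lt_self (by positivity) }, fun n => ?_, fun n => ?_, ?_⟩
  · refine div_le_self hr.le ?_
    linarith [(Nat.cast_nonneg n : (0 : ℝ) ≤ n)]
  · change r / (n + 1) ≤ 2 * (r / (n + 1) / 2)
    linarith
  · have h := (tendsto_one_div_add_atTop_nhds_zero_nat (𝕜 := ℝ)).const_mul r
    simpa only [mul_one_div, mul_zero] using h

lemma measurable_flow_oscillation (ρ : ContDiffBump (0 : Plane)) {G θ : Plane → Plane}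
    (hG : Measurable G) (hθ : Continuous θ) (t : ℝ) :
    Measurable fun q : Plane × ℝ =>
      ∫⁻ z, ‖G (q.1 + q.2 • t • θ q.1 - z) - G q.1‖ₑ ^ 2 ∂bumpMeasure ρ := by
  have := isProbabilityMeasure_bumpMeasure ρ
  have hjoint : Measurable fun q : (Plane × ℝ) × Plane =>
      ‖G (q.1.1 + q.1.2 • t • θ q.1.1 - q.2) - G q.1.1‖ₑ ^ 2 := by
    have c1 : Continuous fun q : (Plane × ℝ) × Plane => q.1.1 + q.1.2 • t • θ q.1.1 - q.2 := by
      fun_prop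
    exact ((hG.comp c1.measurable).sub
      (hG.comp (measurable_fst.comp measurable_fst))).enorm.pow_const 2
  exact hjoint.lintegral_prod_right'

/-- By Tonelli `x` is integrated first. For fixed `s` and `z` the map x ↦ x + stθ(x) - z is a small
perturbation of the identity to which `hηε` applies, and `s` and `z` range over probability
measures. -/
lemma lintegral_flow_oscillation_le (ρ : ContDiffBump (0 : Plane)) {G θ : Plane → Plane}
    (hG : Measurable G) (hθ : ContDiff ℝ 1 θ) {M : NNReal}
    (hM : LipschitzWith M θ) {B : NNReal} (hB : ∀ x, ‖θ x‖₊ ≤ B) {t η : ℝ}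
    (ht : |t| * M ≤ 1 / 2) {ε : ENNReal}
    (hηε : ∀ Φ : Plane → Plane, Measurable Φ → (∀ x, ‖Φ x - x‖ ≤ η) →
      (volume : Measure Plane).map Φ ≤ (2 ^ (2 : ℝ) : ENNReal) • volume →
      eLpNorm (fun x => G (Φ x) - G x) 2 volume ≤ ε) (hρ : |t| * B + ρ.rOut ≤ η) :
    ∫⁻ x, ∫⁻ s in Ioc (0 : ℝ) 1, ∫⁻ z, ‖G (x + s • t • θ x - z) - G x‖ₑ ^ 2 ∂bumpMeasure ρ
      ≤ ε ^ 2 := by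
  have := isProbabilityMeasure_bumpMeasure ρ
  have key : ∀ s ∈ Ioc (0 : ℝ) 1, ∀ z : Plane, ‖z‖ < ρ.rOut →
      ∫⁻ x, ‖G (x + s • t • θ x - z) - G x‖ₑ ^ 2 ≤ ε ^ 2 := by
    intro s hs z hz
    have hst : |s * t| ≤ |t| := by
      rw [abs_mul, abs_of_pos hs.1]
      exact mul_le_of_le_one_left (abs_nonneg t) hs.2
    obtain ⟨S, hS⟩ := exists_isLipDiffeo hθ hM (t := s * t)
      ((mul_le_mul_of_nonneg_right hst M.2).trans ht)
    have hb := hηε (fun x => x + (s * t) • θ x - z) (hS.measurable.sub_const z)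
      (fun x => ?_) (map_sub_const_le hS z)
    · rw [← eLpNorm_two_sq (fun x => G (x + s • t • θ x - z) - G x)]
      simp only [smul_smul]
      exact pow_le_pow_left' hb 2
    · have hBx : ‖θ x‖ ≤ B := by exact_mod_cast hB x
      have h1 : ‖(s * t) • θ x‖ ≤ |t| * B := by
        rw [norm_smul, Real.norm_eq_abs]
        gcongr
      rw [show x + (s * t) • θ x - z - x = (s * t) • θ x - z by abel]
      refine (norm_sub_le _ _).trans ?_
      linarith
  rw [lintegral_lintegral_swap (measurable_flow_oscillation ρ hG hθ.continuous t).aemeasurable]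
  calc _ ≤ ∫⁻ s in Ioc (0 : ℝ) 1, ε ^ 2 := by
        refine setLIntegral_mono' measurableSet_Ioc fun s hs => ?_
        have hm : Measurable fun q : Plane × Plane =>
            ‖G (q.1 + s • t • θ q.1 - q.2) - G q.1‖ₑ ^ 2 := by
          have hθc := hθ.continuous
          have c1 : Continuous fun q : Plane × Plane => q.1 + s • t • θ q.1 - q.2 := by fun_prop
          exact ((hG.comp c1.measurable).sub (hG.comp measurable_fst)).enorm.pow_const 2
        rw [lintegral_lintegral_swap hm.aemeasurable]
        calc _ ≤ ∫⁻ z, ε ^ 2 ∂bumpMeasure ρ := by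
              refine lintegral_mono_ae ?_
              filter_upwards [ae_bumpMeasure ρ] with z hz using key s hs z hz
          _ = _ := by simp
    _ = _ := by simp

/-- The segment is compact in `U`, so a neighbourhood of it lies in `U` and the estimate for
mollified functions holds once the radius is small. How small depends on `x`; hence the pointwise
lower limit, suited to Fatou's lemma. -/
lemma enorm_difference_sq_le_liminf {U : Set Plane} (hU : IsOpen U) {f : Plane → ℝ}
    {G : Plane → Plane} (hf : MemLp f 2 (volume.restrict U)) (hfG : IsWeakGradient U f G)
    (hG : Measurable G) (hGl : LocallyIntegrable G) {ρ : ℕ → ContDiffBump (0 : Plane)}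
    (hρ : Tendsto (fun n => (ρ n).rOut) atTop (𝓝 0)) {x v : Plane} {a b : ℝ}
    (hx : ∀ s ∈ Icc (0 : ℝ) 1, x + s • v ∈ U)
    (ha : Tendsto (fun n => weightedMean (ρ n) (U.indicator f) x) atTop (𝓝 a))
    (hb : Tendsto (fun n => weightedMean (ρ n) (U.indicator f) (x + v)) atTop (𝓝 b)) :
    ‖b - a - inner ℝ (G x) v‖ₑ ^ 2 ≤ ‖v‖ₑ ^ 2 * liminf (fun n =>
      ∫⁻ s in Ioc (0 : ℝ) 1, ∫⁻ z, ‖G (x + s • v - z) - G x‖ₑ ^ 2 ∂bumpMeasure (ρ n)) atTop := by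
  have hcomp : IsCompact ((fun s : ℝ => x + s • v) '' Icc 0 1) :=
    isCompact_Icc.image (by fun_prop)
  obtain ⟨r, hr, hrU⟩ := hcomp.exists_cthickening_subset_open hU (image_subset_iff.2 hx)
  have hlim : Tendsto (fun n => ‖weightedMean (ρ n) (U.indicator f) (x + v) -
      weightedMean (ρ n) (U.indicator f) x - inner ℝ (G x) v‖ₑ ^ 2) atTop
      (𝓝 (‖b - a - inner ℝ (G x) v‖ₑ ^ 2)) :=
    ((ENNReal.continuous_pow 2).comp continuous_enorm).continuousAt.tendsto.comp
      ((hb.sub ha).sub_const _)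
  rw [← ENNReal.liminf_const_mul_of_ne_top (by finiteness), ← hlim.liminf_eq]
  refine liminf_le_liminf ?_
  filter_upwards [hρ.eventually_le_const hr] with n hn
  refine enorm_weightedMean_difference_sq_le (ρ n) hU hf hfG hG hGl fun s hs => ?_
  have hmem : x + s • v ∈ (fun s : ℝ => x + s • v) '' Icc 0 1 := ⟨s, hs, rfl⟩
  intro y hy
  exact hrU (Metric.closedBall_subset_cthickening hmem r
    (Metric.closedBall_subset_closedBall hn hy))

/-- The difference quotients of a Sobolev function along `x ↦ x + t θ x` converge in the mean. -/
lemma exists_eLpNorm_difference_le {U Ω : Set Plane} (hU : IsOpen U) (hΩ : IsOpen Ω)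
    {f : Plane → ℝ} (hf : MemH1 U f) {θ : Plane → Plane} (hθ : ContDiff ℝ 1 θ) {M : NNReal}
    (hM : LipschitzWith M θ) {B : NNReal} (hB : ∀ x, ‖θ x‖₊ ≤ B) {δ : ℝ} (hδ : 0 < δ)
    (hΩU : ∀ t ∈ Ioo (-δ) δ, perturbed Ω θ t ⊆ U) {ε : NNReal} (hε : ε ≠ 0) :
    ∃ τ > 0, ∀ t : ℝ, |t| ≤ τ →
      eLpNorm (fun x => f (x + t • θ x) - f x - t * inner ℝ (weakGrad U f x) (θ x)) 2
        (volume.restrict Ω) ≤ ENNReal.ofReal |t| * (B * ε) := by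
  obtain ⟨hG0L, hG0w⟩ := hf.weakGrad_spec
  have hG0 : MemLp (U.indicator (weakGrad U f)) 2 volume :=
    (memLp_indicator_iff_restrict hU.measurableSet).2 hG0L
  -- A Borel representative is needed, because `G` is evaluated along the flow and integrated
  -- jointly in the point, the time and the mollification variable.
  set G : Plane → Plane := hG0.1.mk _ with hGdef
  have hGm : Measurable G := hG0.1.stronglyMeasurable_mk.measurable
  have hGae : ∀ᵐ x, U.indicator (weakGrad U f) x = G x := hG0.1.ae_eq_mk
  have hG : MemLp G 2 volume := hG0.ae_eq hGae
  have hGl : LocallyIntegrable G := hG.locallyIntegrable (by norm_num)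
  have hGU : ∀ᵐ x ∂volume.restrict U, weakGrad U f x = G x := by
    filter_upwards [ae_restrict_of_ae hGae, ae_restrict_mem hU.measurableSet] with x hx hxU
    rw [← hx, indicator_of_mem hxU]
  have hfG : IsWeakGradient U f G := by
    intro ψ h1 h2 h3
    rw [← hG0w ψ h1 h2 h3]
    refine integral_congr_ae ?_
    filter_upwards [hGU] with x hx
    rw [hx]
  have hF : LocallyIntegrable (U.indicator f) :=
    ((memLp_indicator_iff_restrict hU.measurableSet).2 hf.1).locallyIntegrable (by norm_num)
  obtain ⟨η, hη, hηε⟩ := exists_eLpNorm_comp_sub_le hG (ENNReal.coe_ne_zero.2 hε)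
  have hΩU0 : Ω ⊆ U := by
    have := hΩU 0 ⟨by linarith, hδ⟩
    simpa [perturbed] using this
  -- The three thresholds keep the segments in `U`, make the flow maps diffeomorphisms, and bound
  -- the displacement by η/2. The remaining η/2 is spent on the mollification radius.
  refine ⟨min (δ / 2) (min (1 / (2 * (M + 1))) (η / (2 * (B + 1)))), by positivity,
    fun t ht => ?_⟩
  have ht1 : |t| ≤ δ / 2 := ht.trans (min_le_left _ _)
  have ht2 : |t| * M ≤ 1 / 2 := by
    have h := (ht.trans (min_le_right _ _)).trans (min_le_left _ _)
    rw [le_div_iff₀ (by positivity)] at h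
    nlinarith [abs_nonneg t]
  have ht3 : |t| * B ≤ η / 2 := by
    have h := (ht.trans (min_le_right _ _)).trans (min_le_right _ _)
    rw [le_div_iff₀ (by positivity)] at h
    nlinarith [abs_nonneg t]
  obtain ⟨ρ, hρη, hρK, hρ0⟩ := exists_contDiffBump_seq (half_pos hη)
  have hconv : ∀ᵐ x, Tendsto (fun n => weightedMean (ρ n) (U.indicator f) x) atTop
      (𝓝 (U.indicator f x)) :=
    ContDiffBump.ae_convolution_tendsto_right_of_locallyIntegrable hρ0 (K := 2)
      (Eventually.of_forall hρK) hF
  obtain ⟨S, hS⟩ := exists_isLipDiffeo hθ hM ht2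
  have hconvT : ∀ᵐ x, Tendsto (fun n => weightedMean (ρ n) (U.indicator f) (x + t • θ x)) atTop
      (𝓝 (U.indicator f (x + t • θ x))) := by
    have := map_sub_const_le hS 0
    simp only [sub_zero] at this
    exact ae_comp_of_map_le hS.measurable this hconv
  set H : ℕ → Plane → ENNReal := fun n x =>
    ∫⁻ s in Ioc (0 : ℝ) 1, ∫⁻ z, ‖G (x + s • t • θ x - z) - G x‖ₑ ^ 2 ∂bumpMeasure (ρ n) with hH
  have hHm : ∀ n, Measurable (H n) := fun n =>
    (measurable_flow_oscillation (ρ n) hGm hθ.continuous t).lintegral_prod_right'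
  have hHint : ∀ n, ∫⁻ x, H n x ≤ (ε : ENNReal) ^ 2 := fun n =>
    lintegral_flow_oscillation_le (ρ n) hGm hθ hM hB ht2 hηε (by linarith [hρη n])
  have hpt : ∀ᵐ x ∂volume.restrict Ω,
      ‖f (x + t • θ x) - f x - t * inner ℝ (weakGrad U f x) (θ x)‖ₑ ^ 2 ≤
        (ENNReal.ofReal |t| * B) ^ 2 * liminf (fun n => H n x) atTop := by
    filter_upwards [ae_restrict_of_ae hconv, ae_restrict_of_ae hconvT,
      ae_restrict_mem hΩ.measurableSet, ae_restrict_of_ae_restrict_of_subset hΩU0 hGU]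
      with x h1 h2 hxΩ hGx
    have hseg : ∀ s ∈ Icc (0 : ℝ) 1, x + s • t • θ x ∈ U := by
      intro s hs
      have hst : |s * t| < δ := by
        rw [abs_mul, abs_of_nonneg hs.1]
        nlinarith [abs_nonneg t, hs.2]
      rw [smul_smul]
      exact hΩU (s * t) (abs_lt.1 hst) ⟨x, hxΩ, rfl⟩
    rw [indicator_of_mem (by simpa using hseg 1 (by simp))] at h2
    rw [indicator_of_mem (hΩU0 hxΩ)] at h1
    have h3 := enorm_difference_sq_le_liminf hU hf.1 hfG hGm hGl hρ0 hseg h1 h2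
    rw [real_inner_smul_right] at h3
    rw [hGx]
    refine h3.trans (mul_le_mul_left (pow_le_pow_left' ?_ 2) _)
    rw [enorm_smul, Real.enorm_eq_ofReal_abs]
    gcongr
    exact ENNReal.coe_le_coe.2 (hB x)
  rw [← ENNReal.pow_le_pow_left_iff two_ne_zero, eLpNorm_two_sq]
  calc _ ≤ ∫⁻ x in Ω, (ENNReal.ofReal |t| * B) ^ 2 * liminf (fun n => H n x) atTop :=
        lintegral_mono_ae hpt
    _ = (ENNReal.ofReal |t| * B) ^ 2 * ∫⁻ x in Ω, liminf (fun n => H n x) atTop :=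
        lintegral_const_mul' _ _ (by finiteness)
    _ ≤ (ENNReal.ofReal |t| * B) ^ 2 * (ε : ENNReal) ^ 2 := by
        gcongr
        -- Fatou's lemma turns the uniform bound on the integrals of `H n` into one for their lower
        -- limit.
        refine (setLIntegral_le_lintegral _ _).trans ((lintegral_liminf_le hHm).trans ?_)
        refine (liminf_le_liminf (Eventually.of_forall hHint)).trans_eq ?_
        simp
    _ = _ := by ring

/-! ### Expansion of the transformed coefficients -/

/-- In dimension two the characteristic expansion stops at t², so the remainder is explicit. -/
lemma det_id_add_smul (M : Plane →L[ℝ] Plane) (t : ℝ) :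
    (1 + t • M : Plane →L[ℝ] Plane).det =
      1 + t * LinearMap.trace ℝ Plane (M : Plane →ₗ[ℝ] Plane) + t ^ 2 * M.det := by
  set b := (EuclideanSpace.basisFun (Fin 2) ℝ).toBasis with hb
  have h1 : ((1 + t • M : Plane →L[ℝ] Plane) : Plane →ₗ[ℝ] Plane) =
      LinearMap.id + t • (M : Plane →ₗ[ℝ] Plane) := rfl
  rw [ContinuousLinearMap.det, ContinuousLinearMap.det, h1, ← LinearMap.det_toMatrix b,
    ← LinearMap.det_toMatrix b, LinearMap.trace_eq_matrix_trace ℝ b, map_add, map_smul,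
    LinearMap.toMatrix_id, Matrix.det_fin_two, Matrix.det_fin_two, Matrix.trace_fin_two]
  simp
  ring

lemma exists_bound_trace_det (m : ℝ) : ∃ C : ℝ, 0 ≤ C ∧ ∀ M : Plane →L[ℝ] Plane, ‖M‖ ≤ m →
    |LinearMap.trace ℝ Plane (M : Plane →ₗ[ℝ] Plane)| ≤ C ∧ |M.det| ≤ C := by
  have : ProperSpace (Plane →L[ℝ] Plane) := FiniteDimensional.proper ℝ _
  have hc : IsCompact (Metric.closedBall (0 : Plane →L[ℝ] Plane) m) := isCompact_closedBall _ _
  have c1 : Continuous fun M : Plane →L[ℝ] Plane =>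
      LinearMap.trace ℝ Plane (M : Plane →ₗ[ℝ] Plane) :=
    ((LinearMap.trace ℝ Plane).comp
      (ContinuousLinearMap.coeLM ℝ : (Plane →L[ℝ] Plane) →ₗ[ℝ] _)).continuous_of_finiteDimensional
  obtain ⟨C1, h1⟩ := hc.exists_bound_of_continuousOn c1.continuousOn
  obtain ⟨C2, h2⟩ := hc.exists_bound_of_continuousOn
    (ContinuousLinearMap.continuous_det (𝕜 := ℝ) (E := Plane)).continuousOn
  refine ⟨max 0 (max C1 C2), le_max_left _ _, fun M hM => ?_⟩
  have hM' : M ∈ Metric.closedBall (0 : Plane →L[ℝ] Plane) m := by simpa using hM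
  exact ⟨(h1 M hM').trans ((le_max_left _ _).trans (le_max_right _ _)),
    (h2 M hM').trans ((le_max_right _ _).trans (le_max_right _ _))⟩

/-- Second order expansion of `D D*` for the inverse `D` of `1 + t M`. -/
lemma norm_inv_mul_star_sub_le {E : Type*} [NormedAddCommGroup E] [InnerProductSpace ℝ E]
    [CompleteSpace E] {M D : E →L[ℝ] E} {t m : ℝ} (hM : ‖M‖ ≤ m)
    (ht : |t| * m ≤ 1 / 2) (h1 : (1 + t • M) * D = 1) (h2 : D * (1 + t • M) = 1) :
    ‖D * star D - 1‖ ≤ 6 * m * |t| ∧ ‖D * star D - 1 + t • (M + star M)‖ ≤ 8 * m ^ 2 * t ^ 2 := by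
  have hm : 0 ≤ m := (norm_nonneg M).trans hM
  have e1 : D - 1 = -(t • (M * D)) := by
    rw [add_mul, one_mul, smul_mul_assoc] at h1
    rw [← h1]
    abel
  have e2 : D - 1 = -(t • (D * M)) := by
    rw [mul_add, mul_one, mul_smul_comm] at h2
    rw [← h2]
    abel
  have hone : ‖(1 : E →L[ℝ] E)‖ ≤ 1 := ContinuousLinearMap.norm_id_le
  have hA1 : ‖D - 1‖ ≤ |t| * m * ‖D‖ := by
    rw [e1, norm_neg, norm_smul, Real.norm_eq_abs, mul_assoc]
    gcongr
    exact (norm_mul_le _ _).trans (by gcongr)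
  have hD : ‖D‖ ≤ 2 := by
    have h3 : ‖D‖ ≤ ‖D - 1‖ + ‖(1 : E →L[ℝ] E)‖ := by
      simpa using norm_add_le (D - 1) 1
    nlinarith [norm_nonneg D]
  have hA : ‖D - 1‖ ≤ 2 * m * |t| := by
    have : 0 ≤ |t| * m := by positivity
    nlinarith
  have hA' : ‖star (D - 1)‖ ≤ 2 * m * |t| := by
      rwa [ContinuousLinearMap.star_eq_adjoint, LinearIsometryEquiv.norm_map]
  have hA2 : 2 * m * |t| ≤ 1 := by linarith
  -- The product is expanded around the identity, D = 1 + (D - 1); the quadratic term is O(t²) by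
  -- `hA`.
  have hX : D * star D - 1 = (D - 1) + star (D - 1) + (D - 1) * star (D - 1) := by
    rw [star_sub, star_one]
    noncomm_ring
  have hAA : ‖(D - 1) * star (D - 1)‖ ≤ (2 * m * |t|) * (2 * m * |t|) :=
    (norm_mul_le _ _).trans (by gcongr)
  constructor
  · rw [hX]
    refine (norm_add₃_le).trans ?_
    have : 0 ≤ 2 * m * |t| := by positivity
    nlinarith
  · have hR : D - 1 + t • M = t ^ 2 • (M * D * M) := by
      have h3 : M * (D - 1) = -(t • (M * D * M)) := by
        rw [e2, mul_neg, mul_smul_comm, mul_assoc]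
      have h4 : M * D = M - t • (M * D * M) := by
        rw [mul_sub, mul_one] at h3
        rw [sub_eq_add_neg, ← h3]
        abel
      nth_rewrite 1 [e1]
      nth_rewrite 1 [h4]
      module
    have hRn : ‖D - 1 + t • M‖ ≤ 2 * m ^ 2 * t ^ 2 := by
      rw [hR, norm_smul, Real.norm_of_nonneg (sq_nonneg t)]
      have : ‖M * D * M‖ ≤ m * 2 * m :=
        (norm_mul_le _ _).trans (by gcongr; exact (norm_mul_le _ _).trans (by gcongr))
      nlinarith [sq_nonneg t]
    have hRs : ‖star (D - 1 + t • M)‖ ≤ 2 * m ^ 2 * t ^ 2 := by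
      rwa [ContinuousLinearMap.star_eq_adjoint, LinearIsometryEquiv.norm_map]
    have hsum : D * star D - 1 + t • (M + star M) =
        (D - 1 + t • M) + star (D - 1 + t • M) + (D - 1) * star (D - 1) := by
      rw [hX, star_add, star_smul, star_trivial t]
      module
    rw [hsum]
    refine (norm_add₃_le).trans ?_
    have : (2 * m * |t|) * (2 * m * |t|) = 4 * m ^ 2 * t ^ 2 := by
      rw [← sq_abs t]; ring
    linarith

/-- First order expansion of `J D D*` for the inverse `D` of `1 + t M` and `J ≈ 1 + t d`. -/
lemma norm_smul_inv_mul_star_sub_le {E : Type*} [NormedAddCommGroup E] [InnerProductSpace ℝ E]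
    [CompleteSpace E] {M D : E →L[ℝ] E} {t m J d C : ℝ} (hM : ‖M‖ ≤ m)
    (ht : |t| * m ≤ 1 / 2) (h1 : (1 + t • M) * D = 1) (h2 : D * (1 + t • M) = 1)
    (hd : |d| ≤ C) (hJ : |J - 1 - t * d| ≤ C * t ^ 2) :
    ‖J • (D * star D) - 1 - t • (d • (1 : E →L[ℝ] E) - (M + star M))‖ ≤
      (C * 4 + C * (6 * m) + 8 * m ^ 2) * t ^ 2 := by
  have hm0 : 0 ≤ m := (norm_nonneg M).trans hM
  have hC : 0 ≤ C := (abs_nonneg d).trans hd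
  have ht0 := abs_nonneg t
  have hone : ‖(1 : E →L[ℝ] E)‖ ≤ 1 := ContinuousLinearMap.norm_id_le
  obtain ⟨b1, b2⟩ := norm_inv_mul_star_sub_le hM ht h1 h2
  set X : E →L[ℝ] E := D * star D with hX
  have hXn : ‖X‖ ≤ 4 := by
    have h1 : ‖X‖ ≤ ‖X - 1‖ + ‖(1 : E →L[ℝ] E)‖ := by simpa using norm_add_le (X - 1) 1
    nlinarith
  have hdec : J • X - 1 - t • (d • (1 : E →L[ℝ] E) - (M + star M)) = (J - 1 - t * d) • X +
      (t * d) • (X - 1) + (X - 1 + t • (M + star M)) := by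
    module
  rw [hdec]
  refine (norm_add₃_le).trans ?_
  have n1 : ‖(J - 1 - t * d) • X‖ ≤ (C * t ^ 2) * 4 := by
    rw [norm_smul, Real.norm_eq_abs]
    exact mul_le_mul hJ hXn (norm_nonneg _) (by positivity)
  have n2 : ‖(t * d) • (X - 1)‖ ≤ (C * (6 * m)) * t ^ 2 := by
    rw [norm_smul, Real.norm_eq_abs, abs_mul]
    calc _ ≤ |t| * C * (6 * m * |t|) := by gcongr
      _ = (C * (6 * m)) * |t| ^ 2 := by ring
      _ = _ := by rw [sq_abs]
  linarith

lemma norm_symGrad_le {θ : Plane → Plane} {x : Plane} {m : ℝ} (hm : ‖fderiv ℝ θ x‖ ≤ m) :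
    ‖symGrad θ x‖ ≤ 2 * m := by
  rw [symGrad]
  refine (norm_add_le _ _).trans ?_
  rw [LinearIsometryEquiv.norm_map]
  linarith

/-- The first order coefficient of the transformed Dirichlet form. -/
noncomputable def firstOrderField (θ : Plane → Plane) (x : Plane) : Plane →L[ℝ] Plane :=
  divergence θ x • (1 : Plane →L[ℝ] Plane) - symGrad θ x

/-- Expansion of the Jacobian determinant and of the transformed coefficient field. -/
lemma exists_expansion {θ : Plane → Plane} (hθ : ContDiff ℝ 1 θ) {M : NNReal}
    (hM : LipschitzWith M θ) : ∃ C t₀ : ℝ, 0 ≤ C ∧ 0 < t₀ ∧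
      (∀ x, |divergence θ x| ≤ C) ∧ (∀ x, ‖firstOrderField θ x‖ ≤ C) ∧
      ∀ t : ℝ, |t| ≤ t₀ → ∃ S, IsLipDiffeo (fun x => x + t • θ x) S 2 ∧ ∀ x,
        |(|(fderiv ℝ (fun x => x + t • θ x) x).det| - 1 - t * divergence θ x)| ≤ C * t ^ 2 ∧
        ‖pullbackField (fun x => x + t • θ x) S x - 1 - t • firstOrderField θ x‖ ≤ C * t ^ 2 := by
  obtain ⟨C, hC, hCb⟩ := exists_bound_trace_det (M : ℝ)
  set m : ℝ := (M : ℝ) with hm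
  have hm0 : 0 ≤ m := NNReal.coe_nonneg M
  have hfd : ∀ x, ‖fderiv ℝ θ x‖ ≤ m := fun x => norm_fderiv_le_of_lipschitz ℝ hM
  have hone : ‖(1 : Plane →L[ℝ] Plane)‖ ≤ 1 := ContinuousLinearMap.norm_id_le
  -- A single constant dominates all the bounds. The smallness of `t` yields |t|m ≤ 1/2, for the
  -- diffeomorphism, and 2C|t| ≤ 1/2, which keeps the determinant positive and removes its absolute
  -- value.
  refine ⟨C * 4 + C * (6 * m) + 8 * m ^ 2 + C + 2 * m, min 1 (1 / (2 * (m + 2 * C + 1))),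
    by positivity, by positivity, fun x => ?_, fun x => ?_, fun t ht => ?_⟩
  · refine ((hCb _ (hfd x)).1).trans ?_
    nlinarith [mul_nonneg hC hm0, sq_nonneg m]
  · refine (norm_sub_le _ _).trans ?_
    rw [norm_smul, Real.norm_eq_abs]
    have h1 : |divergence θ x| ≤ C := (hCb _ (hfd x)).1
    have h2 := norm_symGrad_le (hfd x)
    have h3 := mul_le_mul h1 hone (norm_nonneg _) hC
    nlinarith [mul_nonneg hC hm0, sq_nonneg m]
  have ht1 : |t| ≤ 1 := ht.trans (min_le_left _ _)
  have ht2 : |t| * (m + 2 * C + 1) ≤ 1 / 2 := by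
    have h := ht.trans (min_le_right _ _)
    rw [le_div_iff₀ (by positivity)] at h
    linarith
  have ht0 := abs_nonneg t
  have htm : |t| * m ≤ 1 / 2 := by nlinarith
  have htC : |t| * (2 * C) ≤ 1 / 2 := by nlinarith
  obtain ⟨S, hS⟩ := exists_isLipDiffeo hθ hM htm
  refine ⟨S, hS, fun x => ?_⟩
  have hder : fderiv ℝ (fun x => x + t • θ x) x = 1 + t • fderiv ℝ θ x :=
    ((hasFDerivAt_id x).add
      ((hθ.differentiable (by norm_num) x).hasFDerivAt.const_smul t)).fderiv
  obtain ⟨htr, hdet⟩ := hCb _ (hfd x)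
  change |divergence θ x| ≤ C at htr
  have hJ : (fderiv ℝ (fun x => x + t • θ x) x).det =
      1 + t * divergence θ x + t ^ 2 * (fderiv ℝ θ x).det := by
    rw [hder, det_id_add_smul]; rfl
  set J : ℝ := (fderiv ℝ (fun x => x + t • θ x) x).det with hJdef
  have hJpos : 0 < J := by
    have h1 : |t * divergence θ x| ≤ |t| * C := by rw [abs_mul]; gcongr
    have h2 : |t ^ 2 * (fderiv ℝ θ x).det| ≤ |t| * C := by
      rw [abs_mul, abs_pow]
      have : |t| ^ 2 ≤ |t| := by nlinarith
      gcongr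
    rw [hJ]
    linarith [neg_abs_le (t * divergence θ x), neg_abs_le (t ^ 2 * (fderiv ℝ θ x).det)]
  have hJ2 : |J - 1 - t * divergence θ x| ≤ C * t ^ 2 := by
    rw [hJ, show 1 + t * divergence θ x + t ^ 2 * (fderiv ℝ θ x).det - 1 - t * divergence θ x =
      (fderiv ℝ θ x).det * t ^ 2 by ring, abs_mul, abs_of_nonneg (sq_nonneg t)]
    gcongr
  have ht2' := sq_nonneg t
  rw [abs_of_pos hJpos]
  refine ⟨hJ2.trans ?_, ?_⟩
  · gcongr
    nlinarith [mul_nonneg hC hm0, sq_nonneg m]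
  set D : Plane →L[ℝ] Plane := fderiv ℝ S (x + t • θ x) with hD
  have i1 : (1 + t • fderiv ℝ θ x) * D = 1 := by
    rw [← hder]; exact hS.fderiv_inv_comp_fderiv x
  have i2 : D * (1 + t • fderiv ℝ θ x) = 1 := by
    rw [← hder]; exact hS.fderiv_comp_fderiv_inv x
  have hP : pullbackField (fun x => x + t • θ x) S x = J • (D * star D) := by
    rw [pullbackField, ← hJdef, abs_of_pos hJpos]
    rfl
  rw [hP]
  refine (norm_smul_inv_mul_star_sub_le (hfd x) htm i1 i2 htr hJ2).trans ?_
  refine mul_le_mul_of_nonneg_right ?_ ht2'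
  linarith

/-! ### First order perturbation of a variational problem in `L²` -/

lemma toReal_eLpNorm_add_le {α E : Type*} [MeasurableSpace α] {μ : Measure α}
    [NormedAddCommGroup E] {f g : α → E} (hf : MemLp f 2 μ) (hg : MemLp g 2 μ) :
    (eLpNorm (fun x => f x + g x) 2 μ).toReal ≤
      (eLpNorm f 2 μ).toReal + (eLpNorm g 2 μ).toReal := by
  rw [← ENNReal.toReal_add hf.2.ne hg.2.ne]
  exact ENNReal.toReal_mono (ENNReal.add_ne_top.2 ⟨hf.2.ne, hg.2.ne⟩)
    (eLpNorm_add_le hf.1 hg.1 (by norm_num))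

lemma integral_inner_self_eq {α E : Type*} [MeasurableSpace α] {μ : Measure α}
    [NormedAddCommGroup E] [InnerProductSpace ℝ E] {f : α → E} (hf : MemLp f 2 μ) :
    ∫ x, inner ℝ (f x) (f x) ∂μ = (eLpNorm f 2 μ).toReal ^ 2 := by
  rw [← ENNReal.toReal_pow, eLpNorm_two_sq]
  rw [integral_eq_lintegral_of_nonneg_ae (Eventually.of_forall fun x => real_inner_self_nonneg)
    (hf.1.inner hf.1)]
  congr 1
  refine lintegral_congr fun x => ?_
  rw [real_inner_self_eq_norm_sq, ENNReal.ofReal_pow (norm_nonneg _), ofReal_norm]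

lemma integrable_mul_of_memLp {α : Type*} [MeasurableSpace α] {μ : Measure α} {f g : α → ℝ}
    (hf : MemLp f 2 μ) (hg : MemLp g 2 μ) : Integrable (fun x => f x * g x) μ :=
  integrable_of_norm_le_mul hf hg (hf.1.mul hg.1) (C := 1)
    (Eventually.of_forall fun x => by rw [norm_mul, one_mul])

lemma integrable_inner_of_memLp {α E : Type*} [MeasurableSpace α] {μ : Measure α}
    [NormedAddCommGroup E] [InnerProductSpace ℝ E] {f g : α → E}
    (hf : MemLp f 2 μ) (hg : MemLp g 2 μ) : Integrable (fun x => inner ℝ (f x) (g x)) μ :=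
  integrable_of_norm_le_mul hf hg (hf.1.inner hg.1) (C := 1)
    (Eventually.of_forall fun x => by rw [one_mul]; exact norm_inner_le_norm _ _)

lemma abs_integral_mul_le {α : Type*} [MeasurableSpace α] {μ : Measure α} {f g : α → ℝ}
    (hf : MemLp f 2 μ) (hg : MemLp g 2 μ) :
    |∫ x, f x * g x ∂μ| ≤ (eLpNorm f 2 μ).toReal * (eLpNorm g 2 μ).toReal := by
  have := norm_integral_le_of_norm_le_mul (k := fun x => f x * g x) hf hg zero_le_one
    (Eventually.of_forall fun x => by rw [norm_mul, one_mul])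
  rwa [one_mul] at this

lemma memLp_clm_apply {μ : Measure Plane} {A : Plane → Plane →L[ℝ] Plane} (hA : Continuous A)
    {a : ℝ} (ha : ∀ x, ‖A x‖ ≤ a) {ξ : Plane → Plane} (hξ : MemLp ξ 2 μ) :
    MemLp (fun x => A x (ξ x)) 2 μ :=
  MemLp.of_le_mul hξ (aestronglyMeasurable_clm_apply hA hξ.1)
    (Eventually.of_forall fun x => (A x).le_of_opNorm_le (ha x) _)

lemma abs_integral_inner_clm_le {μ : Measure Plane} {A : Plane → Plane →L[ℝ] Plane}
    {a : ℝ} (ha : ∀ x, ‖A x‖ ≤ a) {ξ η : Plane → Plane} (hξ : MemLp ξ 2 μ) (hη : MemLp η 2 μ) :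
    |∫ x, inner ℝ (A x (ξ x)) (η x) ∂μ| ≤
      a * ((eLpNorm ξ 2 μ).toReal * (eLpNorm η 2 μ).toReal) := by
  refine norm_integral_le_of_norm_le_mul (k := fun x => inner ℝ (A x (ξ x)) (η x)) hξ hη
    ((norm_nonneg _).trans (ha 0)) (Eventually.of_forall fun x => ?_)
  refine (norm_inner_le_norm _ _).trans ?_
  rw [← mul_assoc]
  gcongr
  exact (A x).le_of_opNorm_le (ha x) _

section Perturbation

variable {μ : Measure Plane} {A B : Plane → Plane →L[ℝ] Plane} {X E Y : Plane → Plane}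
  {e p F φ : Plane → ℝ} {a b t : ℝ}

/-- The equation tested with the error: ‖E‖² = ∫ F e - ∫ (A - 1)(X + E)·E. The term a‖E‖² is
absorbed because a ≤ 1/2, whence the factor 2. -/
lemma energy_error_le (hA : Continuous A) (hX : MemLp X 2 μ) (hE : MemLp E 2 μ)
    (he : MemLp e 2 μ) (hF : MemLp F 2 μ) {P : ℝ} (hP0 : 0 ≤ P)
    (ha : ∀ x, ‖A x - 1‖ ≤ a) (ha2 : a ≤ 1 / 2)
    (hP : (eLpNorm e 2 μ).toReal ≤ P * (eLpNorm E 2 μ).toReal)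
    (heq : ∫ x, inner ℝ (A x (X x + E x) - X x) (E x) ∂μ = ∫ x, F x * e x ∂μ) :
    (eLpNorm E 2 μ).toReal ≤
      2 * (a * (eLpNorm X 2 μ).toReal + P * (eLpNorm F 2 μ).toReal) := by
  have hA1 : Continuous fun x => A x - 1 := hA.sub continuous_const
  have hXE : MemLp (fun x => X x + E x) 2 μ := hX.add hE
  have hsplit : ∫ x, inner ℝ (A x (X x + E x) - X x) (E x) ∂μ =
      ∫ x, inner ℝ ((A x - 1) (X x + E x)) (E x) ∂μ + ∫ x, inner ℝ (E x) (E x) ∂μ := by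
    rw [← integral_add (integrable_inner_of_memLp (memLp_clm_apply hA1 ha hXE) hE)
      (integrable_inner_of_memLp hE hE)]
    refine integral_congr_ae (Eventually.of_forall fun x => ?_)
    dsimp only
    rw [← inner_add_left]
    congr 1
    change A x (X x + E x) - X x = A x (X x + E x) - (X x + E x) + E x
    abel
  rw [heq, integral_inner_self_eq hE] at hsplit
  have h1 := (abs_le.1 (abs_integral_inner_clm_le ha hXE hE)).1
  have h2 := (abs_le.1 (abs_integral_mul_le hF he)).2
  have h3 := toReal_eLpNorm_add_le hX hE
  have hn : 0 ≤ (eLpNorm E 2 μ).toReal := ENNReal.toReal_nonneg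
  have hnX : 0 ≤ (eLpNorm X 2 μ).toReal := ENNReal.toReal_nonneg
  have hnF : 0 ≤ (eLpNorm F 2 μ).toReal := ENNReal.toReal_nonneg
  have ha0 : 0 ≤ a := (norm_nonneg _).trans (ha 0)
  rcases hn.eq_or_lt with h0 | h0
  · rw [← h0]
    positivity
  · have h4 := mul_le_mul_of_nonneg_left hP hnF
    have h5 : a * ((eLpNorm (fun x => X x + E x) 2 μ).toReal * (eLpNorm E 2 μ).toReal) ≤
        a * (((eLpNorm X 2 μ).toReal + (eLpNorm E 2 μ).toReal) * (eLpNorm E 2 μ).toReal) := by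
      gcongr
    have h6 : (eLpNorm E 2 μ).toReal * (eLpNorm E 2 μ).toReal ≤
        (a * (eLpNorm X 2 μ).toReal + a * (eLpNorm E 2 μ).toReal + P * (eLpNorm F 2 μ).toReal) *
          (eLpNorm E 2 μ).toReal := by
      nlinarith
    have h7 := le_of_mul_le_mul_right h6 h0
    nlinarith

/-- The equation tested with the adjoint, through the splitting A(X + E) - X = (E + tBX) + (A - 1)E
+ (A - 1 - tB)X. In the application the last two terms are of second order, so ∫ E·Y is known up to
the error in the source. -/
lemma linear_term_error_le (hA : Continuous A) (hB : Continuous B) (hX : MemLp X 2 μ)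
    (hE : MemLp E 2 μ) (hY : MemLp Y 2 μ) (hp : MemLp p 2 μ) (hF : MemLp F 2 μ)
    (hφ : MemLp φ 2 μ) {c : ℝ} (ha : ∀ x, ‖A x - 1‖ ≤ a) (hb : ∀ x, ‖A x - 1 - t • B x‖ ≤ b)
    (hc : ∀ x, ‖B x‖ ≤ c)
    (heq : ∫ x, inner ℝ (A x (X x + E x) - X x) (Y x) ∂μ = ∫ x, F x * p x ∂μ) :
    |∫ x, inner ℝ (E x) (Y x) ∂μ + t * ∫ x, inner ℝ (B x (X x)) (Y x) ∂μ
        - t * ∫ x, φ x * p x ∂μ| ≤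
      (a * (eLpNorm E 2 μ).toReal + b * (eLpNorm X 2 μ).toReal) * (eLpNorm Y 2 μ).toReal +
        (eLpNorm (fun x => F x - t * φ x) 2 μ).toReal * (eLpNorm p 2 μ).toReal := by
  have hA1 : Continuous fun x => A x - 1 := hA.sub continuous_const
  have hA2 : Continuous fun x => A x - 1 - t • B x := hA1.sub (hB.const_smul t)
  have i1 := integrable_inner_of_memLp (memLp_clm_apply hA1 ha hE) hY
  have i2 := integrable_inner_of_memLp (memLp_clm_apply hA2 hb hX) hY
  have i3 := integrable_inner_of_memLp hE hY
  have i4 := integrable_inner_of_memLp (memLp_clm_apply hB hc hX) hY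
  have hFφ : MemLp (fun x => F x - t * φ x) 2 μ := hF.sub (hφ.const_mul t)
  have h1 : ∫ x, inner ℝ (A x (X x + E x) - X x) (Y x) ∂μ =
      ∫ x, inner ℝ ((A x - 1) (E x)) (Y x) ∂μ + ∫ x, inner ℝ ((A x - 1 - t • B x) (X x)) (Y x) ∂μ
        + (∫ x, inner ℝ (E x) (Y x) ∂μ + t * ∫ x, inner ℝ (B x (X x)) (Y x) ∂μ) := by
    have i5 : Integrable (fun x => inner ℝ ((A x - 1) (E x)) (Y x) +
        inner ℝ ((A x - 1 - t • B x) (X x)) (Y x)) μ := i1.add i2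
    have i6 : Integrable (fun x => inner ℝ (E x) (Y x) + t * inner ℝ (B x (X x)) (Y x)) μ :=
      i3.add (i4.const_mul t)
    rw [← integral_const_mul, ← integral_add i1 i2, ← integral_add i3 (i4.const_mul t),
      ← integral_add i5 i6]
    refine integral_congr_ae (Eventually.of_forall fun x => ?_)
    dsimp only
    rw [← real_inner_smul_left, ← inner_add_left, ← inner_add_left, ← inner_add_left]
    congr 1
    change A x (X x + E x) - X x =
      (A x (E x) - E x) + (A x (X x) - X x - t • B x (X x)) + (E x + t • B x (X x))
    rw [map_add]
    abel
  have h2 : ∫ x, (F x - t * φ x) * p x ∂μ = ∫ x, F x * p x ∂μ - t * ∫ x, φ x * p x ∂μ := by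
    rw [← integral_const_mul, ← integral_sub (integrable_mul_of_memLp hF hp)
      ((integrable_mul_of_memLp hφ hp).const_mul t)]
    refine integral_congr_ae (Eventually.of_forall fun x => ?_)
    dsimp only
    ring
  have h3 := abs_integral_inner_clm_le ha hE hY
  have h4 := abs_integral_inner_clm_le hb hX hY
  have h5 := abs_integral_mul_le hFφ hp
  rw [h2, ← heq, h1] at h5
  rw [abs_le] at h3 h4 h5 ⊢
  constructor <;> linarith

end Perturbation

/-! ### The state on the reference domain -/

lemma continuous_pullbackField {T S : Plane → Plane} {K : NNReal} (h : IsLipDiffeo T S K) :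
    Continuous (pullbackField T S) := by
  have h1 : Continuous fun x => |(fderiv ℝ T x).det| :=
    ((ContinuousLinearMap.continuous_det).comp (h.contDiff.continuous_fderiv (by norm_num))).abs
  have hT : Continuous T := h.contDiff.continuous
  exact h1.smul (((h.contDiff_inv.continuous_fderiv (by norm_num)).comp hT).clm_comp
    ((continuous_adjoint_fderiv h.contDiff_inv).comp hT))

lemma continuous_divergence {θ : Plane → Plane} (hθ : ContDiff ℝ 1 θ) :
    Continuous (divergence θ) := by
  have c1 : Continuous fun M : Plane →L[ℝ] Plane =>
      LinearMap.trace ℝ Plane (M : Plane →ₗ[ℝ] Plane) :=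
    ((LinearMap.trace ℝ Plane).comp
      (ContinuousLinearMap.coeLM ℝ : (Plane →L[ℝ] Plane) →ₗ[ℝ] _)).continuous_of_finiteDimensional
  exact c1.comp (hθ.continuous_fderiv (by norm_num))

lemma continuous_firstOrderField {θ : Plane → Plane} (hθ : ContDiff ℝ 1 θ) :
    Continuous (firstOrderField θ) :=
  ((continuous_divergence hθ).smul continuous_const).sub
    ((hθ.continuous_fderiv (by norm_num)).add (continuous_adjoint_fderiv hθ))

/-- A `C¹` field may be replaced by a globally Lipschitz and bounded one without changing it near
a bounded set. -/
lemma exists_cutoff_field {θ : Plane → Plane} (hθ : ContDiff ℝ 1 θ) {Ω : Set Plane}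
    (hb : Bornology.IsBounded Ω) : ∃ θ' : Plane → Plane, ContDiff ℝ 1 θ' ∧
      (∃ M, LipschitzWith M θ') ∧ (∃ B : NNReal, ∀ x, ‖θ' x‖₊ ≤ B) ∧
      (∀ x, θ x = 0 → θ' x = 0) ∧ ∀ x ∈ Ω, θ' =ᶠ[𝓝 x] θ := by
  obtain ⟨r, hr0, hr⟩ := hb.subset_ball_lt 0 0
  let χ : ContDiffBump (0 : Plane) := ⟨r, r + 1, hr0, by linarith⟩
  have hc : ContDiff ℝ 1 fun x => χ x • θ x := χ.contDiff.smul hθ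
  have hs : HasCompactSupport fun x => χ x • θ x := χ.hasCompactSupport.smul_right
  obtain ⟨M, hM⟩ := hc.lipschitzWith_of_hasCompactSupport hs (by norm_num)
  obtain ⟨B, hB⟩ := hs.exists_bound_of_continuous hc.continuous
  refine ⟨_, hc, ⟨M, hM⟩, ⟨B.toNNReal, fun x => ?_⟩, fun x hx => by simp [hx], fun x hx => ?_⟩
  · exact NNReal.coe_le_coe.1 ((hB x).trans (Real.le_coe_toNNReal B))
  · filter_upwards [Metric.isOpen_ball.mem_nhds (hr hx)] with y hy
    rw [χ.one_of_mem_closedBall (Metric.ball_subset_closedBall hy), one_smul]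

section Pullback

variable {T S : Plane → Plane} {K : NNReal} {Γf Ω : Set Plane}

/-- On `Γf` every function of `V(Ω)` has a trace. -/
lemma MemV.hasTrace_trace (hΩ : IsOpen Ω) (hb : Bornology.IsBounded Ω)
    (hL : HasLipschitzBoundary Ω) (hΓ : IsCompact Γf) (hsub : Γf ⊆ frontier Ω) {v : Plane → ℝ}
    (hv : MemV Γf Ω v) : HasTrace Ω Γf v (trace Ω Γf v) := by
  obtain ⟨C, hC⟩ := exists_trace_inequality_eLpNorm hΩ hL hΓ hsub
  obtain ⟨φ, a, -⟩ := hv.2.exists_approx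
  obtain ⟨g, hg⟩ := a.exists_hasTrace hΩ hb hC
  exact hg.hasTrace_trace

lemma HasTrace.ae_eq_of_hasLipschitzBoundary (hΩ : IsOpen Ω) (hb : Bornology.IsBounded Ω)
    (hL : HasLipschitzBoundary Ω) (hΓ : IsCompact Γf) (hsub : Γf ⊆ frontier Ω)
    {v g k : Plane → ℝ} (hg : HasTrace Ω Γf v g) (hk : HasTrace Ω Γf v k) :
    g =ᵐ[arcLength Γf] k := by
  obtain ⟨C, hC⟩ := exists_trace_inequality_eLpNorm hΩ hL hΓ hsub
  exact hg.ae_eq hΩ hb hC hk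

/-- No regularity of T(Ω) is assumed: a trace exists on `Ω`, is carried to T(Ω) by `S`, and so
legitimizes the chosen `trace` there, which is then carried back. -/
lemma MemV.hasTrace_comp (h : IsLipDiffeo T S K) (hT : ∀ x ∈ Γf, T x = x)
    (hΩ : IsOpen Ω) (hb : Bornology.IsBounded Ω) (hL : HasLipschitzBoundary Ω)
    (hΓ : IsCompact Γf) (hsub : Γf ⊆ frontier Ω) {v : Plane → ℝ} (hv : MemV Γf (T '' Ω) v) :
    HasTrace Ω Γf (fun x => v (T x)) (trace (T '' Ω) Γf v) := by
  have h1 := (hv.comp h hT hΩ hb).hasTrace_trace hΩ hb hL hΓ hsub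
  have h2 : HasTrace (T '' Ω) Γf v (trace Ω Γf fun x => v (T x)) := by
    rw [← h.image_image_symm Ω] at h1
    have h3 := h1.comp_fixed h.symm (inv_fixed h hT) hΓ.isClosed (h.isOpen_image hΩ)
      (h.isBounded_image hb)
    simp only [h.right_inv, h.image_image_symm] at h3
    exact h3
  exact h2.hasTrace_trace.comp_fixed h hT hΓ.isClosed hΩ hb

/-- The state equation in `T(Ω)`, transported to `Ω`. -/
lemma IsState.pullback (h : IsLipDiffeo T S K) (hT : ∀ x ∈ Γf, T x = x)
    (hΩ : IsOpen Ω) (hb : Bornology.IsBounded Ω) (hL : HasLipschitzBoundary Ω)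
    (hΓ : IsCompact Γf) (hsub : Γf ⊆ frontier Ω) {f : Plane → ℝ} {gN : HMinusHalf Γf}
    {v w : Plane → ℝ} (hv : IsState Γf f gN (T '' Ω) v) (hw : MemV Γf Ω w) :
    ∫ x in Ω, inner ℝ (pullbackField T S x (weakGrad Ω (fun x => v (T x)) x)) (weakGrad Ω w x) =
      (∫ x in Ω, |(fderiv ℝ T x).det| * (f (T x) * w x)) + gN.pairing (trace Ω Γf w) := by
  have hw' := hw.comp_inv h hT hΩ hb
  have h1 := hv.2 _ hw'
  rw [dirichletForm_image h hΩ hb hv.1 hw', load, setIntegral_image h hΩ] at h1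
  have h2 := hw'.hasTrace_comp h hT hΩ hb hL hΓ hsub
  simp only [h.left_inv] at h1 h2
  -- The Neumann pairing is the same on both domains, since w∘S and w have almost everywhere equal
  -- traces on `Γf`.
  rw [h1, gN.congr_ae _ _ (h2.ae_eq_of_hasLipschitzBoundary hΩ hb hL hΓ hsub
    (hw.hasTrace_trace hΩ hb hL hΓ hsub))]

lemma memLp_det_mul_comp_sub (h : IsLipDiffeo T S K) {f : Plane → ℝ} {c : ℝ}
    (hc : ∀ x, |(fderiv ℝ T x).det| ≤ c) (hf : MemLp f 2 (volume.restrict Ω))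
    (hfT : MemLp f 2 (volume.restrict (T '' Ω))) :
    MemLp (fun x => |(fderiv ℝ T x).det| * f (T x) - f x) 2 (volume.restrict Ω) := by
  have h1 : Continuous fun x => |(fderiv ℝ T x).det| :=
    ((ContinuousLinearMap.continuous_det).comp (h.contDiff.continuous_fderiv (by norm_num))).abs
  have h2 := memLp_comp_of_map_le h.measurable (h.map_volume_le Ω) (by finiteness) hfT
  refine MemLp.sub (MemLp.of_le_mul h2 (h1.aestronglyMeasurable.mul h2.1)
    (Eventually.of_forall fun x => (?_ : _ ≤ c * ‖f (T x)‖))) hf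
  rw [norm_mul, norm_abs_eq_norm, Real.norm_eq_abs]
  gcongr
  exact hc x

/-- The equation for the difference between the transported state and the state. -/
lemma IsState.pullback_sub (h : IsLipDiffeo T S K) (hT : ∀ x ∈ Γf, T x = x)
    (hΩ : IsOpen Ω) (hb : Bornology.IsBounded Ω) (hL : HasLipschitzBoundary Ω)
    (hΓ : IsCompact Γf) (hsub : Γf ⊆ frontier Ω) {f : Plane → ℝ} {gN : HMinusHalf Γf}
    {u v w : Plane → ℝ} {c a : ℝ} (hc : ∀ x, |(fderiv ℝ T x).det| ≤ c)
    (ha : ∀ x, ‖pullbackField T S x‖ ≤ a)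
    (hf : MemLp f 2 (volume.restrict Ω)) (hfT : MemLp f 2 (volume.restrict (T '' Ω)))
    (hu : IsState Γf f gN Ω u) (hv : IsState Γf f gN (T '' Ω) v) (hw : MemV Γf Ω w) :
    ∫ x in Ω, inner ℝ (pullbackField T S x
        (weakGrad Ω u x + weakGrad Ω (fun x => v (T x) - u x) x) - weakGrad Ω u x)
        (weakGrad Ω w x) =
      ∫ x in Ω, (|(fderiv ℝ T x).det| * f (T x) - f x) * w x := by
  have hvT := hv.1.comp h hT hΩ hb
  have h1 := hv.pullback h hT hΩ hb hL hΓ hsub hw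
  have h2 := hu.2 w hw
  rw [dirichletForm, load] at h2
  have hwg := hw.1.memLp_weakGrad
  have e1 : ∫ x in Ω, inner ℝ (pullbackField T S x
        (weakGrad Ω u x + weakGrad Ω (fun x => v (T x) - u x) x) - weakGrad Ω u x)
        (weakGrad Ω w x) = (∫ x in Ω, inner ℝ
          (pullbackField T S x (weakGrad Ω (fun x => v (T x)) x)) (weakGrad Ω w x)) -
        ∫ x in Ω, inner ℝ (weakGrad Ω u x) (weakGrad Ω w x) := by
    rw [← integral_sub (integrable_inner_of_memLp
      (memLp_clm_apply (continuous_pullbackField h) ha hvT.1.memLp_weakGrad) hwg)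
      (integrable_inner_of_memLp hu.1.1.memLp_weakGrad hwg)]
    refine integral_congr_ae ?_
    filter_upwards [MemV.weakGrad_sub_ae_eq hΩ hb hvT hu.1] with x hx
    rw [hx, ← inner_sub_left, add_sub_cancel]
  have hF := memLp_det_mul_comp_sub h hc hf hfT
  have e2 : ∫ x in Ω, |(fderiv ℝ T x).det| * (f (T x) * w x) =
      (∫ x in Ω, (|(fderiv ℝ T x).det| * f (T x) - f x) * w x) + ∫ x in Ω, f x * w x := by
    rw [← integral_add (integrable_mul_of_memLp hF hw.1.1) (integrable_mul_of_memLp hf hw.1.1)]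
    refine integral_congr_ae (Eventually.of_forall fun x => ?_)
    dsimp only
    ring
  rw [e1, h1, h2, e2]
  ring

/-- The Lagrangian at the state does not depend on the second argument. -/
lemma IsState.lagrangian_eq {h : ℝ} {f gD : Plane → ℝ} {gN : HMinusHalf Γf} {u v : Plane → ℝ}
    (hu : IsState Γf f gN Ω u) (hv : MemV Γf Ω v) :
    lagrangian Γf h f gD gN Ω u v =
      1 / 2 * h⁻¹ * ∫ x, (gD x - trace Ω Γf u x) ^ 2 ∂arcLength Γf := by
  rw [lagrangian, hu.2 v hv]
  ring

/-- Increment of the Lagrangian under a transformation of the domain. -/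
lemma lagrangian_image_sub (h : IsLipDiffeo T S K) (hT : ∀ x ∈ Γf, T x = x)
    (hΩ : IsOpen Ω) (hb : Bornology.IsBounded Ω) (hL : HasLipschitzBoundary Ω)
    (hΓ : IsCompact Γf) (hsub : Γf ⊆ frontier Ω) {κ : ℝ} {f gD : Plane → ℝ} {gN : HMinusHalf Γf}
    (hgD : MemLp gD 2 (arcLength Γf)) {u p v q : Plane → ℝ}
    (hu : IsState Γf f gN Ω u) (hp : IsAdjoint Γf κ gD Ω u p)
    (hv : IsState Γf f gN (T '' Ω) v) (hq : MemV Γf (T '' Ω) q) :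
    lagrangian Γf κ f gD gN (T '' Ω) v q - lagrangian Γf κ f gD gN Ω u p =
      dirichletForm Ω (fun x => v (T x) - u x) p +
        1 / 2 * κ⁻¹ * (eLpNorm (trace Ω Γf fun x => v (T x) - u x) 2 (arcLength Γf)).toReal ^ 2 := by
  have hvT := hv.1.comp h hT hΩ hb
  have he := hvT.sub hΩ hb hu.1
  have tv := hv.1.hasTrace_comp h hT hΩ hb hL hΓ hsub
  have tu := hu.1.hasTrace_trace hΩ hb hL hΓ hsub
  have te := he.hasTrace_trace hΩ hb hL hΓ hsub
  have hae := te.ae_eq_of_hasLipschitzBoundary hΩ hb hL hΓ hsub (tv.sub hΩ hb tu)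
  rw [hv.lagrangian_eq hq, hu.lagrangian_eq hp.1, hp.2 _ he, ← integral_inner_self_eq te.2.1]
  have i1 : Integrable (fun x => (gD x - trace (T '' Ω) Γf v x) ^ 2) (arcLength Γf) :=
    (hgD.sub tv.2.1).integrable_sq
  have i2 : Integrable (fun x => (gD x - trace Ω Γf u x) ^ 2) (arcLength Γf) :=
    (hgD.sub tu.2.1).integrable_sq
  have i3 : Integrable (fun x => (trace Ω Γf u x - gD x) *
      trace Ω Γf (fun x => v (T x) - u x) x) (arcLength Γf) :=
    integrable_mul_of_memLp (tu.2.1.sub hgD) te.2.1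
  have i4 := integrable_inner_of_memLp te.2.1 te.2.1
  -- Pointwise (g - v)² - (g - u)² = 2(u - g)e + e² with e = v - u. The linear part is the right
  -- side of the adjoint equation tested with e.
  have key : (∫ x, (gD x - trace (T '' Ω) Γf v x) ^ 2 ∂arcLength Γf) -
      ∫ x, (gD x - trace Ω Γf u x) ^ 2 ∂arcLength Γf =
      2 * (∫ x, (trace Ω Γf u x - gD x) * trace Ω Γf (fun x => v (T x) - u x) x ∂arcLength Γf) +
      ∫ x, inner ℝ (trace Ω Γf (fun x => v (T x) - u x) x)
        (trace Ω Γf (fun x => v (T x) - u x) x) ∂arcLength Γf := by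
    rw [← integral_sub i1 i2, ← integral_const_mul,
      ← integral_add (i3.const_mul 2) i4]
    refine integral_congr_ae ?_
    filter_upwards [hae] with x hx
    rw [real_inner_self_eq_norm_sq, Real.norm_eq_abs, sq_abs, hx]
    ring
  linear_combination (1 / 2 * κ⁻¹) * key

end Pullback

/-! ### The derivative of the Lagrangian -/

lemma toReal_eLpNorm_le_add_mul {α E : Type*} [MeasurableSpace α] {μ : Measure α}
    [NormedAddCommGroup E] {k f g l : α → E} (hf : MemLp f 2 μ) (hg : MemLp g 2 μ)
    (hl : MemLp l 2 μ) {a b c : ℝ} (ha : 0 ≤ a) (hb : 0 ≤ b) (hc : 0 ≤ c)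
    (h : ∀ x, ‖k x‖ ≤ a * ‖f x‖ + b * ‖g x‖ + c * ‖l x‖) :
    (eLpNorm k 2 μ).toReal ≤ a * (eLpNorm f 2 μ).toReal + b * (eLpNorm g 2 μ).toReal +
      c * (eLpNorm l 2 μ).toReal := by
  have key : ∀ {w : α → E} {r : ℝ}, 0 ≤ r →
      (eLpNorm (fun x => r * ‖w x‖) 2 μ).toReal = r * (eLpNorm w 2 μ).toReal := by
    intro w r hr
    have h1 : eLpNorm (fun x => r * ‖w x‖) 2 μ = ‖r‖ₑ * eLpNorm (fun x => ‖w x‖) 2 μ :=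
      eLpNorm_const_smul r (fun x => ‖w x‖) 2 μ
    rw [h1, eLpNorm_norm, ENNReal.toReal_mul, toReal_enorm, Real.norm_of_nonneg hr]
  have mf := hf.norm.const_mul a
  have mg := hg.norm.const_mul b
  have ml := hl.norm.const_mul c
  have mfg : MemLp (fun x => a * ‖f x‖ + b * ‖g x‖) 2 μ := mf.add mg
  have h1 := toReal_eLpNorm_add_le mfg ml
  have h2 := toReal_eLpNorm_add_le mf mg
  have h3 : (eLpNorm k 2 μ).toReal ≤
      (eLpNorm (fun x => a * ‖f x‖ + b * ‖g x‖ + c * ‖l x‖) 2 μ).toReal :=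
    ENNReal.toReal_mono (mfg.add ml).2.ne (eLpNorm_mono_real h)
  rw [key ha, key hb] at h2
  rw [key hc] at h1
  linarith

lemma memLp_sourceDerivative {μ : Measure Plane} {θ : Plane → Plane} (hθ : ContDiff ℝ 1 θ)
    {B : NNReal} (hB : ∀ x, ‖θ x‖₊ ≤ B) {C : ℝ} (hC : ∀ x, |divergence θ x| ≤ C)
    {f : Plane → ℝ} {G : Plane → Plane} (hf : MemLp f 2 μ) (hG : MemLp G 2 μ) :
    MemLp (fun x => divergence θ x * f x) 2 μ ∧ MemLp (fun x => inner ℝ (G x) (θ x)) 2 μ := by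
  refine ⟨MemLp.of_le_mul hf ((continuous_divergence hθ).aestronglyMeasurable.mul hf.1)
    (Eventually.of_forall fun x => (?_ : _ ≤ C * ‖f x‖)),
    MemLp.of_le_mul hG (hG.1.inner hθ.continuous.aestronglyMeasurable)
      (Eventually.of_forall fun x => (?_ : _ ≤ (B : ℝ) * ‖G x‖))⟩
  · rw [norm_mul, Real.norm_eq_abs]
    gcongr
    exact hC x
  · rw [mul_comm]
    refine (norm_inner_le_norm _ _).trans ?_
    gcongr
    exact hB x

section Expansion

variable {U Ω : Set Plane} {f : Plane → ℝ} {θ : Plane → Plane} {M B : NNReal} {δ C t₀ : ℝ}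

/-- Expansion of the transported source term. -/
lemma exists_source_expansion (hU : IsOpen U) (hΩ : IsOpen Ω) (hf : MemH1 U f)
    (hθ : ContDiff ℝ 1 θ) (hM : LipschitzWith M θ) (hB : ∀ x, ‖θ x‖₊ ≤ B) (hδ : 0 < δ)
    (hΩU : ∀ t ∈ Ioo (-δ) δ, perturbed Ω θ t ⊆ U) (hC0 : 0 ≤ C) (ht₀ : 0 < t₀)
    (hCd : ∀ x, |divergence θ x| ≤ C)
    (hT : ∀ t : ℝ, |t| ≤ t₀ → ∃ S, IsLipDiffeo (fun x => x + t • θ x) S 2)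
    (hJ : ∀ t : ℝ, |t| ≤ t₀ → ∀ x,
      |(|(fderiv ℝ (fun x => x + t • θ x) x).det| - 1 - t * divergence θ x)| ≤ C * t ^ 2)
    {ε : ℝ} (hε : 0 < ε) : ∃ τ > 0, ∀ t : ℝ, |t| ≤ τ →
      (eLpNorm (fun x => |(fderiv ℝ (fun x => x + t • θ x) x).det| * f (x + t • θ x) - f x -
        t * (divergence θ x * f x + inner ℝ (weakGrad U f x) (θ x))) 2
          (volume.restrict Ω)).toReal ≤ ε * |t| := by
  have hΩU0 : Ω ⊆ U := by
    have := hΩU 0 (by constructor <;> linarith)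
    simpa [perturbed] using this
  have hμ : volume.restrict Ω ≤ (volume.restrict U : Measure Plane) :=
    Measure.restrict_mono hΩU0 le_rfl
  have hfΩ : MemLp f 2 (volume.restrict Ω) := hf.1.mono_measure hμ
  obtain ⟨-, hNL⟩ := memLp_sourceDerivative hθ hB hCd hfΩ (hf.memLp_weakGrad.mono_measure hμ)
  set nf := (eLpNorm f 2 (volume.restrict Ω)).toReal with hnf
  set N := (eLpNorm (fun x => inner ℝ (weakGrad U f x) (θ x)) 2 (volume.restrict Ω)).toReal
    with hN
  have hnf0 : 0 ≤ nf := ENNReal.toReal_nonneg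
  have hN0 : 0 ≤ N := ENNReal.toReal_nonneg
  let ε' : NNReal := ⟨ε / (2 * (B + 1)), by positivity⟩
  have hε' : ε' ≠ 0 := by
    refine ne_of_gt (NNReal.coe_pos.1 ?_)
    change 0 < ε / (2 * (B + 1))
    positivity
  have hBε : (B : ℝ) * ε' ≤ ε / 2 := by
    change (B : ℝ) * (ε / (2 * (B + 1))) ≤ ε / 2
    rw [mul_div_assoc', div_le_div_iff₀ (by positivity) (by norm_num)]
    nlinarith [NNReal.coe_nonneg B]
  obtain ⟨τ₁, hτ₁, h1⟩ := exists_eLpNorm_difference_le hU hΩ hf hθ hM hB hδ hΩU hε'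
  -- `Q` dominates the coefficients of t² below; the difference quotient of `f` consumes one half of
  -- ε|t|, the quadratic terms the other.
  set Q := C * nf + 2 * C * (ε + N) + 1 with hQ
  have hQ0 : 0 < Q := by positivity
  refine ⟨min (min τ₁ t₀) (min (min 1 (δ / 2)) (ε / (2 * Q))), by positivity, fun t ht => ?_⟩
  have ht1 : |t| ≤ τ₁ := ht.trans ((min_le_left _ _).trans (min_le_left _ _))
  have ht2 : |t| ≤ t₀ := ht.trans ((min_le_left _ _).trans (min_le_right _ _))
  have ht3 : |t| ≤ 1 := ht.trans ((min_le_right _ _).trans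
    ((min_le_left _ _).trans (min_le_left _ _)))
  have ht4 : |t| < δ := (ht.trans ((min_le_right _ _).trans
    ((min_le_left _ _).trans (min_le_right _ _)))).trans_lt (by linarith)
  have ht5 : |t| * Q ≤ ε / 2 := by
    have h := ht.trans ((min_le_right _ _).trans (min_le_right _ _))
    rw [le_div_iff₀ (by positivity)] at h
    linarith
  have hta := abs_nonneg t
  obtain ⟨S, hS⟩ := hT t ht2
  have hfT : MemLp (fun x => f (x + t • θ x)) 2 (volume.restrict Ω) :=
    memLp_comp_of_map_le hS.measurable (hS.map_volume_le Ω) (by finiteness)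
      (hf.1.mono_measure (Measure.restrict_mono (hΩU t (abs_lt.1 ht4)) le_rfl))
  set D : Plane → ℝ := fun x => f (x + t • θ x) - f x - t * inner ℝ (weakGrad U f x) (θ x) with hD
  have hDL : MemLp D 2 (volume.restrict Ω) := (hfT.sub hfΩ).sub (hNL.const_mul t)
  have hDn : (eLpNorm D 2 (volume.restrict Ω)).toReal ≤ |t| * (ε / 2) := by
    have h2 := ENNReal.toReal_mono (by finiteness) (h1 t ht1)
    rw [ENNReal.toReal_mul, ENNReal.toReal_ofReal hta, ENNReal.toReal_mul,
      ENNReal.coe_toReal, ENNReal.coe_toReal] at h2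
    refine h2.trans ?_
    gcongr
  have hbd : ∀ x, ‖|(fderiv ℝ (fun x => x + t • θ x) x).det| * f (x + t • θ x) - f x -
        t * (divergence θ x * f x + inner ℝ (weakGrad U f x) (θ x))‖ ≤
      (1 + 2 * C * |t|) * ‖D x‖ + C * t ^ 2 * ‖f x‖ +
        2 * C * |t| * |t| * ‖(inner ℝ (weakGrad U f x) (θ x) : ℝ)‖ := by
    intro x
    set J := |(fderiv ℝ (fun x => x + t • θ x) x).det| with hJd
    have hr := hJ t ht2 x
    rw [← hJd] at hr
    have hJ1 : |J - 1| ≤ 2 * C * |t| := by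
      have h2 : |J - 1| ≤ |J - 1 - t * divergence θ x| + |t * divergence θ x| := by
        simpa using abs_add_le (J - 1 - t * divergence θ x) (t * divergence θ x)
      have h3 : |t * divergence θ x| ≤ |t| * C := by
        rw [abs_mul]; gcongr; exact hCd x
      have h4 : C * t ^ 2 ≤ C * |t| := by
        rw [← sq_abs]; gcongr; nlinarith
      linarith
    -- The product is expanded so that each term contains either the remainder `D` of `f`, the
    -- remainder of the Jacobian, or a product of two quantities of order t.
    have e : J * f (x + t • θ x) - f x -
        t * (divergence θ x * f x + inner ℝ (weakGrad U f x) (θ x)) =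
        D x + (J - 1) * D x + (J - 1 - t * divergence θ x) * f x +
          (J - 1) * t * inner ℝ (weakGrad U f x) (θ x) := by
      rw [hD]; ring
    rw [e]
    refine (norm_add_le _ _).trans (add_le_add ((norm_add_le _ _).trans
      (add_le_add ((norm_add_le _ _).trans ?_) ?_)) ?_)
    · rw [add_mul, one_mul, norm_mul, Real.norm_eq_abs (J - 1)]
      gcongr
    · rw [norm_mul, Real.norm_eq_abs (J - 1 - _)]
      gcongr
    · rw [norm_mul, norm_mul, Real.norm_eq_abs (J - 1), Real.norm_eq_abs t]
      gcongr
  have hfin := toReal_eLpNorm_le_add_mul hDL hfΩ hNL (by positivity) (by positivity)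
    (by positivity) hbd
  rw [← hnf, ← hN] at hfin
  refine hfin.trans ?_
  have h5 : (1 + 2 * C * |t|) * (eLpNorm D 2 (volume.restrict Ω)).toReal ≤
      (1 + 2 * C * |t|) * (|t| * (ε / 2)) := by gcongr
  have h6 : |t| * (|t| * Q) ≤ |t| * (ε / 2) := by gcongr
  have h7 : 0 ≤ C * ε * (|t| * |t|) := by positivity
  rw [← sq_abs t]
  rw [hQ] at h6
  nlinarith [mul_nonneg hta hta]

end Expansion

/-- The trace and Poincaré inequalities combined: the gradient alone controls the boundary norm, so
the boundary square in the Lagrangian inherits the order t² from the energy estimate. -/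
lemma toReal_eLpNorm_trace_le {Ω Γf : Set Plane} {Ct P : NNReal} {e : Plane → ℝ}
    (hC : ∀ φ : Plane → ℝ, ContDiff ℝ 1 φ → eLpNorm φ 2 (arcLength Γf) ≤
      Ct * (eLpNorm φ 2 (volume.restrict Ω) + eLpNorm (gradient φ) 2 (volume.restrict Ω)))
    (hP : eLpNorm e 2 (volume.restrict Ω) ≤ P * eLpNorm (weakGrad Ω e) 2 (volume.restrict Ω))
    {g : Plane → ℝ} (he : HasTrace Ω Γf e g) :
    (eLpNorm g 2 (arcLength Γf)).toReal ≤
      Ct * (P + 1) * (eLpNorm (weakGrad Ω e) 2 (volume.restrict Ω)).toReal := by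
  have hfin := he.1.memLp_weakGrad.2.ne
  have h1 : eLpNorm g 2 (arcLength Γf) ≤
      Ct * ((P + 1) * eLpNorm (weakGrad Ω e) 2 (volume.restrict Ω)) := by
    refine (he.eLpNorm_le hC).trans ?_
    rw [add_mul, one_mul]
    gcongr
  have h2 := ENNReal.toReal_mono (by finiteness) h1
  rw [ENNReal.toReal_mul, ENNReal.toReal_mul, ENNReal.toReal_add (by simp) (by simp)] at h2
  rw [mul_assoc]
  simpa using h2

/-- The final arithmetic. Here I = ∫ ∇e·∇p, J and K are the first order terms from the coefficients
and from the source, b = h⁻¹, `n₁` is the norm of the trace of e, and `n₂` the norm of the source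
remainder. -/
lemma abs_remainder_le {C CE ct nX nY np ε t I J K b nE n₁ n₂ : ℝ} (hC : 0 ≤ C) (hct : 0 ≤ ct)
    (hnY : 0 ≤ nY) (hnp : 0 ≤ np) (hε : 0 < ε) (hn₁ : 0 ≤ n₁)
    (hlin : |I + t * J - t * K| ≤ (2 * C * |t| * nE + C * t ^ 2 * nX) * nY + n₂ * np)
    (hE : nE ≤ CE * |t|) (htr : n₁ ≤ ct * nE) (h₂ : n₂ ≤ ε / (2 * (np + 1)) * |t|)
    (ht : |t| * ((2 * C * CE + C * nX) * nY + 1 / 2 * |b| * (ct * CE) ^ 2 + 1) ≤ ε / 2) :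
    |I + 1 / 2 * b * n₁ ^ 2 - t * (K - J)| ≤ ε * |t| := by
  have hta := abs_nonneg t
  have htsq : t ^ 2 = |t| * |t| := by rw [← sq_abs]; ring
  have htr2 : n₁ ≤ ct * (CE * |t|) := htr.trans (by gcongr)
  have b1 : |1 / 2 * b * n₁ ^ 2| ≤ 1 / 2 * |b| * (ct * CE) ^ 2 * (|t| * |t|) := by
    rw [abs_mul, abs_mul, abs_of_nonneg (sq_nonneg n₁), abs_of_pos (by norm_num : (0:ℝ) < 1 / 2)]
    calc _ ≤ 1 / 2 * |b| * (ct * (CE * |t|)) ^ 2 := by gcongr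
      _ = _ := by ring
  have b2 : n₂ * np ≤ ε / 2 * |t| := by
    calc _ ≤ ε / (2 * (np + 1)) * |t| * np := by gcongr
      _ = ε / 2 * |t| * (np / (np + 1)) := by field_simp
      _ ≤ ε / 2 * |t| * 1 := by
        gcongr
        rw [div_le_one (by positivity)]
        linarith
      _ = _ := by ring
  have b3 : (2 * C * |t| * nE + C * t ^ 2 * nX) * nY ≤
      (2 * C * CE + C * nX) * nY * (|t| * |t|) := by
    calc _ ≤ (2 * C * |t| * (CE * |t|) + C * t ^ 2 * nX) * nY := by gcongr
      _ = _ := by rw [htsq]; ring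
  have b4 := mul_le_mul_of_nonneg_left ht hta
  have b5 : 0 ≤ |t| * |t| := by positivity
  have b6 : I + 1 / 2 * b * n₁ ^ 2 - t * (K - J) =
      (I + t * J - t * K) + 1 / 2 * b * n₁ ^ 2 := by ring
  rw [b6]
  refine (abs_add_le _ _).trans ((add_le_add hlin b1).trans ?_)
  linarith

set_option maxHeartbeats 1600000 in
/-- The expansion of the Lagrangian for a globally bounded and Lipschitz velocity field. -/
lemma exists_lagrangian_remainder_le {Γ Ω : Set Plane} (hΩ : IsOpen Ω)
    (hconn : IsPreconnected Ω) (hb : Bornology.IsBounded Ω) (hL : HasLipschitzBoundary Ω)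
    (hΓ : IsCompact Γ) (hsub : Γ ⊆ frontier Ω) (hne : (freeBoundary Γ Ω).Nonempty) {κ : ℝ}
    {gD : Plane → ℝ} (hgD : MemHHalf Γ gD) {gN : HMinusHalf Γ}
    {θ : Plane → Plane} (hθ : ContDiff ℝ 1 θ) (hθ0 : ∀ x ∈ Γ, θ x = 0)
    {M B : NNReal} (hM : LipschitzWith M θ) (hB : ∀ x, ‖θ x‖₊ ≤ B) {δ : ℝ} (hδ : 0 < δ)
    {U : Set Plane} (hU : IsOpen U) (hΩU : ∀ t ∈ Ioo (-δ) δ, perturbed Ω θ t ⊆ U)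
    {f : Plane → ℝ} (hf : MemH1 U f) {u p : ℝ → Plane → ℝ}
    (hu : ∀ t ∈ Ioo (-δ) δ, IsState Γ f gN (perturbed Ω θ t) (u t))
    (hp : ∀ t ∈ Ioo (-δ) δ, IsAdjoint Γ κ gD (perturbed Ω θ t) (u t) (p t))
    {ε : ℝ} (hε : 0 < ε) : ∃ τ > 0, ∀ t : ℝ, |t| < τ →
      |lagrangian Γ κ f gD gN (perturbed Ω θ t) (u t) (p t)
          - lagrangian Γ κ f gD gN Ω (u 0) (p 0)
          - t * ((∫ x in Ω, (divergence θ x * f x + inner ℝ (weakGrad U f x) (θ x)) * p 0 x) -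
            ∫ x in Ω, inner ℝ (firstOrderField θ x (weakGrad Ω (u 0) x)) (weakGrad Ω (p 0) x))| ≤
        ε * |t| := by
  have h0 : perturbed Ω θ 0 = Ω := by simp [perturbed]
  have hδ0 : (0 : ℝ) ∈ Ioo (-δ) δ := ⟨by linarith, hδ⟩
  have hu0 := hu 0 hδ0
  have hp0 := hp 0 hδ0
  have hΩU0 := hΩU 0 hδ0
  rw [h0] at hu0 hp0 hΩU0
  have hμ : volume.restrict Ω ≤ (volume.restrict U : Measure Plane) :=
    Measure.restrict_mono hΩU0 le_rfl
  have hfΩ : MemLp f 2 (volume.restrict Ω) := hf.1.mono_measure hμ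
  obtain ⟨C, t₀, hC0, ht₀, hCd, hCA, hexp⟩ := exists_expansion hθ hM
  obtain ⟨Ct, hCt⟩ :=
    exists_trace_inequality_eLpNorm hΩ hL hΓ hsub
  obtain ⟨P, hP⟩ := exists_poincare_memV hΩ hconn hb
    hL hΓ.isClosed hne
  obtain ⟨hN1, hN2⟩ := memLp_sourceDerivative hθ hB hCd hfΩ (hf.memLp_weakGrad.mono_measure hμ)
  set φ : Plane → ℝ := fun x => divergence θ x * f x + inner ℝ (weakGrad U f x) (θ x) with hφ
  have hφL : MemLp φ 2 (volume.restrict Ω) := hN1.add hN2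
  have hsrc := fun {ε : ℝ} (hε : 0 < ε) => exists_source_expansion hU hΩ hf hθ hM hB hδ
    hΩU hC0 ht₀ hCd (fun t ht => (hexp t ht).imp fun S hS => hS.1)
    (fun t ht x => ((hexp t ht).choose_spec.2 x).1) hε
  set X := weakGrad Ω (u 0) with hX
  set Y := weakGrad Ω (p 0) with hY
  have hXL : MemLp X 2 (volume.restrict Ω) := hu0.1.1.memLp_weakGrad
  have hYL : MemLp Y 2 (volume.restrict Ω) := hp0.1.1.memLp_weakGrad
  have hpL : MemLp (p 0) 2 (volume.restrict Ω) := hp0.1.1.1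
  set nX := (eLpNorm X 2 (volume.restrict Ω)).toReal with hnX
  set nY := (eLpNorm Y 2 (volume.restrict Ω)).toReal with hnY
  set nφ := (eLpNorm φ 2 (volume.restrict Ω)).toReal with hnφ
  set np := (eLpNorm (p 0) 2 (volume.restrict Ω)).toReal with hnp
  have hnX0 : 0 ≤ nX := ENNReal.toReal_nonneg
  have hnY0 : 0 ≤ nY := ENNReal.toReal_nonneg
  have hnφ0 : 0 ≤ nφ := ENNReal.toReal_nonneg
  have hnp0 : 0 ≤ np := ENNReal.toReal_nonneg
  -- The constant in ‖∇e‖ ≤ CE|t|, read off from `energy_error_le` with a = 2C|t| and a source of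
  -- norm at most (1 + nφ)|t|. `Q` then collects the coefficients of t² in the remainder.
  set CE := 2 * (2 * C * nX + P * (1 + nφ)) with hCE
  have hCE0 : 0 ≤ CE := by positivity
  set Q := (2 * C * CE + C * nX) * nY + 1 / 2 * |κ⁻¹| * (Ct * (P + 1) * CE) ^ 2 + 1 with hQ
  have hQ0 : 0 < Q := by positivity
  -- The source expansion enters twice: with tolerance 1 for the rate of the state, and with one
  -- adapted to `ε` and the norm of the adjoint for the final remainder.
  obtain ⟨τ₁, hτ₁, h1⟩ := hsrc one_pos
  obtain ⟨τ₂, hτ₂, h2⟩ := hsrc (ε := ε / (2 * (np + 1))) (by positivity)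
  refine ⟨min (min (min τ₁ τ₂) (min t₀ δ)) (min (min 1 (1 / (4 * (C + 1)))) (ε / (2 * Q))),
    by positivity, fun t ht => ?_⟩
  simp only [lt_min_iff] at ht
  obtain ⟨⟨⟨ht1, ht2⟩, ht3, ht4⟩, ⟨ht5, ht6⟩, ht7⟩ := ht
  rw [lt_div_iff₀ (by positivity)] at ht6 ht7
  have hta := abs_nonneg t
  have htδ : t ∈ Ioo (-δ) δ := abs_lt.1 ht4
  obtain ⟨S, hS, hSx⟩ := hexp t ht3.le
  set T : Plane → Plane := fun x => x + t • θ x with hTdef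
  have hT : ∀ x ∈ Γ, T x = x := fun x hx => by rw [hTdef]; simp [hθ0 x hx]
  have hut : IsState Γ f gN (T '' Ω) (u t) := hu t htδ
  have hpt : IsAdjoint Γ κ gD (T '' Ω) (u t) (p t) := hp t htδ
  have hfT : MemLp f 2 (volume.restrict (T '' Ω)) :=
    hf.1.mono_measure (Measure.restrict_mono (hΩU t htδ) le_rfl)
  set e : Plane → ℝ := fun x => u t (T x) - u 0 x with he
  have heV : MemV Γ Ω e := (hut.1.comp hS hT hΩ hb).sub hΩ
    hb hu0.1
  set E := weakGrad Ω e with hE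
  have hEL : MemLp E 2 (volume.restrict Ω) := heV.1.memLp_weakGrad
  set nE := (eLpNorm E 2 (volume.restrict Ω)).toReal with hnE
  have hnE0 : 0 ≤ nE := ENNReal.toReal_nonneg
  have htsq : t ^ 2 = |t| * |t| := by rw [← sq_abs]; ring
  have ha : ∀ x, ‖pullbackField T S x - 1‖ ≤ 2 * C * |t| := by
    intro x
    have h3 : ‖pullbackField T S x - 1‖ ≤ ‖pullbackField T S x - 1 - t • firstOrderField θ x‖ +
        ‖t • firstOrderField θ x‖ := by
      simpa using norm_add_le (pullbackField T S x - 1 - t • firstOrderField θ x)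
        (t • firstOrderField θ x)
    have h4 : ‖t • firstOrderField θ x‖ ≤ |t| * C := by
      rw [norm_smul, Real.norm_eq_abs]; gcongr; exact hCA x
    have h5 := (hSx x).2
    have h6 : C * t ^ 2 ≤ C * |t| := by
      rw [htsq]
      exact mul_le_mul_of_nonneg_left (mul_le_of_le_one_right hta ht5.le) hC0
    linarith
  have ha2 : 2 * C * |t| ≤ 1 / 2 := by linarith
  have haA : ∀ x, ‖pullbackField T S x‖ ≤ 2 * C * |t| + 1 := by
    intro x
    have h3 : ‖pullbackField T S x‖ ≤ ‖pullbackField T S x - 1‖ +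
        ‖(1 : Plane →L[ℝ] Plane)‖ := by
      simpa using norm_add_le (pullbackField T S x - 1) 1
    have h4 : ‖(1 : Plane →L[ℝ] Plane)‖ ≤ 1 := ContinuousLinearMap.norm_id_le
    linarith [ha x]
  have hJ : ∀ x, |(fderiv ℝ T x).det| ≤ 1 + |t| * C + C * t ^ 2 := by
    intro x
    have h3 := (abs_le.1 (hSx x).1).2
    have h4 : t * divergence θ x ≤ |t| * C :=
      (le_abs_self _).trans (by rw [abs_mul]; gcongr; exact hCd x)
    linarith
  have hFL := memLp_det_mul_comp_sub hS hJ hfΩ hfT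
  have heqn := fun {w : Plane → ℝ} (hw : MemV Γ Ω w) => IsState.pullback_sub hS hT hΩ
    hb hL hΓ hsub hJ haA hfΩ hfT hu0 hut hw
  set F : Plane → ℝ := fun x => |(fderiv ℝ T x).det| * f (T x) - f x with hF
  have hFn : (eLpNorm F 2 (volume.restrict Ω)).toReal ≤ (1 + nφ) * |t| := by
    have h3 : (eLpNorm (fun x => F x - t * φ x) 2 (volume.restrict Ω)).toReal ≤ 1 * |t| :=
      h1 t ht1.le
    have h4 := toReal_eLpNorm_add_le (hFL.sub (hφL.const_mul t)) (hφL.const_mul t)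
    have h5 : (eLpNorm (fun x => t * φ x) 2 (volume.restrict Ω)).toReal = |t| * nφ := by
      have h6 : eLpNorm (fun x => t * φ x) 2 (volume.restrict Ω) =
          ‖t‖ₑ * eLpNorm φ 2 (volume.restrict Ω) := eLpNorm_const_smul t φ 2 _
      rw [h6, ENNReal.toReal_mul, toReal_enorm, Real.norm_eq_abs]
    rw [h5] at h4
    simp only [Pi.sub_apply, sub_add_cancel] at h4
    change _ ≤ (eLpNorm (fun x => F x - t * φ x) 2 (volume.restrict Ω)).toReal + _ at h4
    linarith
  have hPe := hP e heV
  have hPr : (eLpNorm e 2 (volume.restrict Ω)).toReal ≤ P * nE := by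
    have h3 := ENNReal.toReal_mono (ENNReal.mul_ne_top ENNReal.coe_ne_top hEL.2.ne) hPe
    rwa [ENNReal.toReal_mul, ENNReal.coe_toReal] at h3
  have hEn : nE ≤ CE * |t| := by
    refine (energy_error_le (continuous_pullbackField hS) hXL hEL heV.1.1 hFL
      (NNReal.coe_nonneg P) ha ha2 hPr (heqn heV)).trans ?_
    have h3 : P * (eLpNorm F 2 (volume.restrict Ω)).toReal ≤ P * ((1 + nφ) * |t|) := by gcongr
    rw [hCE]
    linarith
  have hlin := linear_term_error_le (continuous_pullbackField hS) (continuous_firstOrderField hθ)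
    hXL hEL hYL hpL hFL hφL ha (fun x => (hSx x).2) hCA (heqn hp0.1)
  have htr := toReal_eLpNorm_trace_le hCt hPe
    (heV.hasTrace_trace hΩ hb hL hΓ hsub)
  have hLag := lagrangian_image_sub hS hT hΩ hb hL hΓ
    hsub hgD.1 hu0 hp0 hut hpt.1
  change lagrangian Γ κ f gD gN (perturbed Ω θ t) (u t) (p t) - _ = _ at hLag
  rw [hLag, dirichletForm]
  have h2t : (eLpNorm (fun x => F x - t * φ x) 2 (volume.restrict Ω)).toReal ≤
    ε / (2 * (np + 1)) * |t| := h2 t ht2.le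
  set ntr := (eLpNorm (trace Ω Γ e) 2 (arcLength Γ)).toReal with hntr
  have hntr0 : 0 ≤ ntr := ENNReal.toReal_nonneg
  have htQ : |t| * Q ≤ ε / 2 := by linarith
  exact abs_remainder_le hC0 (by positivity) hnY0 hnp0 hε hntr0 hlin hEn htr h2t htQ

/-- The first order term of the expansion, in terms of the symmetrized derivative. -/
lemma integral_firstOrder_eq {Ω : Set Plane} {θ : Plane → Plane} (hθ : ContDiff ℝ 1 θ)
    {M B : NNReal} (hM : LipschitzWith M θ) (hB : ∀ x, ‖θ x‖₊ ≤ B) {f p : Plane → ℝ}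
    {G X Y : Plane → Plane} (hf : MemLp f 2 (volume.restrict Ω))
    (hp : MemLp p 2 (volume.restrict Ω)) (hG : MemLp G 2 (volume.restrict Ω))
    (hX : MemLp X 2 (volume.restrict Ω)) (hY : MemLp Y 2 (volume.restrict Ω)) :
    (∫ x in Ω, divergence θ x * (f x * p x - inner ℝ (X x) (Y x)))
      + (∫ x in Ω, inner ℝ (X x) (symGrad θ x (Y x))) + ∫ x in Ω, inner ℝ (G x) (θ x) * p x =
    (∫ x in Ω, (divergence θ x * f x + inner ℝ (G x) (θ x)) * p x) -
      ∫ x in Ω, inner ℝ (firstOrderField θ x (X x)) (Y x) := by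
  obtain ⟨C, -, -, -, hCd, hCA, -⟩ := exists_expansion hθ hM
  obtain ⟨h1, h2⟩ := memLp_sourceDerivative hθ hB hCd hf hG
  have hS : Continuous (symGrad θ) :=
    (hθ.continuous_fderiv (by norm_num)).add (continuous_adjoint_fderiv hθ)
  have hSb : ∀ x, ‖symGrad θ x‖ ≤ 2 * M := fun x =>
    norm_symGrad_le (norm_fderiv_le_of_lipschitz ℝ hM)
  have i1 := integrable_mul_of_memLp h1 hp
  have i2 := integrable_mul_of_memLp h2 hp
  have i3 := integrable_inner_of_memLp hX (memLp_clm_apply hS hSb hY)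
  have i4 := integrable_inner_of_memLp
    (memLp_clm_apply (continuous_firstOrderField hθ) hCA hX) hY
  have hpt : ∀ x, inner ℝ (firstOrderField θ x (X x)) (Y x) =
      divergence θ x * inner ℝ (X x) (Y x) - inner ℝ (X x) (symGrad θ x (Y x)) := by
    intro x
    have e1 : firstOrderField θ x (X x) = divergence θ x • X x - (fderiv ℝ θ x (X x) +
      ContinuousLinearMap.adjoint (fderiv ℝ θ x) (X x)) := rfl
    have e2 : symGrad θ x (Y x) = fderiv ℝ θ x (Y x) +
      ContinuousLinearMap.adjoint (fderiv ℝ θ x) (Y x) := rfl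
    rw [e1, e2, inner_sub_left, inner_add_left, inner_add_right, real_inner_smul_left,
      ContinuousLinearMap.adjoint_inner_left, ContinuousLinearMap.adjoint_inner_right]
    ring
  have i5 : Integrable (fun x => divergence θ x * (f x * p x - inner ℝ (X x) (Y x)))
      (volume.restrict Ω) := by
    refine (i1.sub (i4.add i3)).congr (Eventually.of_forall fun x => ?_)
    dsimp only [Pi.sub_apply, Pi.add_apply]
    rw [hpt]
    ring
  have i6 : Integrable (fun x => (divergence θ x * f x + inner ℝ (G x) (θ x)) * p x)
      (volume.restrict Ω) :=
    integrable_mul_of_memLp (h1.add h2) hp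
  rw [← integral_sub i6 i4, ← integral_add i5 i3, ← integral_add]
  · refine integral_congr_ae (Eventually.of_forall fun x => ?_)
    dsimp only
    rw [hpt]
    ring
  · exact i5.add i3
  · exact i2

lemma divergence_congr {θ θ' : Plane → Plane} {x : Plane} (h : θ' =ᶠ[𝓝 x] θ) :
    divergence θ' x = divergence θ x := by
  rw [divergence, divergence, h.fderiv_eq]

lemma symGrad_congr {θ θ' : Plane → Plane} {x : Plane} (h : θ' =ᶠ[𝓝 x] θ) :
    symGrad θ' x = symGrad θ x := by
  rw [symGrad, symGrad, h.fderiv_eq]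

end BernoulliShape

open BernoulliShape
theorem lemma4p5
    (Ωhat Ω : Set Plane) (hΩhat_open : IsOpen Ωhat) (hΩhat_sc : IsSimplyConnected Ωhat)
    (hΩ : IsAdmissible Ωhat Ω)
    (h : ℝ) (hh : 0 < h)
    (gD : Plane → ℝ) (hgD : MemHHalf (frontier Ωhat) gD)
    (gN : HMinusHalf (frontier Ωhat))
    (θ : Plane → Plane) (hθ : ContDiff ℝ 1 θ) (hθ0 : ∀ x ∈ frontier Ωhat, θ x = 0)
    (δ : ℝ) (hδ : 0 < δ)
    (U : Set Plane) (hU : IsOpen U) (hΩU : ∀ t ∈ Set.Ioo (-δ) δ, perturbed Ω θ t ⊆ U)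
    (f : Plane → ℝ) (hf : MemH1 U f)
    (u p : ℝ → Plane → ℝ)
    (hu : ∀ t ∈ Set.Ioo (-δ) δ, IsState (frontier Ωhat) f gN (perturbed Ω θ t) (u t))
    (hp : ∀ t ∈ Set.Ioo (-δ) δ,
      IsAdjoint (frontier Ωhat) h gD (perturbed Ω θ t) (u t) (p t)) :
    Tendsto
      (fun t : ℝ => 1 / t *
        (lagrangian (frontier Ωhat) h f gD gN (perturbed Ω θ t) (u t) (p t)
          - lagrangian (frontier Ωhat) h f gD gN Ω (u 0) (p 0)))
      (𝓝[≠] 0)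
      (𝓝 ((∫ x in Ω, divergence θ x *
              (f x * p 0 x - inner ℝ (weakGrad Ω (u 0) x) (weakGrad Ω (p 0) x)))
          + (∫ x in Ω, inner ℝ (weakGrad Ω (u 0) x) (symGrad θ x (weakGrad Ω (p 0) x)))
          + ∫ x in Ω, inner ℝ (weakGrad Ω f x) (θ x) * p 0 x)) := by
  -- The cut-off field agrees with `θ` near every point of `Ω`, so neither the perturbed domains nor
  -- the coefficients on `Ω` change, and it still vanishes on the fixed boundary.
  obtain ⟨θ', hθ', ⟨M, hM⟩, ⟨B, hB⟩, hz, heq⟩ := exists_cutoff_field hθ hΩ.isBounded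
  have hpert : ∀ t, perturbed Ω θ t = perturbed Ω θ' t := fun t =>
    image_congr fun x hx => by rw [(heq x hx).eq_of_nhds]
  simp only [hpert] at hΩU hu hp ⊢
  have h0 : perturbed Ω θ' 0 = Ω := by simp [perturbed]
  have hδ0 : (0 : ℝ) ∈ Ioo (-δ) δ := ⟨by linarith, hδ⟩
  have hu0 := (hu 0 hδ0).1.1
  have hp0 := (hp 0 hδ0).1.1
  have hΩU0 := hΩU 0 hδ0
  rw [h0] at hu0 hp0 hΩU0
  have hμ : volume.restrict Ω ≤ (volume.restrict U : Measure Plane) :=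
    Measure.restrict_mono hΩU0 le_rfl
  have hGL := hf.memLp_weakGrad.mono_measure hμ
  have hG := (hf.weakGrad_spec.2.mono hΩU0).weakGrad_ae_eq hΩ.isOpen hGL
  have hmem := ae_restrict_mem (μ := (volume : Measure Plane)) hΩ.isOpen.measurableSet
  have c1 : ∫ x in Ω, divergence θ x *
        (f x * p 0 x - inner ℝ (weakGrad Ω (u 0) x) (weakGrad Ω (p 0) x)) =
      ∫ x in Ω, divergence θ' x *
        (f x * p 0 x - inner ℝ (weakGrad Ω (u 0) x) (weakGrad Ω (p 0) x)) := by
    refine integral_congr_ae ?_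
    filter_upwards [hmem] with x hx
    rw [divergence_congr (heq x hx)]
  have c2 : ∫ x in Ω, inner ℝ (weakGrad Ω (u 0) x) (symGrad θ x (weakGrad Ω (p 0) x)) =
      ∫ x in Ω, inner ℝ (weakGrad Ω (u 0) x) (symGrad θ' x (weakGrad Ω (p 0) x)) := by
    refine integral_congr_ae ?_
    filter_upwards [hmem] with x hx
    rw [symGrad_congr (heq x hx)]
  -- The weak gradients of `f` in `Ω` and in `U` are separate choices; uniqueness makes them equal
  -- almost everywhere in `Ω`.
  have c3 : ∫ x in Ω, inner ℝ (weakGrad Ω f x) (θ x) * p 0 x =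
      ∫ x in Ω, inner ℝ (weakGrad U f x) (θ' x) * p 0 x := by
    refine integral_congr_ae ?_
    filter_upwards [hmem, hG] with x hx hx2
    rw [(heq x hx).eq_of_nhds, hx2]
  rw [c1, c2, c3, integral_firstOrder_eq hθ' hM hB (hf.1.mono_measure hμ) hp0.1 hGL
    hu0.memLp_weakGrad hp0.memLp_weakGrad, Metric.tendsto_nhdsWithin_nhds]
  intro ε hε
  have hΓ : IsCompact (frontier Ωhat) :=
    Metric.isCompact_of_isClosed_isBounded isClosed_frontier
      (hΩ.isBounded.closure.subset (hΩ.fixed_subset.trans frontier_subset_closure))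
  obtain ⟨τ, hτ, hτb⟩ := exists_lagrangian_remainder_le hΩ.isOpen hΩ.isConnected.isPreconnected
    hΩ.isBounded hΩ.lipschitz hΓ hΩ.fixed_subset hΩ.free_nonempty (κ := h) hgD hθ'
    (fun x hx => hz x (hθ0 x hx)) hM hB hδ hU hΩU hf hu hp (half_pos hε)
  refine ⟨τ, hτ, fun {t} ht0 ht => ?_⟩
  have ht0' : t ≠ 0 := ht0
  rw [dist_zero_right, Real.norm_eq_abs] at ht
  have hpos : 0 < |t| := abs_pos.2 ht0'
  have key := hτb t ht
  rw [Real.dist_eq]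
  -- Multiplication by |t| removes the difference quotient; the remainder was bounded with ε/2 to
  -- make the inequality strict.
  refine lt_of_mul_lt_mul_left ?_ hpos.le
  rw [← abs_mul, mul_sub, one_div, mul_inv_cancel_left₀ ht0']
  exact key.trans_lt (by nlinarith)
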